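/- **Setting.** For every $n$ let $\mathcal X,\mathcal Y$ be separable real Hilbert spaces of dimensions $d_{\mathcal X},d_{\mathcal Y}\in\{1,2,\dots,\infty\}$, and let $(X_1,Y_1),\dots,(X_n,Y_n)$ be i.i.d. with $Y_i=\beta(X_i)+Z_i$, where $\beta$ is Hilbert–Schmidt, $X_i$ and $Z_i$ are independent and centered, $\mathbb E\|X_i\|^4<\infty$, $\mathbb E\|Z_i\|^2<\infty$. (The spaces and the model may change with $n$.) Let $\lambda_1\ge\lambda_2\ge\dots>0$ and $\rho_1\ge\rho_2\ge\dots>0$ be the eigenvalues of $C_X=\mathbb E(X\otimes X)$ and $C_Y=\mathbb E(Y\otimes Y)$, with complete orthonormal systems of eigenelements $\phi_{j_1}$, $\psi_{j_2}$; $b_{j_1j_2}=\langle\beta\phi_{j_1},\psi_{j_2}\rangle$. Let $1\le p_1\le d_{\mathcal X}$, $1\le p_2\le d_{\mathcal Y}$ be integers, $p=p_1p_2$, and assume $p\to\infty$ as $n\to\infty$. All constants hidden in $\lesssim,\asymp$ and the constants $K$, $c$ do not depend on $n$. Fix $\tau\in[0,1)$, $\delta\in(0,1/2)$, $\alpha_1,\alpha_2>2$,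 $\alpha_0\in(0,1)$, $\delta_0>0$, and a real constant $\tilde\alpha$; put $\bar\alpha=\max\{\alpha_1,\alpha_2\}$, $\underline\alpha=\min\{\alpha_1,\alpha_2\}$, $a=\max\{4,3\underline\alpha(1-\tau)\}$, $k_n=\lceil \min\{n^{\delta/a},p\}\rceil$, $a_n=(k_n^{\bar\alpha}p^{\alpha_0})^{-1}$, $m_n=\min\{p,\lceil k_n^{(\bar\alpha-\tilde\alpha)/2+\delta_0}+k_n\rceil\}$. For orthonormal $\tilde\phi=(\tilde\phi_1,\dots,\tilde\phi_{p_1})$ in $\mathcal X$ and $\tilde\psi=(\tilde\psi_1,\dots,\tilde\psi_{p_2})$ in $\mathcal Y$ let $V_i(\tilde\phi,\tilde\psi)\in\mathbb R^p$ have the coordinates $\langle X_i,\tilde\phi_{j_1}\rangle\langle Y_i,\tilde\psi_{j_2}\rangle$, $j=(j_1,j_2)$; let $\sigma_j^2$ be the variance of its $j$th coordinate, $\sigma_{\max}=\max_j\sigma_j$, $\bar V$ the sample mean, $\hat\Sigma=n^{-1}\sum_i(V_i-\bar V)(V_i-\bar V)^\top$ and $\hat\sigma_j^2=\hat\Sigma_{jj}$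 (all depending on $(\tilde\phi,\tilde\psi)$). Put $T_U=\max_j\sqrt n\bar V_j/\hat\sigma_j^\tau$, $T_L=\min_j\sqrt n\bar V_j/\hat\sigma_j^\tau$. Given the data let $S^\star\sim N_p(0,\hat\Sigma)$, and let $\hat q_M(r)$, $\hat q_L(r)$ be the $r$-quantiles of the conditional laws of $M^\star=\max_jS^\star_j/\hat\sigma^\tau_j$ and $L^\star=\min_jS^\star_j/\hat\sigma^\tau_j$ given the data. Let $W_p(\tilde\phi,\tilde\psi)$ be the Kronecker product of the matrices $(\langle\phi_k,\tilde\phi_l\rangle)_{k,l\le p_1}$ and $(\langle\psi_k,\tilde\psi_l\rangle)_{k,l\le p_2}$, and, for a constant $C_{\mathcal F}>0$, let $\mathcal F_p$ be the set of all pairs of orthonormal sequences such that every entry of $W_p(\tilde\phi,\tilde\psi)-I_p$ is at most $C_{\mathcal F}a_n$ in absolute value. **Assumptions.** 1. (Tails) With $V_1^\infty=(\langle X_1,\phi_{j_1}\rangle\langle Y_1,\psi_{j_2}\rangle)_{j_1,j_2}$ and $\|\xi\|_{\psi_2}=\inf\{t>0:\mathbb E e^{\xi^2/t^2}\le2\}$,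 there is $K>0$ with $\|\langle V_1^\infty,t\rangle\|_{\psi_2}\le K\,\mathrm{var}(\langle V_1^\infty,t\rangle)^{1/2}$ for all $t\in\ell^2$. 2. (Structure) $\lambda_{j_1}\asymp j_1^{-\alpha_1}$, $\rho_{j_2}\asymp j_2^{-\alpha_2}$, $\max_{j_1}b_{j_1j_2}^2\lesssim\rho_{j_2}$ for all $j_2$. If $R(m_n)$ is the correlation matrix of the $m_n$ coordinates of $V_1(\phi,\psi)$ with the largest variances, then every $k_n\times k_n$ sub-matrix $R^\circ$ of $R(m_n)$ satisfies $\|R^\circ\|_F^2\lesssim k_n^{2-\delta}$. 3. (Growth) $p^{2\alpha_0}\max\{p_1,p_2\}^{2(\bar\alpha+1)}\ln p\lesssim n/k_n^{2\bar\alpha}$ and $p\lesssim k_n^{\bar\alpha/2}n^{1/4}$; $p_1\gtrsim k_n^{\bar\alpha/(\underline\alpha-1)}$ unless $p_1=d_{\mathcal X}$, and $p_2\gtrsim k_n^{\bar\alpha/(\underline\alpha-1)}$ unless $p_2=d_{\mathcal Y}$; $p_1\asymp p_2$ when $d_{\mathcal X}=d_{\mathcal Y}=\infty$. **Theorem.**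 Under these assumptions: (1) for each fixed $\varrho\in(0,1)$ there is $c>0$ not depending on $n$ such that, with probability at least $1-cn^{-1}$, $\sup_{(\tilde\phi,\tilde\psi)\in\mathcal F_p}|\hat q_{M(\tilde\phi,\tilde\psi)}(\varrho)|\le c(\log n)^{1/2}$; (2) there is $c>0$ not depending on $n$ such that $$\mathbb P\Big(\sup_{(\tilde\phi,\tilde\psi)\in\mathcal F_p}\frac{\max_j\hat\sigma_j^2(\tilde\phi,\tilde\psi)}{\sigma_{\max}^2(\tilde\phi,\tilde\psi)}<5\Big)\ge1-cn^{-1}.$$ (3) Consequently, for each $\varrho\in(0,1)$, if $\max_{j_1\le p_1,\,j_2\le p_2}|\lambda_{j_1}b_{j_1j_2}|\gtrsim\max\{\sigma_{\max}(\phi,\psi)n^{-1/2}\log^{1/2}n,\;a_n\}$, then, as $n\to\infty$, $$\mathbb P\Big(\forall(\tilde\phi,\tilde\psi)\in\mathcal F_p:\ T_U(\tilde\phi,\tilde\psi)>\hat q_{M(\tilde\phi,\tilde\psi)}(1-\varrho/2)\ \text{or}\ T_L(\tilde\phi,\tilde\psi)<\hat q_{L(\tilde\phi,\tilde\psi)}(\varrho/2)\Big)\to1.$$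 -/

import Mathlib

open MeasureTheory ProbabilityTheory Filter Topology
open scoped ENNReal RealInnerProductSpace Kronecker

noncomputable section

namespace FLMTest

/-! ### General notions -/

/-- Indices of a complete orthonormal system of a Hilbert space of dimension `d ≤ ∞`
(numbered from `0`). -/
abbrev Idx (d : ℕ∞) : Type := {j : ℕ // (j : ℕ∞) < d}

/-- The inclusion of the first `p ≤ d` indices. -/
def Idx.ofFin {p : ℕ} {d : ℕ∞} (h : (p : ℕ∞) ≤ d) (k : Fin p) : Idx d :=
  ⟨k, lt_of_lt_of_le (by exact_mod_cast k.isLt) h⟩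

/-- Inner probability; it equals `P A` when `A` is measurable and `P` is a probability measure.
It is used for events given by uncountably many conditions. -/
def innerProb {Ω : Type*} [MeasurableSpace Ω] (P : Measure Ω) (A : Set Ω) : ℝ≥0∞ :=
  1 - P Aᶜ

/-- The `ψ_q`-Orlicz norm `inf {t > 0 : E exp (|ξ|^q / t^q) ≤ 2}`, with value `∞` when there is no
such `t`. -/
def orliczNorm {Ω : Type*} [MeasurableSpace Ω] (q : ℕ) (ξ : Ω → ℝ) (P : Measure Ω) : ℝ≥0∞ :=
  sInf {r | ∃ t : ℝ, 0 < t ∧ r = ENNReal.ofReal t ∧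
    ∫⁻ ω, ENNReal.ofReal (Real.exp (|ξ ω| ^ q / t ^ q)) ∂P ≤ 2}

/-- Hilbert--Schmidt operators: `∑ ‖T e_i‖² < ∞` for some (equivalently, every) complete
orthonormal system. -/
def IsHilbertSchmidt {E F : Type*} [NormedAddCommGroup E] [InnerProductSpace ℝ E]
    [NormedAddCommGroup F] [InnerProductSpace ℝ F] (T : E →L[ℝ] F) : Prop :=
  ∃ (s : Set E) (e : HilbertBasis s ℝ E), Summable fun i => ‖T (e i)‖ ^ 2

/-- The covariance operator `E (ξ ⊗ ξ)` of a centered random element `ξ`. -/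
def covOp {Ω E : Type*} [MeasurableSpace Ω] [NormedAddCommGroup E] [InnerProductSpace ℝ E]
    (ξ : Ω → E) (P : Measure Ω) : E →L[ℝ] E :=
  ∫ ω, InnerProductSpace.rankOne ℝ (ξ ω) (ξ ω) ∂P

/-- The (lower) quantile function `inf {t : μ (-∞, t] ≥ r}` of a law on the real line. -/
def quantile (μ : Measure ℝ) (r : ℝ) : ℝ :=
  sInf {t : ℝ | ENNReal.ofReal r ≤ μ (Set.Iic t)}

/-- Division of real numbers with values in `[-∞, ∞]`, where `x / 0` is `∞`, `-∞` or `0` according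
to the sign of `x`. -/
def exDiv (x s : ℝ) : EReal :=
  if s = 0 then (if 0 < x then ⊤ else if x < 0 then ⊥ else 0) else ((x / s : ℝ) : EReal)

/-! ### The functional linear model `Y = β X + Z` -/

/-- The objects of a (centered) functional linear model, for one sample size: a sequence of
predictors and errors, the slope operator, eigenelements and eigenvalues of the covariance
operators of `X` and `Y`, and the truncation levels `p₁ ≤ d_X` and `p₂ ≤ d_Y`. -/
structure Model (𝒳 𝒴 Ω : Type*) [NormedAddCommGroup 𝒳] [InnerProductSpace ℝ 𝒳]
    [NormedAddCommGroup 𝒴] [InnerProductSpace ℝ 𝒴] where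
  dX : ℕ∞
  dY : ℕ∞
  X : ℕ → Ω → 𝒳
  Z : ℕ → Ω → 𝒴
  β : 𝒳 →L[ℝ] 𝒴
  φ : HilbertBasis (Idx dX) ℝ 𝒳
  ψ : HilbertBasis (Idx dY) ℝ 𝒴
  lam : Idx dX → ℝ
  rho : Idx dY → ℝ
  p₁ : ℕ
  p₂ : ℕ
  p₁_pos : 0 < p₁
  p₂_pos : 0 < p₂
  p₁_le : (p₁ : ℕ∞) ≤ dX
  p₂_le : (p₂ : ℕ∞) ≤ dY

namespace Model

variable {𝒳 𝒴 Ω : Type*} [NormedAddCommGroup 𝒳] [InnerProductSpace ℝ 𝒳]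
  [NormedAddCommGroup 𝒴] [InnerProductSpace ℝ 𝒴]

/-- The response of the `i`-th subject. -/
def Y (D : Model 𝒳 𝒴 Ω) (i : ℕ) (ω : Ω) : 𝒴 := D.β (D.X i ω) + D.Z i ω

/-- The standing assumptions on the model: i.i.d. data, a centered predictor with finite fourth
moment, a centered error with finite variance that is independent of the predictor, a
Hilbert--Schmidt slope operator, and the spectral decompositions of the covariance operators. -/
structure IsFLM [MeasurableSpace Ω] [MeasurableSpace 𝒳] [MeasurableSpace 𝒴]
    (D : Model 𝒳 𝒴 Ω) (P : Measure Ω) : Prop where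
  measurable_X : ∀ i, Measurable (D.X i)
  measurable_Z : ∀ i, Measurable (D.Z i)
  indep : iIndepFun (fun i ω => (D.X i ω, D.Y i ω)) P
  ident : ∀ i, IdentDistrib (fun ω => (D.X i ω, D.Y i ω)) (fun ω => (D.X 0 ω, D.Y 0 ω)) P P
  indep_error : IndepFun (D.X 0) (D.Z 0) P
  moment_X : MemLp (D.X 0) 4 P
  moment_Z : MemLp (D.Z 0) 2 P
  mean_X : ∫ ω, D.X 0 ω ∂P = 0
  mean_Z : ∫ ω, D.Z 0 ω ∂P = 0
  hilbertSchmidt : IsHilbertSchmidt D.β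
  eigen_X : ∀ j, covOp (D.X 0) P (D.φ j) = D.lam j • D.φ j
  eigen_Y : ∀ j, covOp (D.Y 0) P (D.ψ j) = D.rho j • D.ψ j
  antitone_lam : Antitone D.lam
  antitone_rho : Antitone D.rho
  lam_pos : ∀ j, 0 < D.lam j
  rho_pos : ∀ j, 0 < D.rho j

/-- The generalized Fourier coefficient `b_{j₁j₂}` of the slope operator. -/
def b (D : Model 𝒳 𝒴 Ω) (j₁ : Idx D.dX) (j₂ : Idx D.dY) : ℝ := ⟪D.β (D.φ j₁), D.ψ j₂⟫

/-- `⟨V_1^∞, t⟩`, where `V_1^∞` has the coordinates `⟨X_1, φ_{j₁}⟩ ⟨Y_1, ψ_{j₂}⟩`. -/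
def pairVInf (D : Model 𝒳 𝒴 Ω) (t : lp (fun _ : Idx D.dX × Idx D.dY => ℝ) 2) (ω : Ω) : ℝ :=
  ∑' j : Idx D.dX × Idx D.dY, ⟪D.X 0 ω, D.φ j.1⟫ * ⟪D.Y 0 ω, D.ψ j.2⟫ * t j

/-- The total number `p = p₁ p₂` of coordinates. -/
def p (D : Model 𝒳 𝒴 Ω) : ℕ := D.p₁ * D.p₂

/-- Positions `j = (j₁, j₂)` of the `p`-dimensional vectors. -/
abbrev Pos (D : Model 𝒳 𝒴 Ω) : Type := Fin D.p₁ × Fin D.p₂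

/-- Pairs `(φ̃, ψ̃)` of finite sequences that may be used in place of the eigenelements. -/
abbrev Bases (D : Model 𝒳 𝒴 Ω) : Type _ := (Fin D.p₁ → 𝒳) × (Fin D.p₂ → 𝒴)

/-- The pair `(φ, ψ)` formed by the leading eigenelements. -/
def eigenBases (D : Model 𝒳 𝒴 Ω) : D.Bases :=
  (fun k => D.φ (Idx.ofFin D.p₁_le k), fun k => D.ψ (Idx.ofFin D.p₂_le k))

/-- The vector `V_i(φ̃, ψ̃)`. -/
def V (D : Model 𝒳 𝒴 Ω) (f : D.Bases) (i : ℕ) (ω : Ω) (j : D.Pos) : ℝ :=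
  ⟪D.X i ω, f.1 j.1⟫ * ⟪D.Y i ω, f.2 j.2⟫

/-- The population standard deviation `σ_j(φ̃, ψ̃)`. -/
def sd [MeasurableSpace Ω] (D : Model 𝒳 𝒴 Ω) (P : Measure Ω) (f : D.Bases) (j : D.Pos) : ℝ :=
  √(variance (fun ω => D.V f 0 ω j) P)

/-- `σ_max(φ̃, ψ̃)`. -/
def sdMax [MeasurableSpace Ω] (D : Model 𝒳 𝒴 Ω) (P : Measure Ω) (f : D.Bases) : ℝ :=
  ⨆ j, D.sd P f j

/-- Correlation of the coordinates `j`, `k` of `V_1 = V_1(φ, ψ)`. -/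
def corr [MeasurableSpace Ω] (D : Model 𝒳 𝒴 Ω) (P : Measure Ω) (j k : D.Pos) : ℝ :=
  covariance (fun ω => D.V D.eigenBases 0 ω j) (fun ω => D.V D.eigenBases 0 ω k) P /
    (D.sd P D.eigenBases j * D.sd P D.eigenBases k)

/-- `J` consists of the positions of the `d` largest values among the `σ_j`. -/
def IsTop [MeasurableSpace Ω] (D : Model 𝒳 𝒴 Ω) (P : Measure Ω) (d : ℕ) (J : Finset D.Pos) :
    Prop :=
  J.card = d ∧ ∀ j ∈ J, ∀ k ∉ J, D.sd P D.eigenBases k ≤ D.sd P D.eigenBases j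

/-! ### The test -/

/-- The sample mean of `V_1(φ̃, ψ̃), …, V_n(φ̃, ψ̃)`. -/
def Vbar (D : Model 𝒳 𝒴 Ω) (n : ℕ) (f : D.Bases) (ω : Ω) (j : D.Pos) : ℝ :=
  (n : ℝ)⁻¹ * ∑ i ∈ Finset.range n, D.V f i ω j

/-- The sample covariance matrix `Σ̂(φ̃, ψ̃)`. -/
def sigmaHat (D : Model 𝒳 𝒴 Ω) (n : ℕ) (f : D.Bases) (ω : Ω) : Matrix D.Pos D.Pos ℝ :=
  Matrix.of fun j k => (n : ℝ)⁻¹ * ∑ i ∈ Finset.range n,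
    (D.V f i ω j - D.Vbar n f ω j) * (D.V f i ω k - D.Vbar n f ω k)

/-- The sample standard deviation `σ̂_j(φ̃, ψ̃)`. -/
def sdHat (D : Model 𝒳 𝒴 Ω) (n : ℕ) (f : D.Bases) (ω : Ω) (j : D.Pos) : ℝ :=
  √(D.sigmaHat n f ω j j)

/-- The statistic `T_U(φ̃, ψ̃)`. -/
def TU (D : Model 𝒳 𝒴 Ω) (τ : ℝ) (n : ℕ) (f : D.Bases) (ω : Ω) : EReal :=
  ⨆ j, exDiv (√n * D.Vbar n f ω j) (D.sdHat n f ω j ^ τ)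

/-- The statistic `T_L(φ̃, ψ̃)`. -/
def TL (D : Model 𝒳 𝒴 Ω) (τ : ℝ) (n : ℕ) (f : D.Bases) (ω : Ω) : EReal :=
  ⨅ j, exDiv (√n * D.Vbar n f ω j) (D.sdHat n f ω j ^ τ)

/-- The law of the bootstrap statistic `M⋆(φ̃, ψ̃)` conditional on the data. (A coordinate with
`σ̂_j = 0` of the Gaussian vector vanishes almost surely.) -/
def bootLawM (D : Model 𝒳 𝒴 Ω) (τ : ℝ) (n : ℕ) (f : D.Bases) (ω : Ω) : Measure ℝ :=
  (multivariateGaussian 0 (D.sigmaHat n f ω)).map fun s => ⨆ j, s j / D.sdHat n f ω j ^ τ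

/-- The law of the bootstrap statistic `L⋆(φ̃, ψ̃)` conditional on the data. -/
def bootLawL (D : Model 𝒳 𝒴 Ω) (τ : ℝ) (n : ℕ) (f : D.Bases) (ω : Ω) : Measure ℝ :=
  (multivariateGaussian 0 (D.sigmaHat n f ω)).map fun s => ⨅ j, s j / D.sdHat n f ω j ^ τ

/-- The bootstrap quantile `q̂_{M(φ̃, ψ̃)}(r)`. -/
def qM (D : Model 𝒳 𝒴 Ω) (τ : ℝ) (n : ℕ) (f : D.Bases) (ω : Ω) (r : ℝ) : ℝ :=
  quantile (D.bootLawM τ n f ω) r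

/-- The bootstrap quantile `q̂_{L(φ̃, ψ̃)}(r)`. -/
def qL (D : Model 𝒳 𝒴 Ω) (τ : ℝ) (n : ℕ) (f : D.Bases) (ω : Ω) (r : ℝ) : ℝ :=
  quantile (D.bootLawL τ n f ω) r

/-- The test with the bases `(φ̃, ψ̃)` rejects the null hypothesis at level `r`. -/
def Rejects (D : Model 𝒳 𝒴 Ω) (τ : ℝ) (n : ℕ) (f : D.Bases) (r : ℝ) (ω : Ω) : Prop :=
  (D.qM τ n f ω (1 - r / 2) : EReal) < D.TU τ n f ω ∨
    D.TL τ n f ω < (D.qL τ n f ω (r / 2) : EReal)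

/-- The signal strength `ν₀ = max_j |λ_j b_j|`, over `j = (j₁, j₂)` with `j₁ ≤ p₁`, `j₂ ≤ p₂`. -/
def signal (D : Model 𝒳 𝒴 Ω) : ℝ :=
  ⨆ j : D.Pos, |D.lam (Idx.ofFin D.p₁_le j.1) *
    D.b (Idx.ofFin D.p₁_le j.1) (Idx.ofFin D.p₂_le j.2)|

/-- The matrix `W_p(φ̃, ψ̃)`: the Kronecker product of the matrices `(⟨φ_k, φ̃_l⟩)` and
`(⟨ψ_k, ψ̃_l⟩)`. -/
def W (D : Model 𝒳 𝒴 Ω) (f : D.Bases) : Matrix D.Pos D.Pos ℝ :=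
  (Matrix.of fun k l => ⟪D.eigenBases.1 k, f.1 l⟫) ⊗ₖ
    (Matrix.of fun k l => ⟪D.eigenBases.2 k, f.2 l⟫)

/-- Pairs of orthonormal sequences with `‖W_p(φ̃, ψ̃) - I_p‖_∞ ≤ r` in the max norm. -/
def classF (D : Model 𝒳 𝒴 Ω) (r : ℝ) : Set D.Bases :=
  {f | Orthonormal ℝ f.1 ∧ Orthonormal ℝ f.2 ∧ ∀ j k, |(D.W f - 1) j k| ≤ r}

end Model

/-! ### Constants, rates and assumptions -/

/-- The fixed real constants: the decay exponents `α₁`, `α₂`, the standardization parameter `τ`,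
and `δ`, `α₀`, `δ₀`, `α̃`. -/
structure Consts where
  α₁ : ℝ
  α₂ : ℝ
  τ : ℝ
  δ : ℝ
  α₀ : ℝ
  δ₀ : ℝ
  αt : ℝ

namespace Consts

/-- `max {α₁, α₂}`. -/
def αhi (e : Consts) : ℝ := max e.α₁ e.α₂

/-- `min {α₁, α₂}`. -/
def αlo (e : Consts) : ℝ := min e.α₁ e.α₂

/-- `a = 4 ∨ (3 α̲ (1 - τ))`. -/
def a (e : Consts) : ℝ := max 4 (3 * e.αlo * (1 - e.τ))

/-- `k_n = ⌈n^{δ/a} ∧ p⌉`. -/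
def k (e : Consts) (n p : ℕ) : ℕ := ⌈min ((n : ℝ) ^ (e.δ / e.a)) (p : ℝ)⌉₊

/-- `m_n = k_n^{(ᾱ - α̃)/2 + δ₀} + k_n`, rounded up to an integer and capped at `p`. -/
def m (e : Consts) (n p : ℕ) : ℕ :=
  min p ⌈(e.k n p : ℝ) ^ ((e.αhi - e.αt) / 2 + e.δ₀) + e.k n p⌉₊

/-- `a_n = (k_n^{ᾱ} p^{α₀})⁻¹`. -/
def rate (e : Consts) (n p : ℕ) : ℝ := ((e.k n p : ℝ) ^ e.αhi * (p : ℝ) ^ e.α₀)⁻¹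

end Consts

section Assumptions

variable {𝒳 𝒴 Ω : ℕ → Type*} [∀ n, NormedAddCommGroup (𝒳 n)] [∀ n, InnerProductSpace ℝ (𝒳 n)]
  [∀ n, NormedAddCommGroup (𝒴 n)] [∀ n, InnerProductSpace ℝ (𝒴 n)] [∀ n, MeasurableSpace (Ω n)]

/-- Tail behavior: `‖⟨V_1^∞, t⟩‖_{ψ₂} ≤ K ⟨C_V t, t⟩^{1/2}` for all `t ∈ ℓ²`; here
`⟨C_V t, t⟩ = var ⟨V_1^∞, t⟩`. -/
def TailAssumption (P : ∀ n, Measure (Ω n)) (D : ∀ n, Model (𝒳 n) (𝒴 n) (Ω n)) : Prop :=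
  ∃ K : ℝ, 0 < K ∧ ∀ n, ∀ t : lp (fun _ : Idx (D n).dX × Idx (D n).dY => ℝ) 2,
    orliczNorm 2 ((D n).pairVInf t) (P n) ≤
      ENNReal.ofReal (K * √(variance ((D n).pairVInf t) (P n)))

/-- Structural assumptions: polynomial decay of the eigenvalues, the bound
`max_{j₁} b_{j₁j₂}² ≲ ρ_{j₂}` on the coefficients of the slope operator, and the bound `‖R°‖_F² ≲ k_n^{2-δ}` for the `k_n × k_n` sub-matrices `R°` of
the correlation matrix `R(m_n)`. -/
structure StructuralAssumption (P : ∀ n, Measure (Ω n)) (D : ∀ n, Model (𝒳 n) (𝒴 n) (Ω n))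
    (e : Consts) : Prop where
  lam_decay : ∃ c C : ℝ, 0 < c ∧ 0 < C ∧ ∀ n, ∀ j : Idx (D n).dX,
    c * ((j : ℕ) + 1 : ℝ) ^ (-e.α₁) ≤ (D n).lam j ∧
      (D n).lam j ≤ C * ((j : ℕ) + 1 : ℝ) ^ (-e.α₁)
  rho_decay : ∃ c C : ℝ, 0 < c ∧ 0 < C ∧ ∀ n, ∀ j : Idx (D n).dY,
    c * ((j : ℕ) + 1 : ℝ) ^ (-e.α₂) ≤ (D n).rho j ∧
      (D n).rho j ≤ C * ((j : ℕ) + 1 : ℝ) ^ (-e.α₂)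
  alignment : ∃ C : ℝ, 0 < C ∧ ∀ n, ∀ j₂ : Idx (D n).dY,
    (⨆ j₁ : Idx (D n).dX, (D n).b j₁ j₂ ^ 2) ≤ C * (D n).rho j₂
  correlation : ∃ C : ℝ, 0 < C ∧ ∀ᶠ n in atTop,
    ∃ J : Finset (D n).Pos, (D n).IsTop (P n) (e.m n (D n).p) J ∧
      ∀ r c : Fin (e.k n (D n).p) ↪ (D n).Pos, (∀ i, r i ∈ J) → (∀ i, c i ∈ J) →
        ∑ i, ∑ l, (D n).corr (P n) (r i) (c l) ^ 2 ≤ C * (e.k n (D n).p : ℝ) ^ (2 - e.δ)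

/-- Growth of the truncation levels. The lower bounds on `p₁` and `p₂` are required whenever the
expansion is really truncated, that is, unless `p₁ = d_X` and `p₂ = d_Y` respectively. -/
structure GrowthAssumption (D : ∀ n, Model (𝒳 n) (𝒴 n) (Ω n)) (e : Consts) : Prop where
  p_bound : ∃ C : ℝ, 0 < C ∧ ∀ᶠ n : ℕ in atTop,
    ((D n).p : ℝ) ^ (2 * e.α₀) * (max (D n).p₁ (D n).p₂ : ℝ) ^ (2 * (e.αhi + 1)) *
      Real.log (D n).p ≤ C * ((n : ℝ) / (e.k n (D n).p : ℝ) ^ (2 * e.αhi))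
  p_bound' : ∃ C : ℝ, 0 < C ∧ ∀ᶠ n : ℕ in atTop,
    ((D n).p : ℝ) ≤ C * ((e.k n (D n).p : ℝ) ^ (e.αhi / 2) * (n : ℝ) ^ (1 / 4 : ℝ))
  p₁_lower : ∃ c : ℝ, 0 < c ∧ ∀ᶠ n in atTop, ((D n).p₁ : ℕ∞) < (D n).dX →
    c * (e.k n (D n).p : ℝ) ^ (e.αhi / (e.αlo - 1)) ≤ (D n).p₁
  p₂_lower : ∃ c : ℝ, 0 < c ∧ ∀ᶠ n in atTop, ((D n).p₂ : ℕ∞) < (D n).dY →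
    c * (e.k n (D n).p : ℝ) ^ (e.αhi / (e.αlo - 1)) ≤ (D n).p₂
  comparable : ∃ c C : ℝ, 0 < c ∧ 0 < C ∧ ∀ᶠ n in atTop, (D n).dX = ⊤ → (D n).dY = ⊤ →
    c * ((D n).p₂ : ℝ) ≤ (D n).p₁ ∧ ((D n).p₁ : ℝ) ≤ C * (D n).p₂

end Assumptions

end FLMTest

end

/-! The three claims rest on second and fourth moments, on Chebyshev's inequality, and on a union
bound for Gaussian maxima.

*Moments.* In the direction of an elementary tensor the tail assumption says that each product
`⟪X, u⟫ ⟪Y, v⟫` is sub-Gaussian at the scale of its own standard deviation. Hence its fourth moment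
is at most a constant times the square of its second moment, and the second moment at most a
constant times `(E |⟪X, u⟫ ⟪Y, v⟫|)² ≤ E ⟪X, u⟫² E ⟪Y, v⟫²` (`IsFLM.integral_score_sq_le`).
Summing over the eigenelements, `‖X‖² ‖Y‖²` has a bounded second moment. Chebyshev's inequality,
applied to its sample mean and to the squared coordinates of `V_i(φ, ψ)`, shows that
`varianceEvent` fails with probability `O(1/n)`; no logarithm is lost, since the eigenvalues are
summable. A pair in the class is close to `(φ, ψ)` up to a common sign in each coordinate, so on
this event the sample variances of all such pairs are controlled
(`sigmaHat_le_of_mem_varianceEvent`).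

*Claims (1) and (2).* The sample variances are bounded and `p ≤ n`, so that a union bound gives
quantiles of the order `(log n)^{1/2}`. For the ratio, it remains to bound the largest population
variance from below: either the error contributes to `⟪Y, ψ_1⟫`, or the alignment assumption makes
some leading score of `X` correlated with it (`IsFLM.exists_le_sd_sq`).

*Claim (3).* The error of the sample means `⟪X, u⟫ ⟪Y, v⟫` is a bilinear form whose Hilbert--Schmidt
norm is of the order `n^{-1/2}`, which gives uniformity over all unit vectors
(`IsFLM.measure_exists_mean_score_gt_le`). Only a bounded number of sample standard deviations is
not small, so the quantiles are in fact `o((log n)^{1/2})`, and it suffices that the mean of some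
coordinate is at least half of the signal (`eventually_signal_le`). Replacing `(φ, ψ)` by `(φ̃, ψ̃)`
changes a mean by the effect of the entries of `W - I`, which is at most a small multiple of the
signal, and by the parts of `φ̃` and `ψ̃` outside the span of the leading eigenelements. The latter
are governed by the first omitted eigenvalues, which have to be `o(a_n)`.

That they are follows from the growth assumption together with `IsFLM.min_p_le`: the tail
assumption bounds the smaller of the two dimensions by a constant. For, if `d` standardized scores
of both `X` and `Y` are available, then the sum of the absolute values of their `d²` products is the
maximum of `4^d` variables that are sub-Gaussian at scale `d`. It is of order `d²` in expectation,
but at most of order `d^{3/2}` by the sub-Gaussian bound. -/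

set_option linter.unusedSectionVars false

/-! ### Hilbert--Schmidt norms, Chebyshev's inequality and sub-Gaussian moments -/

namespace FLMTest

section Hilbert

variable {E F ι κ : Type*} [NormedAddCommGroup E] [InnerProductSpace ℝ E]
  [NormedAddCommGroup F] [InnerProductSpace ℝ F]

theorem tsum_ofReal_inner_sq (e : HilbertBasis ι ℝ E) (x : E) :
    ∑' k, ENNReal.ofReal (⟪x, e k⟫ ^ 2) = ENNReal.ofReal (‖x‖ ^ 2) := by
  have h := e.hasSum_inner_mul_inner x x
  have h2 : HasSum (fun i => ⟪x, e i⟫ ^ 2) (‖x‖ ^ 2) := by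
    simpa [real_inner_comm x, sq, real_inner_self_eq_norm_sq] using h
  rw [← h2.tsum_eq, ENNReal.ofReal_tsum_of_nonneg (fun _ => sq_nonneg _) h2.summable]

/-- A bilinear form `⟪T u, v⟫` is bounded by the Hilbert--Schmidt norm of `T`. -/
theorem ofReal_inner_apply_sq_le [CompleteSpace E] [CompleteSpace F]
    (e : HilbertBasis ι ℝ E) (f : HilbertBasis κ ℝ F) (T : E →L[ℝ] F) (u : E) (v : F) :
    ENNReal.ofReal (⟪T u, v⟫ ^ 2) ≤ ENNReal.ofReal (‖u‖ ^ 2 * ‖v‖ ^ 2) *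
      ∑' k, ∑' i, ENNReal.ofReal (⟪T (e i), f k⟫ ^ 2) := by
  have h1 : ENNReal.ofReal (⟪T u, v⟫ ^ 2) ≤
      ENNReal.ofReal (‖v‖ ^ 2) * ENNReal.ofReal (‖T u‖ ^ 2) := by
    rw [← ENNReal.ofReal_mul (by positivity)]
    apply ENNReal.ofReal_le_ofReal
    rw [← mul_pow, ← sq_abs]
    gcongr
    rw [mul_comm]
    exact abs_real_inner_le_norm _ _
  have h2 : ENNReal.ofReal (‖T u‖ ^ 2) ≤ ENNReal.ofReal (‖u‖ ^ 2) *
      ∑' k, ∑' i, ENNReal.ofReal (⟪T (e i), f k⟫ ^ 2) := by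
    rw [← tsum_ofReal_inner_sq f, ← ENNReal.tsum_mul_left]
    refine ENNReal.tsum_le_tsum fun k => ?_
    have h3 : ∀ w, ⟪T w, f k⟫ = ⟪T.adjoint (f k), w⟫ := fun w => by
      rw [ContinuousLinearMap.adjoint_inner_left, real_inner_comm]
    simp only [h3]
    rw [tsum_ofReal_inner_sq e, ← ENNReal.ofReal_mul (by positivity)]
    apply ENNReal.ofReal_le_ofReal
    rw [← mul_pow, ← sq_abs]
    gcongr
    rw [mul_comm]
    exact abs_real_inner_le_norm _ _
  calc _ ≤ _ := h1
    _ ≤ ENNReal.ofReal (‖v‖ ^ 2) * (ENNReal.ofReal (‖u‖ ^ 2) *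
      ∑' k, ∑' i, ENNReal.ofReal (⟪T (e i), f k⟫ ^ 2)) := by gcongr
    _ = _ := by rw [← mul_assoc, ← ENNReal.ofReal_mul (by positivity), mul_comm (‖v‖ ^ 2)]

variable {Ω : Type*} [MeasurableSpace Ω] {P : Measure Ω}

theorem integrable_inner_mul_inner {ξ : Ω → E} {η : Ω → F} (hξ : MemLp ξ 2 P) (hη : MemLp η 2 P)
    (u : E) (v : F) : Integrable (fun ω => ⟪ξ ω, u⟫ * ⟪η ω, v⟫) P :=
  MemLp.integrable_mul (hξ.inner_const u) (hη.inner_const v)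

theorem covOp_inner [CompleteSpace E] {ξ : Ω → E} (hξ : MemLp ξ 2 P) (u v : E) :
    ⟪covOp ξ P u, v⟫ = ∫ ω, ⟪ξ ω, u⟫ * ⟪ξ ω, v⟫ ∂P := by
  have hint : Integrable (fun ω => InnerProductSpace.rankOne ℝ (ξ ω) (ξ ω)) P := by
    refine Integrable.mono' (g := fun ω => ‖ξ ω‖ ^ 2) (hξ.integrable_norm_pow (by norm_num)) ?_ ?_
    · have hc : Continuous fun x : E => InnerProductSpace.rankOne ℝ x x :=
        (InnerProductSpace.rankOne ℝ (E := E) (F := E)).continuous.clm_apply continuous_id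
      exact hc.comp_aestronglyMeasurable hξ.1
    · exact ae_of_all _ fun ω => by simp [sq]
  rw [covOp, ContinuousLinearMap.integral_apply hint, real_inner_comm,
    ← integral_inner (hint.apply_continuousLinearMap u)]
  refine integral_congr_ae (ae_of_all _ fun ω => ?_)
  simp only [InnerProductSpace.rankOne_apply, inner_smul_right, real_inner_comm]

/-- The covariance form in a basis of eigenelements. -/
theorem hasSum_covOp [CompleteSpace E] {ξ : Ω → E} (hξ : MemLp ξ 2 P) (e : HilbertBasis ι ℝ E)
    {l : ι → ℝ} (he : ∀ j, covOp ξ P (e j) = l j • e j) (u v : E) :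
    HasSum (fun j => l j * ⟪u, e j⟫ * ⟪v, e j⟫) (∫ ω, ⟪ξ ω, u⟫ * ⟪ξ ω, v⟫ ∂P) := by
  have h := e.hasSum_inner_mul_inner (covOp ξ P u) v
  rw [covOp_inner hξ] at h
  refine h.congr_fun fun j => ?_
  rw [covOp_inner hξ u (e j)]
  simp_rw [mul_comm (⟪ξ _, u⟫ : ℝ)]
  rw [← covOp_inner hξ, he, inner_smul_left, real_inner_comm u (e j), real_inner_comm v (e j)]
  simp

end Hilbert

section Chebyshev

variable {Ω : Type*} [MeasurableSpace Ω] {P : Measure Ω} [IsProbabilityMeasure P]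

/-- The mean squared error of a sample mean. -/
theorem lintegral_sampleMean_sub_sq_le {U : ℕ → Ω → ℝ} (hU : MemLp (U 0) 2 P)
    (hind : iIndepFun U P) (hid : ∀ i, IdentDistrib (U i) (U 0) P P) {n : ℕ} (hn : 1 ≤ n) :
    ∫⁻ ω, ENNReal.ofReal (((n : ℝ)⁻¹ * ∑ i ∈ Finset.range n, U i ω - ∫ ω, U 0 ω ∂P) ^ 2) ∂P ≤
      ENNReal.ofReal ((∫ ω, U 0 ω ^ 2 ∂P) / n) := by
  have hn0 : (n : ℝ) ≠ 0 := by positivity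
  have hL : ∀ i, MemLp (U i) 2 P := fun i => (hid i).memLp_iff.2 hU
  set S : Ω → ℝ := fun ω => (n : ℝ)⁻¹ * ∑ i ∈ Finset.range n, U i ω with hS
  have hsum : MemLp (fun ω => ∑ i ∈ Finset.range n, U i ω) 2 P :=
    memLp_finsetSum _ fun i _ => hL i
  have hSL : MemLp S 2 P := hsum.const_mul _
  have hES : ∫ ω, S ω ∂P = ∫ ω, U 0 ω ∂P := by
    rw [hS, integral_const_mul, integral_finsetSum _ fun i _ => (hL i).integrable (by norm_num)]
    rw [Finset.sum_congr rfl fun i _ => (hid i).integral_eq]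
    simp [hn0]
  have hvar : variance S P ≤ (∫ ω, U 0 ω ^ 2 ∂P) / n := by
    rw [hS, variance_const_mul]
    have h1 := IndepFun.variance_sum (s := Finset.range n) (X := U) (μ := P) (fun i _ => hL i)
      (fun i _ j _ hij => hind.indepFun hij)
    have h2 : variance (fun ω => ∑ i ∈ Finset.range n, U i ω) P = n * variance (U 0) P := by
      rw [show (fun ω => ∑ i ∈ Finset.range n, U i ω) = ∑ i ∈ Finset.range n, U i by
        ext; simp, h1, Finset.sum_congr rfl fun i _ => (hid i).variance_eq]
      simp
    rw [h2]
    have h3 : variance (U 0) P ≤ ∫ ω, U 0 ω ^ 2 ∂P := variance_le_expectation_sq hU.1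
    calc ((n : ℝ)⁻¹) ^ 2 * (n * variance (U 0) P) = variance (U 0) P / n := by field_simp
      _ ≤ _ := by gcongr
  have h4 := ofReal_variance hSL
  rw [← hES]
  calc _ = evariance S P := by rw [evariance_eq_lintegral_ofReal]
    _ = ENNReal.ofReal (variance S P) := h4.symm
    _ ≤ _ := ENNReal.ofReal_le_ofReal hvar

theorem measure_lt_sampleMean_sub_le {U : ℕ → Ω → ℝ} (hU : MemLp (U 0) 2 P)
    (hind : iIndepFun U P) (hid : ∀ i, IdentDistrib (U i) (U 0) P P) {n : ℕ} (hn : 1 ≤ n)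
    {ε : ℝ} (hε : 0 < ε) :
    P {ω | ε < |(n : ℝ)⁻¹ * ∑ i ∈ Finset.range n, U i ω - ∫ ω, U 0 ω ∂P|} ≤
      ENNReal.ofReal ((∫ ω, U 0 ω ^ 2 ∂P) / ε ^ 2 * (n : ℝ)⁻¹) := by
  have hL : ∀ i, MemLp (U i) 2 P := fun i => (hid i).memLp_iff.2 hU
  have h1 := lintegral_sampleMean_sub_sq_le hU hind hid hn
  have hm : AEMeasurable (fun ω => ENNReal.ofReal
      (((n : ℝ)⁻¹ * ∑ i ∈ Finset.range n, U i ω - ∫ ω, U 0 ω ∂P) ^ 2)) P := by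
    have : ∀ i, AEMeasurable (U i) P := fun i => (hL i).1.aemeasurable
    fun_prop
  have h2 := mul_meas_ge_le_lintegral₀ hm (ENNReal.ofReal (ε ^ 2))
  have hε2 : ENNReal.ofReal (ε ^ 2) ≠ 0 := by simpa using hε.ne'
  calc _ ≤ P {ω | ENNReal.ofReal (ε ^ 2) ≤ ENNReal.ofReal
        (((n : ℝ)⁻¹ * ∑ i ∈ Finset.range n, U i ω - ∫ ω, U 0 ω ∂P) ^ 2)} := by
        refine measure_mono fun ω hω => ENNReal.ofReal_le_ofReal ?_
        rw [← sq_abs (_ - _)]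
        exact pow_le_pow_left₀ hε.le (le_of_lt hω) 2
    _ ≤ ENNReal.ofReal ((∫ ω, U 0 ω ^ 2 ∂P) / n) / ENNReal.ofReal (ε ^ 2) := by
        rw [ENNReal.le_div_iff_mul_le (Or.inl hε2) (Or.inl ENNReal.ofReal_ne_top), mul_comm]
        exact h2.trans h1
    _ = _ := by
        rw [← ENNReal.ofReal_div_of_pos (by positivity)]
        congr 1
        ring

end Chebyshev

section SubGaussian

variable {Ω : Type*} [MeasurableSpace Ω] {P : Measure Ω}

theorem lintegral_exp_sq_le_of_orliczNorm_lt {W : Ω → ℝ} {r t : ℝ}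
    (h : orliczNorm 2 W P ≤ ENNReal.ofReal r) (hr : 0 ≤ r) (hrt : r < t) :
    ∫⁻ ω, ENNReal.ofReal (Real.exp (W ω ^ 2 / t ^ 2)) ∂P ≤ 2 := by
  have h1 : orliczNorm 2 W P < ENNReal.ofReal t :=
    h.trans_lt ((ENNReal.ofReal_lt_ofReal_iff (hr.trans_lt hrt)).2 hrt)
  obtain ⟨_, ⟨s, hs, rfl, h2⟩, hst⟩ := sInf_lt_iff.1 h1
  have hst' : s < t := (ENNReal.ofReal_lt_ofReal_iff (hr.trans_lt hrt)).1 hst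
  refine (lintegral_mono fun ω => ENNReal.ofReal_le_ofReal ?_).trans h2
  rw [sq_abs]
  gcongr

/-- Moment consequences of `E exp (W² / t²) ≤ 2`. -/
theorem memLp_four_of_lintegral_exp {W : Ω → ℝ} (hW : Measurable W) {t : ℝ} (ht : 0 < t)
    (h : ∫⁻ ω, ENNReal.ofReal (Real.exp (W ω ^ 2 / t ^ 2)) ∂P ≤ 2) :
    MemLp W 4 P ∧ ∫ ω, W ω ^ 2 ∂P ≤ 2 * t ^ 2 ∧ ∫ ω, W ω ^ 4 ∂P ≤ 4 * t ^ 4 := by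
  have hi : Integrable (fun ω => Real.exp (W ω ^ 2 / t ^ 2)) P := by
    refine ⟨by fun_prop, ?_⟩
    rw [hasFiniteIntegral_iff_ofReal (ae_of_all _ fun ω => (Real.exp_pos _).le)]
    exact h.trans_lt (by simp)
  have he : ∫ ω, Real.exp (W ω ^ 2 / t ^ 2) ∂P ≤ 2 := by
    rw [integral_eq_lintegral_of_nonneg_ae (ae_of_all _ fun ω => (Real.exp_pos _).le) (by fun_prop)]
    exact ENNReal.toReal_le_of_le_ofReal (by norm_num) (by simpa using h)
  have b2 : ∀ ω, W ω ^ 2 ≤ t ^ 2 * Real.exp (W ω ^ 2 / t ^ 2) := fun ω => by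
    have := Real.add_one_le_exp (W ω ^ 2 / t ^ 2)
    calc W ω ^ 2 = t ^ 2 * (W ω ^ 2 / t ^ 2) := by field_simp
      _ ≤ _ := by gcongr; linarith
  have b4 : ∀ ω, W ω ^ 4 ≤ 2 * t ^ 4 * Real.exp (W ω ^ 2 / t ^ 2) := fun ω => by
    have := Real.quadratic_le_exp_of_nonneg (x := W ω ^ 2 / t ^ 2) (by positivity)
    have h0 : (0 : ℝ) ≤ W ω ^ 2 / t ^ 2 := by positivity
    calc W ω ^ 4 = 2 * t ^ 4 * ((W ω ^ 2 / t ^ 2) ^ 2 / 2) := by field_simp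
      _ ≤ _ := by gcongr; linarith
  have i4 : Integrable (fun ω => W ω ^ 4) P := by
    refine (hi.const_mul (2 * t ^ 4)).mono' (by fun_prop) (ae_of_all _ fun ω => ?_)
    rw [Real.norm_of_nonneg (by positivity)]
    exact b4 ω
  have i2 : Integrable (fun ω => W ω ^ 2) P := by
    refine (hi.const_mul (t ^ 2)).mono' (by fun_prop) (ae_of_all _ fun ω => ?_)
    rw [Real.norm_of_nonneg (by positivity)]
    exact b2 ω
  refine ⟨?_, ?_, ?_⟩
  · have : Integrable (fun ω => ‖W ω‖ ^ ((4 : ℝ≥0∞).toReal)) P := by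
      refine i4.congr (ae_of_all _ fun ω => ?_)
      simp only [ENNReal.toReal_ofNat, Real.norm_eq_abs]
      rw [show (4 : ℝ) = ((4 : ℕ) : ℝ) by norm_num, Real.rpow_natCast]
      exact ((by decide : Even 4).pow_abs _).symm
    exact (integrable_norm_rpow_iff hW.aestronglyMeasurable (by norm_num) (by norm_num)).1 this
  · calc _ ≤ ∫ ω, t ^ 2 * Real.exp (W ω ^ 2 / t ^ 2) ∂P := integral_mono i2 (hi.const_mul _) b2
      _ = t ^ 2 * ∫ ω, Real.exp (W ω ^ 2 / t ^ 2) ∂P := integral_const_mul _ _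
      _ ≤ t ^ 2 * 2 := by gcongr
      _ = _ := by ring
  · calc _ ≤ ∫ ω, 2 * t ^ 4 * Real.exp (W ω ^ 2 / t ^ 2) ∂P :=
          integral_mono i4 (hi.const_mul _) b4
      _ = 2 * t ^ 4 * ∫ ω, Real.exp (W ω ^ 2 / t ^ 2) ∂P := integral_const_mul _ _
      _ ≤ 2 * t ^ 4 * 2 := by gcongr
      _ = _ := by ring

/-- A reverse Hölder inequality: a bound of the fourth moment by the square of the second one bounds
the second moment by the first absolute moment. -/
theorem sqrt_integral_sq_le_mul_integral_abs [IsProbabilityMeasure P] {W : Ω → ℝ}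
    (hW : MemLp W 4 P) {B : ℝ} (hB : 0 < B)
    (h4 : ∫ ω, W ω ^ 4 ∂P ≤ B ^ 2 * (∫ ω, W ω ^ 2 ∂P) ^ 2) :
    √(∫ ω, W ω ^ 2 ∂P) ≤ 4 * B * ∫ ω, |W ω| ∂P := by
  set s := √(∫ ω, W ω ^ 2 ∂P) with hs
  have hs0 : 0 ≤ s := Real.sqrt_nonneg _
  have hs2 : s ^ 2 = ∫ ω, W ω ^ 2 ∂P := Real.sq_sqrt (integral_nonneg fun _ => sq_nonneg _)
  rcases hs0.eq_or_lt with h | hpos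
  · rw [← h]
    have : 0 ≤ ∫ ω, |W ω| ∂P := integral_nonneg fun _ => abs_nonneg _
    positivity
  have i4 : Integrable (fun ω => W ω ^ 4) P := by
    have := hW.integrable_norm_pow (by norm_num : 4 ≠ 0)
    simpa [(by decide : Even 4).pow_abs] using this
  have i2 : Integrable (fun ω => W ω ^ 2) P :=
    (hW.mono_exponent (by norm_num : (2 : ℝ≥0∞) ≤ 4)).integrable_sq
  have i1 : Integrable (fun ω => |W ω|) P := (hW.integrable (by norm_num)).abs
  -- At this threshold the part of `W²` where `|W| > A` has at most a quarter of the mass.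
  set A := 2 * B * s with hA
  have hApos : 0 < A := by positivity
  have hpt : ∀ ω, W ω ^ 2 ≤ A * |W ω| + (A ^ 2)⁻¹ * W ω ^ 4 := fun ω => by
    rcases le_total |W ω| A with h | h
    · have : 0 ≤ (A ^ 2)⁻¹ * W ω ^ 4 := by positivity
      nlinarith [sq_abs (W ω), abs_nonneg (W ω)]
    · have h1 : A ^ 2 ≤ W ω ^ 2 := by rw [← sq_abs (W ω)]; gcongr
      have h2 : W ω ^ 2 ≤ (A ^ 2)⁻¹ * W ω ^ 4 := by
        rw [inv_mul_eq_div, le_div_iff₀ (by positivity)]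
        nlinarith [sq_nonneg (W ω)]
      have : 0 ≤ A * |W ω| := by positivity
      linarith
  have h5 : s ^ 2 ≤ A * ∫ ω, |W ω| ∂P + (A ^ 2)⁻¹ * ∫ ω, W ω ^ 4 ∂P := by
    rw [hs2, ← integral_const_mul, ← integral_const_mul,
      ← integral_add (i1.const_mul _) (i4.const_mul _)]
    exact integral_mono i2 ((i1.const_mul _).add (i4.const_mul _)) hpt
  have h6 : (A ^ 2)⁻¹ * ∫ ω, W ω ^ 4 ∂P ≤ s ^ 2 / 4 := by
    rw [inv_mul_le_iff₀ (by positivity)]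
    rw [← hs2] at h4
    calc _ ≤ _ := h4
      _ = _ := by rw [hA]; ring
  have h7 : s * s ≤ s * (4 * B * ∫ ω, |W ω| ∂P) := by
    have : A * ∫ ω, |W ω| ∂P = s * (2 * B * ∫ ω, |W ω| ∂P) := by rw [hA]; ring
    have h0 : 0 ≤ s * (B * ∫ ω, |W ω| ∂P) :=
      mul_nonneg hs0 (mul_nonneg hB.le (integral_nonneg fun _ => abs_nonneg _))
    nlinarith
  exact le_of_mul_le_mul_left h7 hpos

end SubGaussian
end FLMTest

namespace FLMTest

/-! ### Quantiles of maxima of Gaussian vectors -/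

/-- Quantile bounds from a bound for the two tails, for a level away from `0` and `1`. Both bounds
are needed for the set in the definition of the quantile to be nonempty and bounded below. -/
theorem abs_quantile_le {μ : Measure ℝ} [IsProbabilityMeasure μ] {r t ε : ℝ}
    (h : μ {x | t ≤ |x|} ≤ ENNReal.ofReal ε) (hε : 0 ≤ ε) (hr : ε < r) (hr' : ε ≤ 1 - r) :
    |quantile μ r| ≤ t := by
  have hup : ENNReal.ofReal r ≤ μ (Set.Iic t) := by
    have h1 : μ (Set.Iic t)ᶜ ≤ ENNReal.ofReal ε := by
      refine (measure_mono fun x hx => ?_).trans h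
      simp only [Set.mem_compl_iff, Set.mem_Iic, not_le] at hx
      exact hx.le.trans (le_abs_self x)
    have h2 : μ (Set.Iic t) = 1 - μ (Set.Iic t)ᶜ := by
      rw [← prob_compl_eq_one_sub measurableSet_Iic.compl, compl_compl]
    rw [h2]
    calc ENNReal.ofReal r ≤ ENNReal.ofReal (1 - ε) := ENNReal.ofReal_le_ofReal (by linarith)
      _ = 1 - ENNReal.ofReal ε := by rw [ENNReal.ofReal_sub _ hε, ENNReal.ofReal_one]
      _ ≤ _ := tsub_le_tsub_left h1 _
  have hlow : ∀ x ∈ {x : ℝ | ENNReal.ofReal r ≤ μ (Set.Iic x)}, -t ≤ x := by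
    intro x hx
    by_contra! hlt
    have h1 : μ (Set.Iic x) ≤ ENNReal.ofReal ε := by
      refine (measure_mono fun y hy => ?_).trans h
      have : y ≤ x := hy
      exact le_trans (by linarith) (neg_le_abs y)
    exact absurd (hx.out.trans h1) (not_le.2 ((ENNReal.ofReal_lt_ofReal_iff (hε.trans_lt hr)).2 hr))
  rw [abs_le]
  exact ⟨le_csInf ⟨t, hup⟩ hlow, csInf_le ⟨-t, hlow⟩ hup⟩

theorem hasSubgaussianMGF_gaussianReal {u c : NNReal} (h : u ≤ c) :
    HasSubgaussianMGF id c (gaussianReal 0 u) where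
  integrable_exp_mul t := integrable_exp_mul_gaussianReal t
  mgf_le t := by
    rw [mgf_id_gaussianReal]
    simp only [zero_mul, zero_add]
    gcongr

theorem gaussianReal_le_abs_le {u : NNReal} {v t : ℝ} (hv : 0 < v) (hu : (u : ℝ) ≤ v ^ 2)
    (ht : 0 ≤ t) :
    gaussianReal 0 u {x | t ≤ |x|} ≤ ENNReal.ofReal (2 * Real.exp (-t ^ 2 / (2 * v ^ 2))) := by
  have hs := hasSubgaussianMGF_gaussianReal (u := u) (c := NNReal.mk (v ^ 2) (by positivity))
    (by exact_mod_cast hu)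
  have h1 := hs.measure_ge_le ht
  have h2 := hs.neg.measure_ge_le ht
  have hsub : {x : ℝ | t ≤ |x|} ⊆ {x | t ≤ id x} ∪ {x | t ≤ (-id) x} := by
    intro x hx
    simpa [le_abs] using hx
  refine (measure_mono hsub).trans ((measure_union_le _ _).trans ?_)
  rw [two_mul, ENNReal.ofReal_add (Real.exp_pos _).le (Real.exp_pos _).le]
  refine add_le_add ?_ ?_
  · rw [← ENNReal.ofReal_toReal (measure_ne_top _ {x : ℝ | t ≤ id x})]
    exact ENNReal.ofReal_le_ofReal h1
  · rw [← ENNReal.ofReal_toReal (measure_ne_top _ {x : ℝ | t ≤ (-id) x})]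
    exact ENNReal.ofReal_le_ofReal h2

section MultivariateGaussian

variable {ι : Type*} [Fintype ι] [DecidableEq ι] {S : Matrix ι ι ℝ}

/-- A union bound for the standardized coordinates of a Gaussian vector. The bound allows for
coordinates with variance `0`. -/
theorem multivariateGaussian_exists_le_abs_le (hS : S.PosSemidef) {τ t : ℝ} (ht : 0 ≤ t)
    {v : ι → ℝ} (hv : ∀ j, 0 < v j) (hSv : ∀ j, √(S j j) ^ (1 - τ) ≤ v j) :
    multivariateGaussian 0 S {s | ∃ j, t ≤ |s j / √(S j j) ^ τ|} ≤
      ENNReal.ofReal (∑ j, 2 * Real.exp (-t ^ 2 / (2 * v j ^ 2))) := by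
  have hset : {s : EuclideanSpace ℝ ι | ∃ j, t ≤ |s j / √(S j j) ^ τ|} =
      ⋃ j, {s : EuclideanSpace ℝ ι | t ≤ |s j / √(S j j) ^ τ|} := by ext; simp
  rw [hset]
  refine (measure_iUnion_fintype_le _ _).trans ?_
  rw [ENNReal.ofReal_sum_of_nonneg fun _ _ => by positivity]
  refine Finset.sum_le_sum fun j _ => ?_
  have hmp := measurePreserving_eval_multivariateGaussian (μ := 0) hS (i := j)
  have hlaw : (multivariateGaussian 0 S).map (fun s => (√(S j j) ^ τ)⁻¹ * s j) =
      gaussianReal 0 (NNReal.mk (((√(S j j) ^ τ)⁻¹) ^ 2) (sq_nonneg _) * (S j j).toNNReal) := by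
    have h1 : (fun s : EuclideanSpace ℝ ι => (√(S j j) ^ τ)⁻¹ * s j) =
      (fun x => (√(S j j) ^ τ)⁻¹ * x) ∘ fun s => s j := rfl
    rw [h1, ← Measure.map_map (by fun_prop) (by fun_prop), hmp.map_eq, gaussianReal_map_const_mul]
    simp
  have hpre : {s : EuclideanSpace ℝ ι | t ≤ |s j / √(S j j) ^ τ|} =
      (fun s : EuclideanSpace ℝ ι => (√(S j j) ^ τ)⁻¹ * s j) ⁻¹' {x | t ≤ |x|} := by
    ext s
    simp only [Set.mem_ofPred_eq, Set.mem_preimage, div_eq_inv_mul]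
  rw [hpre, ← Measure.map_apply (by fun_prop) (measurableSet_le (by fun_prop) (by fun_prop)), hlaw]
  refine gaussianReal_le_abs_le (hv j) ?_ ht
  have hnn : 0 ≤ S j j := hS.diag_nonneg
  rw [NNReal.coe_mul, Real.coe_toNNReal _ hnn]
  change ((√(S j j) ^ τ)⁻¹) ^ 2 * S j j ≤ v j ^ 2
  rcases hnn.eq_or_lt with h0 | hpos
  · rw [← h0]; simp; positivity
  · have hs : 0 < √(S j j) := Real.sqrt_pos.2 hpos
    calc ((√(S j j) ^ τ)⁻¹) ^ 2 * S j j = (√(S j j) ^ (1 - τ)) ^ 2 := by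
          rw [Real.rpow_sub hs, Real.rpow_one, div_pow, Real.sq_sqrt hnn]
          ring
      _ ≤ v j ^ 2 := by gcongr; exact hSv j

variable [Nonempty ι]

theorem abs_quantile_iSup_le (hS : S.PosSemidef) {τ t r : ℝ} (ht : 0 ≤ t) {v : ι → ℝ}
    (hv : ∀ j, 0 < v j) (hSv : ∀ j, √(S j j) ^ (1 - τ) ≤ v j)
    (hr : ∑ j, 2 * Real.exp (-t ^ 2 / (2 * v j ^ 2)) < r)
    (hr' : ∑ j, 2 * Real.exp (-t ^ 2 / (2 * v j ^ 2)) ≤ 1 - r) :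
    |quantile ((multivariateGaussian 0 S).map fun s => ⨆ j, s j / √(S j j) ^ τ) r| ≤ t := by
  have hm : Measurable fun s : EuclideanSpace ℝ ι => ⨆ j, s j / √(S j j) ^ τ :=
    Measurable.iSup fun j => by fun_prop
  have : IsProbabilityMeasure
      ((multivariateGaussian 0 S).map fun s => ⨆ j, s j / √(S j j) ^ τ) :=
    Measure.isProbabilityMeasure_map hm.aemeasurable
  refine abs_quantile_le ?_ (Finset.sum_nonneg fun _ _ => by positivity) hr hr'
  rw [Measure.map_apply hm (measurableSet_le (by fun_prop) (by fun_prop))]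
  refine (measure_mono fun s hs => ?_).trans
    (multivariateGaussian_exists_le_abs_le hS ht hv hSv)
  obtain ⟨j, hj⟩ := exists_eq_ciSup_of_finite (f := fun j => s j / √(S j j) ^ τ)
  exact ⟨j, by rw [hj]; exact hs⟩

theorem abs_quantile_iInf_le (hS : S.PosSemidef) {τ t r : ℝ} (ht : 0 ≤ t) {v : ι → ℝ}
    (hv : ∀ j, 0 < v j) (hSv : ∀ j, √(S j j) ^ (1 - τ) ≤ v j)
    (hr : ∑ j, 2 * Real.exp (-t ^ 2 / (2 * v j ^ 2)) < r)
    (hr' : ∑ j, 2 * Real.exp (-t ^ 2 / (2 * v j ^ 2)) ≤ 1 - r) :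
    |quantile ((multivariateGaussian 0 S).map fun s => ⨅ j, s j / √(S j j) ^ τ) r| ≤ t := by
  have hm : Measurable fun s : EuclideanSpace ℝ ι => ⨅ j, s j / √(S j j) ^ τ :=
    Measurable.iInf fun j => by fun_prop
  have : IsProbabilityMeasure
      ((multivariateGaussian 0 S).map fun s => ⨅ j, s j / √(S j j) ^ τ) :=
    Measure.isProbabilityMeasure_map hm.aemeasurable
  refine abs_quantile_le ?_ (Finset.sum_nonneg fun _ _ => by positivity) hr hr'
  rw [Measure.map_apply hm (measurableSet_le (by fun_prop) (by fun_prop))]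
  refine (measure_mono fun s hs => ?_).trans
    (multivariateGaussian_exists_le_abs_le hS ht hv hSv)
  obtain ⟨j, hj⟩ := exists_eq_ciInf_of_finite (f := fun j => s j / √(S j j) ^ τ)
  exact ⟨j, by rw [hj]; exact hs⟩

end MultivariateGaussian

namespace Model

variable {𝒳 𝒴 Ω : Type*} [NormedAddCommGroup 𝒳] [InnerProductSpace ℝ 𝒳]
  [NormedAddCommGroup 𝒴] [InnerProductSpace ℝ 𝒴]

instance (D : Model 𝒳 𝒴 Ω) : Nonempty D.Pos := ⟨(⟨0, D.p₁_pos⟩, ⟨0, D.p₂_pos⟩)⟩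

theorem posSemidef_sigmaHat (D : Model 𝒳 𝒴 Ω) (n : ℕ) (f : D.Bases) (ω : Ω) :
    (D.sigmaHat n f ω).PosSemidef := by
  let A : Matrix (Fin n) D.Pos ℝ := Matrix.of fun i j => D.V f i ω j - D.Vbar n f ω j
  have h := (Matrix.posSemidef_conjTranspose_mul_self A).smul (a := (n : ℝ)⁻¹) (by positivity)
  convert h using 1
  ext j k
  simp [sigmaHat, A, Matrix.mul_apply, Finset.sum_range]

/-- Bounds `v` on `σ̂_j ^ (1 - τ)` bound the bootstrap quantiles. -/
theorem abs_quantile_le_of_sdHat_le (D : Model 𝒳 𝒴 Ω) {n : ℕ} {f : D.Bases} {ω : Ω} {τ t r : ℝ}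
    (ht : 0 ≤ t) {v : D.Pos → ℝ} (hv : ∀ j, 0 < v j)
    (hSv : ∀ j, D.sdHat n f ω j ^ (1 - τ) ≤ v j)
    (hr : ∑ j, 2 * Real.exp (-t ^ 2 / (2 * v j ^ 2)) < r)
    (hr' : ∑ j, 2 * Real.exp (-t ^ 2 / (2 * v j ^ 2)) ≤ 1 - r) :
    |D.qM τ n f ω r| ≤ t ∧ |D.qL τ n f ω r| ≤ t :=
  ⟨abs_quantile_iSup_le (D.posSemidef_sigmaHat n f ω) ht hv hSv hr hr',
    abs_quantile_iInf_le (D.posSemidef_sigmaHat n f ω) ht hv hSv hr hr'⟩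

end Model
end FLMTest

/-! ### Cauchy--Schwarz inequalities -/

namespace FLMTest

theorem lintegral_mul_le_of_sq_le {Ω : Type*} [MeasurableSpace Ω] {P : Measure Ω}
    {g h : Ω → ℝ≥0∞} (hg : Measurable g) (hh : Measurable h) {c d : ℝ≥0∞}
    (hgc : ∫⁻ ω, g ω ^ 2 ∂P ≤ c ^ 2) (hhd : ∫⁻ ω, h ω ^ 2 ∂P ≤ d ^ 2) :
    ∫⁻ ω, g ω * h ω ∂P ≤ c * d := by
  have h1 := ENNReal.lintegral_mul_le_Lp_mul_Lq P Real.HolderConjugate.two_two hg.aemeasurable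
    hh.aemeasurable
  have h2 : ∀ {x y : ℝ≥0∞}, x ≤ y ^ 2 → x ^ (1 / 2 : ℝ) ≤ y := fun {x y} hxy => by
    calc x ^ (1 / 2 : ℝ) ≤ (y ^ 2) ^ (1 / 2 : ℝ) := by gcongr
      _ = y := by rw [← ENNReal.rpow_natCast, ← ENNReal.rpow_mul]; norm_num
  refine h1.trans (mul_le_mul' (h2 ?_) (h2 ?_))
  · simpa using hgc
  · simpa using hhd

/-- The triangle inequality in `L²` for countable sums of nonnegative functions. -/
theorem lintegral_tsum_sq_le {Ω ι : Type*} [MeasurableSpace Ω] [Countable ι] {P : Measure Ω}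
    {g : ι → Ω → ℝ≥0∞} (hg : ∀ a, Measurable (g a)) {c : ι → ℝ≥0∞}
    (hgc : ∀ a, ∫⁻ ω, g a ω ^ 2 ∂P ≤ c a ^ 2) :
    ∫⁻ ω, (∑' a, g a ω) ^ 2 ∂P ≤ (∑' a, c a) ^ 2 := by
  have h1 : ∀ x : ι → ℝ≥0∞, (∑' a, x a) ^ 2 = ∑' a, ∑' b, x a * x b := fun x => by
    simp_rw [sq, ENNReal.tsum_mul_left, ENNReal.tsum_mul_right]
  simp_rw [h1]
  have hm : ∀ a b, Measurable fun ω => g a ω * g b ω := fun a b => (hg a).mul (hg b)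
  rw [lintegral_tsum fun a => (Measurable.tsum (hm a)).aemeasurable]
  refine ENNReal.tsum_le_tsum fun a => ?_
  rw [lintegral_tsum fun b => (hm a b).aemeasurable]
  exact ENNReal.tsum_le_tsum fun b => lintegral_mul_le_of_sq_le (hg a) (hg b) (hgc a) (hgc b)

theorem sq_integral_mul_le {Ω : Type*} [MeasurableSpace Ω] {P : Measure Ω} {f g : Ω → ℝ}
    (hf : MemLp f 2 P) (hg : MemLp g 2 P) :
    (∫ ω, f ω * g ω ∂P) ^ 2 ≤ (∫ ω, f ω ^ 2 ∂P) * ∫ ω, g ω ^ 2 ∂P := by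
  have hF := hf.integrable_sq
  have hG := hg.integrable_sq
  have hFG : Integrable (fun ω => f ω * g ω) P := hf.integrable_mul hg
  have h : ∀ x : ℝ, 0 ≤ (∫ ω, g ω ^ 2 ∂P) * (x * x) + (2 * ∫ ω, f ω * g ω ∂P) * x +
      ∫ ω, f ω ^ 2 ∂P := fun x => by
    have h0 : 0 ≤ ∫ ω, (f ω + x * g ω) ^ 2 ∂P := integral_nonneg fun _ => sq_nonneg _
    have h1 : ∀ ω, (f ω + x * g ω) ^ 2 = f ω ^ 2 + ((2 * x) * (f ω * g ω) + x ^ 2 * g ω ^ 2) :=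
      fun ω => by ring
    have h2 : ∫ ω, (f ω + x * g ω) ^ 2 ∂P = ∫ ω, f ω ^ 2 ∂P +
        ((2 * x) * ∫ ω, f ω * g ω ∂P + x ^ 2 * ∫ ω, g ω ^ 2 ∂P) := by
      have h3 : Integrable (fun ω => (2 * x) * (f ω * g ω) + x ^ 2 * g ω ^ 2) P :=
        (hFG.const_mul _).add (hG.const_mul _)
      simp_rw [h1]
      rw [integral_add hF h3, integral_add (hFG.const_mul _) (hG.const_mul _),
        integral_const_mul, integral_const_mul]
    rw [h2] at h0
    linarith
  have := discrim_le_zero h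
  rw [discrim] at this
  nlinarith

namespace Model

/-! ### Moments of the products of scores -/

section Basic

variable {𝒳 𝒴 Ω : Type*} [NormedAddCommGroup 𝒳] [InnerProductSpace ℝ 𝒳]
  [NormedAddCommGroup 𝒴] [InnerProductSpace ℝ 𝒴]

/-- The product `⟪X_i, u⟫ ⟪Y_i, v⟫` of two scores; the coordinates of `V_i(φ̃, ψ̃)` are of this
form. -/
noncomputable def score (D : Model 𝒳 𝒴 Ω) (u : 𝒳) (v : 𝒴) (i : ℕ) (ω : Ω) : ℝ :=
  ⟪D.X i ω, u⟫ * ⟪D.Y i ω, v⟫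

/-- The second moment `E ⟪X, u⟫²`. -/
noncomputable def secX [MeasurableSpace Ω] (D : Model 𝒳 𝒴 Ω) (P : Measure Ω) (u : 𝒳) : ℝ :=
  ∫ ω, ⟪D.X 0 ω, u⟫ ^ 2 ∂P

/-- The second moment `E ⟪Y, v⟫²`. -/
noncomputable def secY [MeasurableSpace Ω] (D : Model 𝒳 𝒴 Ω) (P : Measure Ω) (v : 𝒴) : ℝ :=
  ∫ ω, ⟪D.Y 0 ω, v⟫ ^ 2 ∂P

/-- The tail assumption with constant `K` for one model. -/
def HasTail [MeasurableSpace Ω] (D : Model 𝒳 𝒴 Ω) (P : Measure Ω) (K : ℝ) : Prop :=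
  ∀ t : lp (fun _ : Idx D.dX × Idx D.dY => ℝ) 2,
    orliczNorm 2 (D.pairVInf t) P ≤ ENNReal.ofReal (K * √(variance (D.pairVInf t) P))

theorem secX_nonneg [MeasurableSpace Ω] (D : Model 𝒳 𝒴 Ω) (P : Measure Ω) (u : 𝒳) :
    0 ≤ D.secX P u := integral_nonneg fun _ => sq_nonneg _

theorem secY_nonneg [MeasurableSpace Ω] (D : Model 𝒳 𝒴 Ω) (P : Measure Ω) (v : 𝒴) :
    0 ≤ D.secY P v := integral_nonneg fun _ => sq_nonneg _

/-- In the direction of an elementary tensor, `⟨V_1^∞, t⟩` is a product of two scores. -/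
theorem exists_pairVInf_eq_score (D : Model 𝒳 𝒴 Ω) (u : 𝒳) (v : 𝒴) :
    ∃ t, D.pairVInf t = D.score u v 0 := by
  have hu : Summable fun i => (⟪D.φ i, u⟫ : ℝ) ^ 2 :=
    (D.φ.summable_inner_mul_inner u u).congr fun i => by rw [real_inner_comm (D.φ i) u, sq]
  have hv : Summable fun i => (⟪D.ψ i, v⟫ : ℝ) ^ 2 :=
    (D.ψ.summable_inner_mul_inner v v).congr fun i => by rw [real_inner_comm (D.ψ i) v, sq]
  have hmem : Memℓp (fun j : Idx D.dX × Idx D.dY => (⟪D.φ j.1, u⟫ * ⟪D.ψ j.2, v⟫ : ℝ)) 2 := by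
    rw [memℓp_gen_iff (by norm_num)]
    have h1 := hu.mul_of_nonneg hv (fun i => sq_nonneg _) (fun i => sq_nonneg _)
    refine h1.congr fun j => ?_
    simp only [ENNReal.toReal_ofNat, Real.norm_eq_abs, Real.rpow_ofNat, sq_abs, mul_pow]
  refine ⟨⟨fun j => ⟪D.φ j.1, u⟫ * ⟪D.ψ j.2, v⟫, hmem⟩, funext fun ω => ?_⟩
  have hX := D.φ.hasSum_inner_mul_inner (D.X 0 ω) u
  have hY := D.ψ.hasSum_inner_mul_inner (D.Y 0 ω) v
  have h2 := (hX.mul hY (summable_mul_of_summable_norm hX.summable.norm hY.summable.norm)).tsum_eq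
  rw [score, ← h2]
  exact tsum_congr fun j => by simp only [mul_mul_mul_comm]

end Basic

section Moments

variable {𝒳 𝒴 Ω : Type*} [NormedAddCommGroup 𝒳] [InnerProductSpace ℝ 𝒳] [CompleteSpace 𝒳]
  [SecondCountableTopology 𝒳] [MeasurableSpace 𝒳] [BorelSpace 𝒳]
  [NormedAddCommGroup 𝒴] [InnerProductSpace ℝ 𝒴] [CompleteSpace 𝒴]
  [SecondCountableTopology 𝒴] [MeasurableSpace 𝒴] [BorelSpace 𝒴]
  [MeasurableSpace Ω] {P : Measure Ω} [IsProbabilityMeasure P] {D : Model 𝒳 𝒴 Ω}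

namespace IsFLM

theorem measurable_Y (hD : D.IsFLM P) (i : ℕ) : Measurable (D.Y i) :=
  (D.β.continuous.measurable.comp (hD.measurable_X i)).add (hD.measurable_Z i)

theorem measurable_score (hD : D.IsFLM P) (u : 𝒳) (v : 𝒴) (i : ℕ) : Measurable (D.score u v i) :=
  ((hD.measurable_X i).inner measurable_const).mul ((hD.measurable_Y i).inner measurable_const)

theorem memLp_X (hD : D.IsFLM P) : MemLp (D.X 0) 2 P :=
  hD.moment_X.mono_exponent (by norm_num)

theorem memLp_Y (hD : D.IsFLM P) : MemLp (D.Y 0) 2 P :=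
  (D.β.comp_memLp' hD.memLp_X).add hD.moment_Z

theorem integrable_score (hD : D.IsFLM P) (u : 𝒳) (v : 𝒴) : Integrable (D.score u v 0) P :=
  integrable_inner_mul_inner hD.memLp_X hD.memLp_Y u v

theorem hasSum_secX (hD : D.IsFLM P) (u : 𝒳) :
    HasSum (fun j => D.lam j * ⟪u, D.φ j⟫ ^ 2) (D.secX P u) := by
  have h := hasSum_covOp hD.memLp_X D.φ hD.eigen_X u u
  simpa only [mul_assoc, ← sq, secX] using h

theorem hasSum_secY (hD : D.IsFLM P) (v : 𝒴) :
    HasSum (fun j => D.rho j * ⟪v, D.ψ j⟫ ^ 2) (D.secY P v) := by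
  have h := hasSum_covOp hD.memLp_Y D.ψ hD.eigen_Y v v
  simpa only [mul_assoc, ← sq, secY] using h

theorem secX_φ (hD : D.IsFLM P) (j : Idx D.dX) : D.secX P (D.φ j) = D.lam j := by
  have h := covOp_inner hD.memLp_X (D.φ j) (D.φ j)
  rw [hD.eigen_X, inner_smul_left, real_inner_self_eq_norm_sq, D.φ.orthonormal.1 j] at h
  simp only [secX, sq, ← h]
  simp

theorem secY_ψ (hD : D.IsFLM P) (j : Idx D.dY) : D.secY P (D.ψ j) = D.rho j := by
  have h := covOp_inner hD.memLp_Y (D.ψ j) (D.ψ j)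
  rw [hD.eigen_Y, inner_smul_left, real_inner_self_eq_norm_sq, D.ψ.orthonormal.1 j] at h
  simp only [secY, sq, ← h]
  simp

theorem _root_.FLMTest.Model.HasTail.lintegral_exp_score_le {K : ℝ} (hT : D.HasTail P K)
    (hK : 0 < K)
    (u : 𝒳) (v : 𝒴) {t : ℝ} (ht : K * √(variance (D.score u v 0) P) < t) :
    ∫⁻ ω, ENNReal.ofReal (Real.exp (D.score u v 0 ω ^ 2 / t ^ 2)) ∂P ≤ 2 := by
  obtain ⟨s, hs⟩ := D.exists_pairVInf_eq_score u v
  have h := hT s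
  rw [hs] at h
  exact lintegral_exp_sq_le_of_orliczNorm_lt h (by positivity) ht

theorem memLp_score (hD : D.IsFLM P) {K : ℝ} (hK : 0 < K) (hT : D.HasTail P K)
    (u : 𝒳) (v : 𝒴) : MemLp (D.score u v 0) 4 P :=
  (memLp_four_of_lintegral_exp (hD.measurable_score u v 0) (by positivity)
    (hT.lintegral_exp_score_le hK u v (lt_add_one _))).1

/-- The tail assumption at `t` slightly above `K σ`, in the limit; in particular the mean is
controlled by the standard deviation. -/
theorem integral_score_sq_le_variance (hD : D.IsFLM P) {K : ℝ} (hK : 0 < K) (hT : D.HasTail P K)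
    (u : 𝒳) (v : 𝒴) :
    ∫ ω, D.score u v 0 ω ^ 2 ∂P ≤ 2 * K ^ 2 * variance (D.score u v 0) P := by
  set a := K * √(variance (D.score u v 0) P) with ha
  have hlim : Tendsto (fun t : ℝ => 2 * t ^ 2) (𝓝[>] a) (𝓝 (2 * a ^ 2)) :=
    ((by fun_prop : Continuous fun t : ℝ => 2 * t ^ 2).tendsto a).mono_left nhdsWithin_le_nhds
  have h : ∫ ω, D.score u v 0 ω ^ 2 ∂P ≤ 2 * a ^ 2 := by
    refine ge_of_tendsto hlim (eventually_mem_nhdsWithin.mono fun t ht => ?_)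
    exact (memLp_four_of_lintegral_exp (hD.measurable_score u v 0)
      ((by positivity : 0 ≤ a).trans_lt ht) (hT.lintegral_exp_score_le hK u v ht)).2.1
  rw [ha, mul_pow, Real.sq_sqrt (variance_nonneg _ _)] at h
  linarith

theorem variance_score_le (hD : D.IsFLM P) (u : 𝒳) (v : 𝒴) :
    variance (D.score u v 0) P ≤ ∫ ω, D.score u v 0 ω ^ 2 ∂P :=
  variance_le_expectation_sq (hD.measurable_score u v 0).aestronglyMeasurable

theorem integral_score_pow_four_le_sq (hD : D.IsFLM P) {K : ℝ} (hK : 0 < K) (hT : D.HasTail P K)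
    (u : 𝒳) (v : 𝒴) :
    ∫ ω, D.score u v 0 ω ^ 4 ∂P ≤ (2 * K ^ 2) ^ 2 * (∫ ω, D.score u v 0 ω ^ 2 ∂P) ^ 2 := by
  set a := K * √(variance (D.score u v 0) P) with ha
  have hlim : Tendsto (fun t : ℝ => 4 * t ^ 4) (𝓝[>] a) (𝓝 (4 * a ^ 4)) :=
    ((by fun_prop : Continuous fun t : ℝ => 4 * t ^ 4).tendsto a).mono_left nhdsWithin_le_nhds
  have h : ∫ ω, D.score u v 0 ω ^ 4 ∂P ≤ 4 * a ^ 4 := by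
    refine ge_of_tendsto hlim (eventually_mem_nhdsWithin.mono fun t ht => ?_)
    exact (memLp_four_of_lintegral_exp (hD.measurable_score u v 0)
      ((by positivity : 0 ≤ a).trans_lt ht) (hT.lintegral_exp_score_le hK u v ht)).2.2
  have h2 : a ^ 4 = K ^ 4 * (variance (D.score u v 0) P) ^ 2 := by
    rw [ha, mul_pow, show (√(variance (D.score u v 0) P)) ^ 4 =
      (√(variance (D.score u v 0) P) ^ 2) ^ 2 by ring, Real.sq_sqrt (variance_nonneg _ _)]
  rw [h2] at h
  calc _ ≤ _ := h
    _ = (2 * K ^ 2) ^ 2 * (variance (D.score u v 0) P) ^ 2 := by ring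
    _ ≤ _ := by
      gcongr
      · exact variance_nonneg _ _
      · exact hD.variance_score_le u v

/-- The second moment of a product of scores is controlled by its first absolute moment. -/
theorem sqrt_integral_score_sq_le (hD : D.IsFLM P) {K : ℝ} (hK : 0 < K) (hT : D.HasTail P K)
    (u : 𝒳) (v : 𝒴) :
    √(∫ ω, D.score u v 0 ω ^ 2 ∂P) ≤ 8 * K ^ 2 * ∫ ω, |D.score u v 0 ω| ∂P := by
  have := sqrt_integral_sq_le_mul_integral_abs (hD.memLp_score hK hT u v) (by positivity)
    (hD.integral_score_pow_four_le_sq hK hT u v)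
  linarith

theorem integral_abs_score_sq_le (hD : D.IsFLM P) (u : 𝒳) (v : 𝒴) :
    (∫ ω, |D.score u v 0 ω| ∂P) ^ 2 ≤ D.secX P u * D.secY P v := by
  have h := sq_integral_mul_le (hD.memLp_X.inner_const u).abs (hD.memLp_Y.inner_const v).abs
  simpa only [Pi.abs_apply, sq_abs, ← abs_mul, score, secX, secY] using h

/-- The reverse Hölder inequality decouples the second moment of a product of scores: `E ⟪X, u⟫²
⟪Y, v⟫²` is controlled by `E ⟪X, u⟫² E ⟪Y, v⟫²`. -/
theorem integral_score_sq_le (hD : D.IsFLM P) {K : ℝ} (hK : 0 < K) (hT : D.HasTail P K)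
    (u : 𝒳) (v : 𝒴) :
    ∫ ω, D.score u v 0 ω ^ 2 ∂P ≤ 64 * K ^ 4 * (D.secX P u * D.secY P v) := by
  have h0 : 0 ≤ ∫ ω, D.score u v 0 ω ^ 2 ∂P := integral_nonneg fun _ => sq_nonneg _
  calc ∫ ω, D.score u v 0 ω ^ 2 ∂P = √(∫ ω, D.score u v 0 ω ^ 2 ∂P) ^ 2 := (Real.sq_sqrt h0).symm
    _ ≤ (8 * K ^ 2 * ∫ ω, |D.score u v 0 ω| ∂P) ^ 2 := by
      gcongr; exact hD.sqrt_integral_score_sq_le hK hT u v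
    _ = 64 * K ^ 4 * (∫ ω, |D.score u v 0 ω| ∂P) ^ 2 := by ring
    _ ≤ _ := by gcongr; exact hD.integral_abs_score_sq_le u v

theorem integral_score_pow_four_le (hD : D.IsFLM P) {K : ℝ} (hK : 0 < K) (hT : D.HasTail P K)
    (u : 𝒳) (v : 𝒴) :
    ∫ ω, D.score u v 0 ω ^ 4 ∂P ≤ (128 * K ^ 6 * (D.secX P u * D.secY P v)) ^ 2 := by
  have h0 : 0 ≤ ∫ ω, D.score u v 0 ω ^ 2 ∂P := integral_nonneg fun _ => sq_nonneg _
  calc _ ≤ _ := hD.integral_score_pow_four_le_sq hK hT u v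
    _ ≤ (2 * K ^ 2) ^ 2 * (64 * K ^ 4 * (D.secX P u * D.secY P v)) ^ 2 := by
      gcongr; exact hD.integral_score_sq_le hK hT u v
    _ = _ := by ring

instance (d : ℕ∞) : Countable (Idx d) := Subtype.countable

/-- `‖X‖² ‖Y‖²` is square integrable, with a bound that depends on the tail constant and on the
traces of the covariance operators only. -/
theorem lintegral_norm_sq_mul_norm_sq_sq_le (hD : D.IsFLM P) {K : ℝ} (hK : 0 < K)
    (hT : D.HasTail P K) {LX LY : ℝ} (hX : ∑' j, ENNReal.ofReal (D.lam j) ≤ ENNReal.ofReal LX)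
    (hY : ∑' j, ENNReal.ofReal (D.rho j) ≤ ENNReal.ofReal LY) :
    ∫⁻ ω, ENNReal.ofReal (‖D.X 0 ω‖ ^ 2 * ‖D.Y 0 ω‖ ^ 2) ^ 2 ∂P ≤
      (ENNReal.ofReal (128 * K ^ 6) * (ENNReal.ofReal LX * ENNReal.ofReal LY)) ^ 2 := by
  have h1 : ∀ ω, ENNReal.ofReal (‖D.X 0 ω‖ ^ 2 * ‖D.Y 0 ω‖ ^ 2) =
      ∑' a : Idx D.dX × Idx D.dY, ENNReal.ofReal (D.score (D.φ a.1) (D.ψ a.2) 0 ω ^ 2) := by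
    intro ω
    rw [ENNReal.ofReal_mul (by positivity), ← tsum_ofReal_inner_sq D.φ, ← tsum_ofReal_inner_sq D.ψ,
      ENNReal.tsum_prod', ← ENNReal.tsum_mul_right]
    refine tsum_congr fun i => ?_
    rw [← ENNReal.tsum_mul_left]
    refine tsum_congr fun j => ?_
    rw [← ENNReal.ofReal_mul (by positivity), score, mul_pow]
  have h2 : ENNReal.ofReal (128 * K ^ 6) * (∑' j, ENNReal.ofReal (D.lam j)) *
      (∑' j, ENNReal.ofReal (D.rho j)) = ∑' a : Idx D.dX × Idx D.dY,
      ENNReal.ofReal (128 * K ^ 6 * (D.lam a.1 * D.rho a.2)) := by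
    rw [ENNReal.tsum_prod', ← ENNReal.tsum_mul_left (f := fun j => ENNReal.ofReal (D.lam j)),
      ← ENNReal.tsum_mul_right]
    refine tsum_congr fun i => ?_
    rw [← ENNReal.tsum_mul_left]
    refine tsum_congr fun j => ?_
    rw [← ENNReal.ofReal_mul (by positivity), ← ENNReal.ofReal_mul
      (mul_nonneg (by positivity) (hD.lam_pos i).le), mul_assoc]
  simp_rw [h1]
  calc _ ≤ (∑' a : Idx D.dX × Idx D.dY,
      ENNReal.ofReal (128 * K ^ 6 * (D.lam a.1 * D.rho a.2))) ^ 2 := by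
        refine lintegral_tsum_sq_le (fun a => ?_) fun a => ?_
        · exact ((hD.measurable_score _ _ 0).pow_const 2).ennreal_ofReal
        · have h3 := hD.integral_score_pow_four_le hK hT (D.φ a.1) (D.ψ a.2)
          rw [hD.secX_φ, hD.secY_ψ] at h3
          have hi : Integrable (fun ω => D.score (D.φ a.1) (D.ψ a.2) 0 ω ^ 4) P := by
            have := (hD.memLp_score hK hT (D.φ a.1) (D.ψ a.2)).integrable_norm_pow
              (by norm_num : 4 ≠ 0)
            simpa [(by decide : Even 4).pow_abs] using this
          have hpos := mul_pos (hD.lam_pos a.1) (hD.rho_pos a.2)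
          rw [← ENNReal.ofReal_pow (by positivity)]
          refine le_trans (le_of_eq ?_) (ENNReal.ofReal_le_ofReal h3)
          rw [ofReal_integral_eq_lintegral_ofReal hi (ae_of_all _ fun ω => by positivity)]
          refine lintegral_congr fun ω => ?_
          rw [← ENNReal.ofReal_pow (by positivity)]
          congr 1
          ring
    _ ≤ _ := by
        rw [← h2, mul_assoc]
        gcongr

theorem integral_norm_sq_mul_norm_sq_sq_le (hD : D.IsFLM P) {K : ℝ} (hK : 0 < K)
    (hT : D.HasTail P K) {LX LY : ℝ} (hLX : 0 ≤ LX) (hLY : 0 ≤ LY)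
    (hX : ∑' j, ENNReal.ofReal (D.lam j) ≤ ENNReal.ofReal LX)
    (hY : ∑' j, ENNReal.ofReal (D.rho j) ≤ ENNReal.ofReal LY) :
    MemLp (fun ω => ‖D.X 0 ω‖ ^ 2 * ‖D.Y 0 ω‖ ^ 2) 2 P ∧
      ∫ ω, (‖D.X 0 ω‖ ^ 2 * ‖D.Y 0 ω‖ ^ 2) ^ 2 ∂P ≤ (128 * K ^ 6 * (LX * LY)) ^ 2 := by
  have h := hD.lintegral_norm_sq_mul_norm_sq_sq_le hK hT hX hY
  have hm : Measurable fun ω => ‖D.X 0 ω‖ ^ 2 * ‖D.Y 0 ω‖ ^ 2 :=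
    ((hD.measurable_X 0).norm.pow_const 2).mul ((hD.measurable_Y 0).norm.pow_const 2)
  rw [← ENNReal.ofReal_mul hLX, ← ENNReal.ofReal_mul (by positivity),
    ← ENNReal.ofReal_pow (by positivity)] at h
  simp_rw [← ENNReal.ofReal_pow (show 0 ≤ ‖D.X 0 _‖ ^ 2 * ‖D.Y 0 _‖ ^ 2 by positivity)] at h
  have hi : Integrable (fun ω => (‖D.X 0 ω‖ ^ 2 * ‖D.Y 0 ω‖ ^ 2) ^ 2) P := by
    refine ⟨(hm.pow_const 2).aestronglyMeasurable, ?_⟩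
    rw [hasFiniteIntegral_iff_ofReal (ae_of_all _ fun ω => by positivity)]
    exact h.trans_lt ENNReal.ofReal_lt_top
  refine ⟨(memLp_two_iff_integrable_sq hm.aestronglyMeasurable).2 hi, ?_⟩
  rw [← ofReal_integral_eq_lintegral_ofReal hi (ae_of_all _ fun ω => by positivity)] at h
  exact (ENNReal.ofReal_le_ofReal_iff (by positivity)).1 h

end IsFLM

end Moments
end Model
end FLMTest

namespace FLMTest

theorem memLp_two_sq_of_memLp_four {Ω : Type*} [MeasurableSpace Ω] {P : Measure Ω} {f : Ω → ℝ}
    (hf : MemLp f 4 P) : MemLp (fun ω => f ω ^ 2) 2 P := by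
  refine (memLp_two_iff_integrable_sq (hf.1.pow 2)).2 ?_
  have := hf.integrable_norm_pow (by norm_num : 4 ≠ 0)
  refine this.congr (ae_of_all _ fun ω => ?_)
  simp only [Real.norm_eq_abs, (by decide : Even 4).pow_abs, Pi.pow_apply]
  ring

theorem integral_inner_sum_sq {Ω E ι κ : Type*} [MeasurableSpace Ω] [NormedAddCommGroup E]
    [InnerProductSpace ℝ E] [CompleteSpace E] [Fintype κ] {P : Measure Ω} {ξ : Ω → E}
    (hξ : MemLp ξ 2 P) (e : HilbertBasis ι ℝ E)
    {l : ι → ℝ} (he : ∀ j, covOp ξ P (e j) = l j • e j) {g : κ → ι} (hg : g.Injective)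
    (c : κ → ℝ) :
    ∫ ω, ⟪ξ ω, ∑ j, c j • e (g j)⟫ ^ 2 ∂P = ∑ j, c j ^ 2 * l (g j) := by
  simp_rw [sq (⟪ξ _, _⟫ : ℝ)]
  rw [← covOp_inner hξ, map_sum]
  simp_rw [map_smul, he, smul_smul]
  have h := (e.orthonormal.comp g hg).inner_sum (fun j => c j * l (g j)) c Finset.univ
  simp only [Function.comp_apply] at h
  rw [h]
  refine Finset.sum_congr rfl fun j _ => ?_
  simp only [conj_trivial]
  ring

namespace Model

variable {𝒳 𝒴 Ω : Type*} [NormedAddCommGroup 𝒳] [InnerProductSpace ℝ 𝒳] [CompleteSpace 𝒳]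
  [SecondCountableTopology 𝒳] [MeasurableSpace 𝒳] [BorelSpace 𝒳]
  [NormedAddCommGroup 𝒴] [InnerProductSpace ℝ 𝒴] [CompleteSpace 𝒴]
  [SecondCountableTopology 𝒴] [MeasurableSpace 𝒴] [BorelSpace 𝒴]
  [MeasurableSpace Ω] {P : Measure Ω} [IsProbabilityMeasure P] {D : Model 𝒳 𝒴 Ω}

/-! ### Signal and error parts of the response -/

namespace IsFLM

theorem integral_mul_of_indep (hD : D.IsFLM P) {f : 𝒳 → ℝ} {g : 𝒴 → ℝ} (hf : Measurable f)
    (hg : Measurable g) :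
    ∫ ω, f (D.X 0 ω) * g (D.Z 0 ω) ∂P = (∫ ω, f (D.X 0 ω) ∂P) * ∫ ω, g (D.Z 0 ω) ∂P :=
  (hD.indep_error.comp hf hg).integral_fun_mul_eq_mul_integral
    (hf.comp (hD.measurable_X 0)).aestronglyMeasurable
    (hg.comp (hD.measurable_Z 0)).aestronglyMeasurable

theorem integrable_mul_of_indep (hD : D.IsFLM P) {f : 𝒳 → ℝ} {g : 𝒴 → ℝ} (hf : Measurable f)
    (hg : Measurable g) (hfi : Integrable (fun ω => f (D.X 0 ω)) P)
    (hgi : Integrable (fun ω => g (D.Z 0 ω)) P) :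
    Integrable (fun ω => f (D.X 0 ω) * g (D.Z 0 ω)) P :=
  (hD.indep_error.comp hf hg).integrable_mul hfi hgi

theorem integral_inner_Z (hD : D.IsFLM P) (v : 𝒴) : ∫ ω, ⟪D.Z 0 ω, v⟫ ∂P = 0 := by
  simp_rw [real_inner_comm v]
  rw [integral_inner (hD.moment_Z.integrable (by norm_num)), hD.mean_Z, inner_zero_right]

theorem memLp_four_inner_β (hD : D.IsFLM P) (v : 𝒴) :
    MemLp (fun ω => ⟪D.β (D.X 0 ω), v⟫) 4 P :=
  (D.β.comp_memLp' hD.moment_X).inner_const v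

theorem inner_Y (D : Model 𝒳 𝒴 Ω) (ω : Ω) (v : 𝒴) :
    ⟪D.Y 0 ω, v⟫ = ⟪D.β (D.X 0 ω), v⟫ + ⟪D.Z 0 ω, v⟫ := by rw [Y, inner_add_left]

/-- The error is uncorrelated with every function of the predictor. -/
theorem secY_eq (hD : D.IsFLM P) (v : 𝒴) :
    D.secY P v = ∫ ω, ⟪D.β (D.X 0 ω), v⟫ ^ 2 ∂P + ∫ ω, ⟪D.Z 0 ω, v⟫ ^ 2 ∂P := by
  have hm1 : Measurable fun x : 𝒳 => ⟪D.β x, v⟫ :=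
    (D.β.continuous.inner continuous_const).measurable
  have hm2 : Measurable fun z : 𝒴 => ⟪z, v⟫ := (continuous_id.inner continuous_const).measurable
  have hG : MemLp (fun ω => ⟪D.β (D.X 0 ω), v⟫) 2 P :=
    (hD.memLp_four_inner_β v).mono_exponent (by norm_num)
  have hζ : MemLp (fun ω => ⟪D.Z 0 ω, v⟫) 2 P := hD.moment_Z.inner_const v
  have h0 := hD.integral_mul_of_indep hm1 hm2
  rw [hD.integral_inner_Z, mul_zero] at h0
  have hi := hG.integrable_mul hζ
  have hi' : Integrable (fun ω => 2 * (⟪D.β (D.X 0 ω), v⟫ * ⟪D.Z 0 ω, v⟫)) P := hi.const_mul 2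
  have h3 : Integrable (fun ω => 2 * (⟪D.β (D.X 0 ω), v⟫ * ⟪D.Z 0 ω, v⟫) + ⟪D.Z 0 ω, v⟫ ^ 2) P :=
    hi'.add hζ.integrable_sq
  have h4 : ∀ ω, ⟪D.Y 0 ω, v⟫ ^ 2 = ⟪D.β (D.X 0 ω), v⟫ ^ 2 +
      (2 * (⟪D.β (D.X 0 ω), v⟫ * ⟪D.Z 0 ω, v⟫) + ⟪D.Z 0 ω, v⟫ ^ 2) := fun ω => by
    rw [inner_Y]; ring
  simp_rw [secY, h4]
  rw [integral_add hG.integrable_sq h3, integral_add hi' hζ.integrable_sq, integral_const_mul, h0]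
  ring

theorem integral_score_sq_eq (hD : D.IsFLM P) (u : 𝒳) (v : 𝒴) :
    ∫ ω, D.score u v 0 ω ^ 2 ∂P = ∫ ω, ⟪D.X 0 ω, u⟫ ^ 2 * ⟪D.β (D.X 0 ω), v⟫ ^ 2 ∂P +
      D.secX P u * ∫ ω, ⟪D.Z 0 ω, v⟫ ^ 2 ∂P := by
  have hm0 : Measurable fun x : 𝒳 => ⟪x, u⟫ := (continuous_id.inner continuous_const).measurable
  have hm1 : Measurable fun x : 𝒳 => ⟪D.β x, v⟫ :=
    (D.β.continuous.inner continuous_const).measurable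
  have hm2 : Measurable fun z : 𝒴 => ⟪z, v⟫ := (continuous_id.inner continuous_const).measurable
  have hU : MemLp (fun ω => ⟪D.X 0 ω, u⟫) 4 P := hD.moment_X.inner_const u
  have hG := hD.memLp_four_inner_β v
  have hζ : MemLp (fun ω => ⟪D.Z 0 ω, v⟫) 2 P := hD.moment_Z.inner_const v
  have hU2 := memLp_two_sq_of_memLp_four hU
  have hG2 : MemLp (fun ω => ⟪D.β (D.X 0 ω), v⟫) 2 P := hG.mono_exponent (by norm_num)
  have i1 : Integrable (fun ω => ⟪D.X 0 ω, u⟫ ^ 2 * ⟪D.β (D.X 0 ω), v⟫ ^ 2) P :=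
    hU2.integrable_mul (memLp_two_sq_of_memLp_four hG)
  have i2 : Integrable (fun ω => 2 * (⟪D.X 0 ω, u⟫ ^ 2 * ⟪D.β (D.X 0 ω), v⟫ * ⟪D.Z 0 ω, v⟫)) P :=
    (hD.integrable_mul_of_indep ((hm0.pow_const 2).mul hm1) hm2
      (hU2.integrable_mul hG2)
      (hζ.integrable (by norm_num))).const_mul 2
  have i3 : Integrable (fun ω => ⟪D.X 0 ω, u⟫ ^ 2 * ⟪D.Z 0 ω, v⟫ ^ 2) P :=
    hD.integrable_mul_of_indep (hm0.pow_const 2) (hm2.pow_const 2)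
      (hU2.integrable (by norm_num)) hζ.integrable_sq
  have i4 : Integrable (fun ω => 2 * (⟪D.X 0 ω, u⟫ ^ 2 * ⟪D.β (D.X 0 ω), v⟫ * ⟪D.Z 0 ω, v⟫) +
      ⟪D.X 0 ω, u⟫ ^ 2 * ⟪D.Z 0 ω, v⟫ ^ 2) P := i2.add i3
  have h2 : ∫ ω, ⟪D.X 0 ω, u⟫ ^ 2 * ⟪D.β (D.X 0 ω), v⟫ * ⟪D.Z 0 ω, v⟫ ∂P = _ :=
    hD.integral_mul_of_indep ((hm0.pow_const 2).mul hm1) hm2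
  rw [hD.integral_inner_Z, mul_zero] at h2
  have h3 := hD.integral_mul_of_indep (hm0.pow_const 2) (hm2.pow_const 2)
  have h4 : ∀ ω, D.score u v 0 ω ^ 2 = ⟪D.X 0 ω, u⟫ ^ 2 * ⟪D.β (D.X 0 ω), v⟫ ^ 2 +
      (2 * (⟪D.X 0 ω, u⟫ ^ 2 * ⟪D.β (D.X 0 ω), v⟫ * ⟪D.Z 0 ω, v⟫) +
        ⟪D.X 0 ω, u⟫ ^ 2 * ⟪D.Z 0 ω, v⟫ ^ 2) := fun ω => by
    rw [score, inner_Y]; ring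
  simp_rw [h4]
  rw [integral_add i1 i4, integral_add i2 i3, integral_const_mul, h2, h3, secX]
  ring

theorem mul_integral_Z_le_integral_score_sq (hD : D.IsFLM P) (u : 𝒳) (v : 𝒴) :
    D.secX P u * ∫ ω, ⟪D.Z 0 ω, v⟫ ^ 2 ∂P ≤ ∫ ω, D.score u v 0 ω ^ 2 ∂P := by
  rw [hD.integral_score_sq_eq]
  have : 0 ≤ ∫ ω, ⟪D.X 0 ω, u⟫ ^ 2 * ⟪D.β (D.X 0 ω), v⟫ ^ 2 ∂P :=
    integral_nonneg fun _ => by positivity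
  linarith

theorem integral_β_le_integral_score_sq (hD : D.IsFLM P) (u : 𝒳) (v : 𝒴) :
    ∫ ω, ⟪D.X 0 ω, u⟫ ^ 2 * ⟪D.β (D.X 0 ω), v⟫ ^ 2 ∂P ≤ ∫ ω, D.score u v 0 ω ^ 2 ∂P := by
  rw [hD.integral_score_sq_eq]
  have : 0 ≤ D.secX P u * ∫ ω, ⟪D.Z 0 ω, v⟫ ^ 2 ∂P :=
    mul_nonneg (D.secX_nonneg P u) (integral_nonneg fun _ => by positivity)
  linarith

/-! ### The tail assumption bounds the smaller of the two dimensions -/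

/-- A sub-Gaussian bound for all sign combinations of `d × d` products of scores limits `d`: the
maximum of `4 ^ d` sub-Gaussian variables at scale `d` is of order `d ^ (3 / 2)`, while it equals
the sum of the absolute values of the `d ^ 2` products. -/
theorem card_le_of_signs (hD : D.IsFLM P) {K : ℝ} (hK : 0 < K) (hT : D.HasTail P K) {d : ℕ}
    (u : Fin d → 𝒳) (v : Fin d → 𝒴)
    (hu : ∀ a : Fin d → ℝ, (∀ i, a i ^ 2 = 1) → D.secX P (∑ i, a i • u i) ≤ d)
    (hv : ∀ a : Fin d → ℝ, (∀ i, a i ^ 2 = 1) → D.secY P (∑ i, a i • v i) ≤ d)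
    (hu1 : ∀ i, D.secX P (u i) ≤ 1) (hv1 : ∀ i, D.secY P (v i) ≤ 1)
    (hS : (d : ℝ) ^ 2 / 4 ≤ ∑ i, ∑ j, ∫ ω, D.score (u i) (v j) 0 ω ^ 2 ∂P) :
    (d : ℝ) ≤ 192 * K ^ 2 * (8 * K ^ 2) ^ 6 := by
  rcases Nat.eq_zero_or_pos d with rfl | hd
  · simp; positivity
  have hd1 : (1 : ℝ) ≤ d := by exact_mod_cast hd
  set A := 8 * K ^ 2 with hA
  have hApos : 0 < A := by positivity
  set t := 2 * K * A * d with ht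
  have htpos : 0 < t := by positivity
  have hs : ∀ x y, √(∫ ω, D.score x y 0 ω ^ 2 ∂P) ≤ A * √(D.secX P x * D.secY P y) := fun x y => by
    refine (hD.sqrt_integral_score_sq_le hK hT x y).trans ?_
    gcongr
    exact Real.le_sqrt_of_sq_le (hD.integral_abs_score_sq_le x y)
  have hexp : ∀ x y, D.secX P x ≤ d → D.secY P y ≤ d →
      ∫⁻ ω, ENNReal.ofReal (Real.exp (D.score x y 0 ω ^ 2 / t ^ 2)) ∂P ≤ 2 := fun x y hx hy => by
    refine hT.lintegral_exp_score_le hK x y ?_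
    have h1 : √(variance (D.score x y 0) P) ≤ A * d := by
      calc _ ≤ √(∫ ω, D.score x y 0 ω ^ 2 ∂P) := Real.sqrt_le_sqrt (hD.variance_score_le x y)
        _ ≤ A * √(D.secX P x * D.secY P y) := hs x y
        _ ≤ A * √((d : ℝ) * d) := by
          gcongr
          · exact D.secY_nonneg P y
        _ = A * d := by rw [Real.sqrt_mul_self (by positivity)]
    calc _ ≤ K * (A * d) := by gcongr
      _ < t := by rw [ht]; nlinarith [mul_pos (mul_pos hK hApos) (zero_lt_one.trans_le hd1)]
  set M : Ω → ℝ := fun ω => ∑ i, ∑ j, |D.score (u i) (v j) 0 ω| with hM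
  have hMm : Measurable M := Finset.measurable_sum _ fun i _ => Finset.measurable_sum _ fun j _ =>
    (hD.measurable_score (u i) (v j) 0).abs
  have hMi : Integrable M P := integrable_finsetSum _ fun i _ => integrable_finsetSum _ fun j _ =>
    (hD.integrable_score (u i) (v j)).abs
  have hEM : (d : ℝ) ^ 2 / (4 * A ^ 2) ≤ ∫ ω, M ω ∂P := by
    rw [hM, integral_finsetSum _ fun i _ => integrable_finsetSum _ fun j _ =>
      (hD.integrable_score (u i) (v j)).abs]
    simp_rw [integral_finsetSum Finset.univ fun j _ => (hD.integrable_score (u _) (v j)).abs]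
    rw [div_le_iff₀ (by positivity)]
    have h1 : ∀ i j, ∫ ω, D.score (u i) (v j) 0 ω ^ 2 ∂P ≤
        A ^ 2 * ∫ ω, |D.score (u i) (v j) 0 ω| ∂P := fun i j => by
      have h0 : 0 ≤ ∫ ω, D.score (u i) (v j) 0 ω ^ 2 ∂P := integral_nonneg fun _ => sq_nonneg _
      have h2 : √(∫ ω, D.score (u i) (v j) 0 ω ^ 2 ∂P) ≤ A := by
        refine (hs _ _).trans ?_
        have : √(D.secX P (u i) * D.secY P (v j)) ≤ 1 := by
          rw [Real.sqrt_le_one]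
          exact mul_le_one₀ (hu1 i) (D.secY_nonneg P _) (hv1 j)
        nlinarith
      calc ∫ ω, D.score (u i) (v j) 0 ω ^ 2 ∂P
          = √(∫ ω, D.score (u i) (v j) 0 ω ^ 2 ∂P) * √(∫ ω, D.score (u i) (v j) 0 ω ^ 2 ∂P) :=
            (Real.mul_self_sqrt h0).symm
        _ ≤ A * (A * ∫ ω, |D.score (u i) (v j) 0 ω| ∂P) :=
            mul_le_mul h2 (hD.sqrt_integral_score_sq_le hK hT _ _) (Real.sqrt_nonneg _) hApos.le
        _ = _ := by ring
    have h3 : ∑ i, ∑ j, ∫ ω, D.score (u i) (v j) 0 ω ^ 2 ∂P ≤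
        A ^ 2 * ∑ i, ∑ j, ∫ ω, |D.score (u i) (v j) 0 ω| ∂P := by
      rw [Finset.mul_sum]
      refine Finset.sum_le_sum fun i _ => ?_
      rw [Finset.mul_sum]
      exact Finset.sum_le_sum fun j _ => h1 i j
    linarith
  let sg : Bool → ℝ := fun b => if b then 1 else -1
  have hsg : ∀ b, sg b ^ 2 = 1 := fun b => by cases b <;> simp [sg]
  have hsgx : ∀ x : ℝ, sg (decide (0 ≤ x)) * x = |x| := fun x => by
    by_cases h : 0 ≤ x
    · simp [sg, h, abs_of_nonneg]
    · simp [sg, h, abs_of_neg (not_le.1 h)]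
  let w : (Fin d → Bool) × (Fin d → Bool) → Ω → ℝ := fun s =>
    D.score (∑ i, sg (s.1 i) • u i) (∑ j, sg (s.2 j) • v j) 0
  have hMw : ∀ ω, ∃ s, M ω = w s ω := fun ω => by
    refine ⟨(fun i => decide (0 ≤ ⟪D.X 0 ω, u i⟫), fun j => decide (0 ≤ ⟪D.Y 0 ω, v j⟫)), ?_⟩
    simp only [w, score, inner_sum, inner_smul_right, hsgx, hM, Finset.sum_mul_sum, abs_mul]
  have hcard : (Fintype.card ((Fin d → Bool) × (Fin d → Bool)) : ℝ) = 4 ^ d := by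
    simp only [Fintype.card_prod, Fintype.card_pi, Fintype.card_bool, Finset.prod_const,
      Finset.card_univ, Fintype.card_fin]
    push_cast
    rw [← mul_pow]
    norm_num
  have hlint : ∫⁻ ω, ENNReal.ofReal (Real.exp (M ω ^ 2 / t ^ 2)) ∂P ≤
      ENNReal.ofReal (4 ^ d * 2) := by
    calc _ ≤ ∫⁻ ω, ∑ s, ENNReal.ofReal (Real.exp (w s ω ^ 2 / t ^ 2)) ∂P := by
          refine lintegral_mono fun ω => ?_
          obtain ⟨s, hs⟩ := hMw ω
          rw [hs]
          exact Finset.single_le_sum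
            (f := fun s => ENNReal.ofReal (Real.exp (w s ω ^ 2 / t ^ 2)))
            (fun _ _ => zero_le) (Finset.mem_univ s)
      _ = ∑ s, ∫⁻ ω, ENNReal.ofReal (Real.exp (w s ω ^ 2 / t ^ 2)) ∂P := by
          refine lintegral_finsetSum _ fun s _ => ?_
          have := hD.measurable_score (∑ i, sg (s.1 i) • u i) (∑ j, sg (s.2 j) • v j) 0
          fun_prop
      _ ≤ ∑ s : (Fin d → Bool) × (Fin d → Bool), 2 := Finset.sum_le_sum fun s _ =>
          hexp _ _ (hu _ fun i => hsg _) (hv _ fun i => hsg _)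
      _ = _ := by
          rw [Finset.sum_const, Finset.card_univ, nsmul_eq_mul, ← hcard,
            ENNReal.ofReal_mul (by positivity), ENNReal.ofReal_natCast]
          simp
  have hexpi : Integrable (fun ω => Real.exp (M ω ^ 2 / t ^ 2)) P := by
    refine ⟨by fun_prop, ?_⟩
    rw [hasFiniteIntegral_iff_ofReal (ae_of_all _ fun ω => (Real.exp_pos _).le)]
    exact hlint.trans_lt ENNReal.ofReal_lt_top
  have hE : ∫ ω, Real.exp (M ω ^ 2 / t ^ 2) ∂P ≤ 4 ^ d * 2 := by
    rw [integral_eq_lintegral_of_nonneg_ae (ae_of_all _ fun ω => (Real.exp_pos _).le) (by fun_prop)]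
    exact ENNReal.toReal_le_of_le_ofReal (by positivity) hlint
  set m := (∫ ω, M ω ∂P) / t with hm
  have hm0 : (d : ℝ) / (8 * K * A ^ 3) ≤ m := by
    rw [hm, le_div_iff₀ htpos]
    calc _ = (d : ℝ) ^ 2 / (4 * A ^ 2) := by rw [ht]; field_simp; norm_num
      _ ≤ _ := hEM
  have hm0' : 0 ≤ m := le_trans (by positivity) hm0
  -- Jensen's inequality for `exp (x ^ 2)`
  have hJ : Real.exp (m ^ 2) ≤ ∫ ω, Real.exp (M ω ^ 2 / t ^ 2) ∂P := by
    have hpt : ∀ ω, Real.exp (m ^ 2) * (1 - 2 * m ^ 2) + (Real.exp (m ^ 2) * (2 * m / t)) * M ω ≤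
        Real.exp (M ω ^ 2 / t ^ 2) := fun ω => by
      have h1 : m ^ 2 + 2 * m * (M ω / t - m) ≤ M ω ^ 2 / t ^ 2 := by
        rw [← div_pow]; nlinarith [sq_nonneg (M ω / t - m)]
      have h2 := Real.add_one_le_exp (2 * m * (M ω / t - m))
      calc _ = Real.exp (m ^ 2) * (2 * m * (M ω / t - m) + 1) := by ring
        _ ≤ Real.exp (m ^ 2) * Real.exp (2 * m * (M ω / t - m)) := by gcongr
        _ = Real.exp (m ^ 2 + 2 * m * (M ω / t - m)) := by rw [Real.exp_add]
        _ ≤ _ := Real.exp_le_exp.2 h1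
    have hMi' : Integrable (fun ω => (Real.exp (m ^ 2) * (2 * m / t)) * M ω) P := hMi.const_mul _
    have h3 : ∫ ω, (Real.exp (m ^ 2) * (1 - 2 * m ^ 2) +
        (Real.exp (m ^ 2) * (2 * m / t)) * M ω) ∂P ≤ _ :=
      integral_mono ((integrable_const _).add hMi') hexpi hpt
    have h4 : ∫ ω, M ω ∂P = m * t := by rw [hm]; field_simp
    rw [integral_add (integrable_const _) hMi', integral_const_mul _ M, h4, integral_const,
      probReal_univ, one_smul] at h3
    refine le_trans (le_of_eq ?_) h3
    field_simp
    ring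
  have h5 : Real.exp (m ^ 2) ≤ Real.exp (3 * d) := by
    calc _ ≤ 4 ^ d * (2 : ℝ) := hJ.trans hE
      _ ≤ 4 ^ d * 2 ^ d := by
        gcongr
        exact le_self_pow₀ (by norm_num) hd.ne'
      _ = ((2 : ℝ) ^ 3) ^ d := by rw [← mul_pow]; norm_num
      _ ≤ (Real.exp 1 ^ 3) ^ d := by
        gcongr
        linarith [Real.add_one_le_exp (1 : ℝ)]
      _ = _ := by
        rw [← pow_mul, ← Real.exp_nat_mul]
        push_cast
        ring_nf
  have h6 : m ^ 2 ≤ 3 * d := Real.exp_le_exp.1 h5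
  have h7 : ((d : ℝ) / (8 * K * A ^ 3)) ^ 2 ≤ 3 * d := le_trans (by gcongr) h6
  rw [div_pow, div_le_iff₀ (by positivity)] at h7
  have h8 : (d : ℝ) * d ≤ d * (192 * K ^ 2 * A ^ 6) := by
    calc (d : ℝ) * d = (d : ℝ) ^ 2 := by ring
      _ ≤ _ := h7
      _ = _ := by ring
  exact le_of_mul_le_mul_left h8 (by linarith)

/-- The tail assumption bounds the smaller of the two dimensions. -/
theorem dim_le (hD : D.IsFLM P) {K : ℝ} (hK : 0 < K) (hT : D.HasTail P K) {d : ℕ}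
    (hdX : (d : ℕ∞) ≤ D.dX) (hdY : (d : ℕ∞) ≤ D.dY) :
    (d : ℝ) ≤ 192 * K ^ 2 * (8 * K ^ 2) ^ 6 := by
  have hinj : ∀ {e : ℕ∞} (h : (d : ℕ∞) ≤ e), Function.Injective (Idx.ofFin h) := fun h a b hab => by
    have := congrArg Subtype.val hab
    exact Fin.ext this
  set v : Fin d → 𝒴 := fun j => (√(D.rho (Idx.ofFin hdY j)))⁻¹ • D.ψ (Idx.ofFin hdY j) with hv
  have hcY : ∀ a : Fin d → ℝ, D.secY P (∑ i, a i • v i) = ∑ i, a i ^ 2 := fun a => by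
    have h := integral_inner_sum_sq hD.memLp_Y D.ψ hD.eigen_Y (hinj hdY)
      fun i => a i * (√(D.rho (Idx.ofFin hdY i)))⁻¹
    simp_rw [secY, hv, smul_smul, h]
    refine Finset.sum_congr rfl fun i _ => ?_
    have := hD.rho_pos (Idx.ofFin hdY i)
    rw [mul_pow, inv_pow, Real.sq_sqrt this.le]
    field_simp
  have hcY1 : ∀ j, D.secY P (v j) = 1 := fun j => by
    have h := hcY (Pi.single j 1)
    simpa [Pi.single_apply, Finset.sum_ite_eq', ite_smul] using h
  have hvd : ∀ a : Fin d → ℝ, (∀ i, a i ^ 2 = 1) → D.secY P (∑ i, a i • v i) ≤ d := fun a ha => by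
    rw [hcY]; simp [ha]
  -- If the errors carry half of the variance, then the eigenelements provide the scores of `X`.
  -- Otherwise `u_i = β* v_i` is used, so that the products contain `⟪β X, v_i⟫ ⟪β X, v_j⟫`.
  by_cases hZ : (d : ℝ) / 2 ≤ ∑ j, ∫ ω, ⟪D.Z 0 ω, v j⟫ ^ 2 ∂P
  · set u : Fin d → 𝒳 := fun j => (√(D.lam (Idx.ofFin hdX j)))⁻¹ • D.φ (Idx.ofFin hdX j) with hu
    have hcX : ∀ a : Fin d → ℝ, D.secX P (∑ i, a i • u i) = ∑ i, a i ^ 2 := fun a => by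
      have h := integral_inner_sum_sq hD.memLp_X D.φ hD.eigen_X (hinj hdX)
        fun i => a i * (√(D.lam (Idx.ofFin hdX i)))⁻¹
      simp_rw [secX, hu, smul_smul, h]
      refine Finset.sum_congr rfl fun i _ => ?_
      have := hD.lam_pos (Idx.ofFin hdX i)
      rw [mul_pow, inv_pow, Real.sq_sqrt this.le]
      field_simp
    have hcX1 : ∀ j, D.secX P (u j) = 1 := fun j => by
      have h := hcX (Pi.single j 1)
      simpa [Pi.single_apply, Finset.sum_ite_eq', ite_smul] using h
    refine hD.card_le_of_signs hK hT u v (fun a ha => by rw [hcX]; simp [ha]) hvd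
      (fun i => (hcX1 i).le) (fun i => (hcY1 i).le) ?_
    calc (d : ℝ) ^ 2 / 4 ≤ ∑ i : Fin d, ∑ j, ∫ ω, ⟪D.Z 0 ω, v j⟫ ^ 2 ∂P := by
          rw [Finset.sum_const, Finset.card_univ, Fintype.card_fin, nsmul_eq_mul]
          nlinarith [(Nat.cast_nonneg d : (0 : ℝ) ≤ d)]
      _ ≤ _ := by
          refine Finset.sum_le_sum fun i _ => Finset.sum_le_sum fun j _ => ?_
          have h := hD.mul_integral_Z_le_integral_score_sq (u i) (v j)
          rwa [hcX1, one_mul] at h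
  · have hβ : ∀ ω x, ⟪D.X 0 ω, D.β.adjoint x⟫ = ⟪D.β (D.X 0 ω), x⟫ := fun ω x =>
      ContinuousLinearMap.adjoint_inner_right _ _ _
    have hle : ∀ x, D.secX P (D.β.adjoint x) ≤ D.secY P x := fun x => by
      rw [hD.secY_eq]
      simp_rw [secX, hβ]
      have : 0 ≤ ∫ ω, ⟪D.Z 0 ω, x⟫ ^ 2 ∂P := integral_nonneg fun _ => sq_nonneg _
      linarith
    refine hD.card_le_of_signs hK hT (fun i => D.β.adjoint (v i)) v (fun a ha => ?_) hvd
      (fun i => (hle _).trans (hcY1 i).le) (fun i => (hcY1 i).le) ?_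
    · simp_rw [← map_smul, ← map_sum]
      exact (hle _).trans (hvd a ha)
    · have hG : ∀ i, MemLp (fun ω => ⟪D.β (D.X 0 ω), v i⟫ ^ 2) 2 P := fun i =>
        memLp_two_sq_of_memLp_four (hD.memLp_four_inner_β (v i))
      have hsum : MemLp (fun ω => ∑ i, ⟪D.β (D.X 0 ω), v i⟫ ^ 2) 2 P :=
        memLp_finsetSum _ fun i _ => hG i
      have hE : (d : ℝ) / 2 ≤ ∫ ω, ∑ i, ⟪D.β (D.X 0 ω), v i⟫ ^ 2 ∂P := by
        rw [integral_finsetSum _ fun i _ => (hG i).integrable (by norm_num)]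
        have h1 : ∑ i, (∫ ω, ⟪D.β (D.X 0 ω), v i⟫ ^ 2 ∂P + ∫ ω, ⟪D.Z 0 ω, v i⟫ ^ 2 ∂P) = d := by
          simp_rw [← hD.secY_eq, hcY1]; simp
        rw [Finset.sum_add_distrib] at h1
        linarith
      have h2 := sq_integral_mul_le hsum (memLp_const (1 : ℝ))
      simp only [mul_one, one_pow, integral_const, probReal_univ, smul_eq_mul] at h2
      have h3 : ∫ ω, (∑ i, ⟪D.β (D.X 0 ω), v i⟫ ^ 2) ^ 2 ∂P ≤
          ∑ i, ∑ j, ∫ ω, D.score (D.β.adjoint (v i)) (v j) 0 ω ^ 2 ∂P := by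
        have h4 : ∀ i j, Integrable (fun ω => ⟪D.β (D.X 0 ω), v i⟫ ^ 2 *
          ⟪D.β (D.X 0 ω), v j⟫ ^ 2) P := fun i j => (hG i).integrable_mul (hG j)
        simp_rw [sq (∑ i, _), Finset.sum_mul_sum]
        rw [integral_finsetSum _ fun i _ => integrable_finsetSum _ fun j _ => h4 i j]
        refine Finset.sum_le_sum fun i _ => ?_
        rw [integral_finsetSum _ fun j _ => h4 i j]
        refine Finset.sum_le_sum fun j _ => ?_
        have h5 := hD.integral_β_le_integral_score_sq (D.β.adjoint (v i)) (v j)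
        simpa only [hβ] using h5
      calc (d : ℝ) ^ 2 / 4 = ((d : ℝ) / 2) ^ 2 := by ring
        _ ≤ (∫ ω, ∑ i, ⟪D.β (D.X 0 ω), v i⟫ ^ 2 ∂P) ^ 2 := by gcongr
        _ ≤ _ := h2
        _ ≤ _ := h3

/-- Of the two truncation levels, one stays bounded. -/
theorem min_p_le (hD : D.IsFLM P) {K : ℝ} (hK : 0 < K) (hT : D.HasTail P K) :
    (min D.p₁ D.p₂ : ℝ) ≤ 192 * K ^ 2 * (8 * K ^ 2) ^ 6 := by
  have h := hD.dim_le hK hT (d := min D.p₁ D.p₂)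
    (le_trans (by exact_mod_cast min_le_left _ _) D.p₁_le)
    (le_trans (by exact_mod_cast min_le_right _ _) D.p₂_le)
  exact_mod_cast h

end IsFLM
end Model
end FLMTest

/-! ### Perturbation of the bases and sampling fluctuations -/

namespace FLMTest

/-- The sample mean minimizes the mean squared deviation. -/
theorem sampleVariance_le {n : ℕ} (hn : 1 ≤ n) (a : ℕ → ℝ) (c : ℝ) :
    (n : ℝ)⁻¹ * ∑ i ∈ Finset.range n, (a i - (n : ℝ)⁻¹ * ∑ k ∈ Finset.range n, a k) ^ 2 ≤
      (n : ℝ)⁻¹ * ∑ i ∈ Finset.range n, (a i - c) ^ 2 := by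
  have hn0 : (0 : ℝ) < n := by exact_mod_cast hn
  set m := (n : ℝ)⁻¹ * ∑ k ∈ Finset.range n, a k with hm
  have h1 : ∑ i ∈ Finset.range n, (a i - m) = 0 := by
    rw [Finset.sum_sub_distrib, Finset.sum_const, Finset.card_range, nsmul_eq_mul, hm]
    field_simp
    ring
  have h2 : ∑ i ∈ Finset.range n, (a i - c) ^ 2 =
      ∑ i ∈ Finset.range n, (a i - m) ^ 2 + n * (m - c) ^ 2 := by
    have h3 : ∀ i, (a i - c) ^ 2 = (a i - m) ^ 2 + (2 * (m - c) * (a i - m) + (m - c) ^ 2) :=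
      fun i => by ring
    simp_rw [h3, Finset.sum_add_distrib, ← Finset.mul_sum, h1]
    simp
  rw [h2]
  gcongr
  have : 0 ≤ n * (m - c) ^ 2 := by positivity
  linarith

theorem real_inner_sq_le {E : Type*} [NormedAddCommGroup E] [InnerProductSpace ℝ E] (a b : E) :
    (⟪a, b⟫ : ℝ) ^ 2 ≤ ‖a‖ ^ 2 * ‖b‖ ^ 2 := by
  rw [← mul_pow, ← sq_abs]
  gcongr
  exact abs_real_inner_le_norm a b

theorem sq_inner_mul_inner_sub_le {E F : Type*} [NormedAddCommGroup E] [InnerProductSpace ℝ E]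
    [NormedAddCommGroup F] [InnerProductSpace ℝ F] (x : E) (y : F) {u u' : E} {v v' : F} {r : ℝ}
    (hu : ‖u - u'‖ ^ 2 ≤ r) (hv : ‖v - v'‖ ^ 2 ≤ r) (hv1 : ‖v‖ = 1) (hu1 : ‖u'‖ = 1) :
    (⟪x, u⟫ * ⟪y, v⟫ - ⟪x, u'⟫ * ⟪y, v'⟫) ^ 2 ≤ 4 * r * (‖x‖ ^ 2 * ‖y‖ ^ 2) := by
  have h0 : ⟪x, u⟫ * ⟪y, v⟫ - ⟪x, u'⟫ * ⟪y, v'⟫ = ⟪x, u - u'⟫ * ⟪y, v⟫ + ⟪x, u'⟫ * ⟪y, v - v'⟫ := by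
    rw [inner_sub_right, inner_sub_right]; ring
  have h1 : (⟪x, u - u'⟫ * ⟪y, v⟫) ^ 2 ≤ r * (‖x‖ ^ 2 * ‖y‖ ^ 2) := by
    rw [mul_pow]
    calc _ ≤ (‖x‖ ^ 2 * ‖u - u'‖ ^ 2) * (‖y‖ ^ 2 * ‖v‖ ^ 2) :=
          mul_le_mul (real_inner_sq_le _ _) (real_inner_sq_le _ _) (sq_nonneg _) (by positivity)
      _ = ‖u - u'‖ ^ 2 * (‖x‖ ^ 2 * ‖y‖ ^ 2) := by rw [hv1]; ring
      _ ≤ _ := by gcongr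
  have h2 : (⟪x, u'⟫ * ⟪y, v - v'⟫) ^ 2 ≤ r * (‖x‖ ^ 2 * ‖y‖ ^ 2) := by
    rw [mul_pow]
    calc _ ≤ (‖x‖ ^ 2 * ‖u'‖ ^ 2) * (‖y‖ ^ 2 * ‖v - v'‖ ^ 2) :=
          mul_le_mul (real_inner_sq_le _ _) (real_inner_sq_le _ _) (sq_nonneg _) (by positivity)
      _ = ‖v - v'‖ ^ 2 * (‖x‖ ^ 2 * ‖y‖ ^ 2) := by rw [hu1]; ring
      _ ≤ _ := by gcongr
  rw [h0]
  have := add_sq_le (a := ⟪x, u - u'⟫ * ⟪y, v⟫) (b := ⟪x, u'⟫ * ⟪y, v - v'⟫)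
  linarith

namespace Model

section ClassF

variable {𝒳 𝒴 Ω : Type*} [NormedAddCommGroup 𝒳] [InnerProductSpace ℝ 𝒳]
  [NormedAddCommGroup 𝒴] [InnerProductSpace ℝ 𝒴] {D : Model 𝒳 𝒴 Ω}

theorem norm_eigenBases_fst (D : Model 𝒳 𝒴 Ω) (k : Fin D.p₁) : ‖D.eigenBases.1 k‖ = 1 :=
  D.φ.orthonormal.1 _

theorem norm_eigenBases_snd (D : Model 𝒳 𝒴 Ω) (k : Fin D.p₂) : ‖D.eigenBases.2 k‖ = 1 :=
  D.ψ.orthonormal.1 _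

/-- A pair in the class is close to the pair of eigenelements, up to a common sign of `φ̃_{j₁}` and
`ψ̃_{j₂}`, which does not affect `V_i`. -/
theorem exists_sign_norm_sub_le {r : ℝ} (hr : r < 1) {f : D.Bases} (hf : f ∈ D.classF r)
    (j : D.Pos) : ∃ s : ℝ, s * s = 1 ∧ ‖s • f.1 j.1 - D.eigenBases.1 j.1‖ ^ 2 ≤ 2 * r ∧
      ‖s • f.2 j.2 - D.eigenBases.2 j.2‖ ^ 2 ≤ 2 * r := by
  obtain ⟨h1, h2, h3⟩ := hf
  have hx1 : ‖f.1 j.1‖ = 1 := h1.1 _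
  have hy1 : ‖f.2 j.2‖ = 1 := h2.1 _
  have hφ := D.norm_eigenBases_fst j.1
  have hψ := D.norm_eigenBases_snd j.2
  set x : ℝ := ⟪D.eigenBases.1 j.1, f.1 j.1⟫ with hx
  set y : ℝ := ⟪D.eigenBases.2 j.2, f.2 j.2⟫ with hy
  have hW : 1 - r ≤ x * y := by
    have h := h3 j j
    have hWj : D.W f j j = x * y := rfl
    rw [Matrix.sub_apply, Matrix.one_apply_eq, hWj] at h
    linarith [(abs_le.1 h).1]
  have hxa : |x| ≤ 1 := by
    have h := abs_real_inner_le_norm (D.eigenBases.1 j.1) (f.1 j.1)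
    rwa [hx1, hφ, one_mul] at h
  have hya : |y| ≤ 1 := by
    have h := abs_real_inner_le_norm (D.eigenBases.2 j.2) (f.2 j.2)
    rwa [hy1, hψ, one_mul] at h
  have key : ∀ s : ℝ, s * s = 1 → 1 - r ≤ s * x → 1 - r ≤ s * y →
      ‖s • f.1 j.1 - D.eigenBases.1 j.1‖ ^ 2 ≤ 2 * r ∧
        ‖s • f.2 j.2 - D.eigenBases.2 j.2‖ ^ 2 ≤ 2 * r := by
    intro s hs hsx hsy
    have hs1 : s ^ 2 = 1 := by rw [sq, hs]
    constructor
    · rw [norm_sub_sq_real, norm_smul, hx1, hφ, inner_smul_left, real_inner_comm, ← hx, mul_pow,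
        Real.norm_eq_abs, sq_abs, hs1]
      simp only [conj_trivial]
      linarith
    · rw [norm_sub_sq_real, norm_smul, hy1, hψ, inner_smul_left, real_inner_comm, ← hy, mul_pow,
        Real.norm_eq_abs, sq_abs, hs1]
      simp only [conj_trivial]
      linarith
  have habs : x * y ≤ |x| ∧ x * y ≤ |y| := by
    constructor
    · calc x * y ≤ |x * y| := le_abs_self _
        _ = |x| * |y| := abs_mul _ _
        _ ≤ |x| := mul_le_of_le_one_right (abs_nonneg _) hya
    · calc x * y ≤ |x * y| := le_abs_self _
        _ = |x| * |y| := abs_mul _ _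
        _ ≤ |y| := mul_le_of_le_one_left (abs_nonneg _) hxa
  have hpos : 0 < x * y := by linarith
  rcases pos_and_pos_or_neg_and_neg_of_mul_pos hpos with ⟨h4, h5⟩ | ⟨h4, h5⟩
  · rw [abs_of_pos h4, abs_of_pos h5] at habs
    exact ⟨1, by norm_num, key 1 (by norm_num) (by linarith [habs.1]) (by linarith [habs.2])⟩
  · rw [abs_of_neg h4, abs_of_neg h5] at habs
    exact ⟨-1, by norm_num, key (-1) (by norm_num) (by linarith [habs.1]) (by linarith [habs.2])⟩

theorem sq_V_sub_le {r : ℝ} (hr : r < 1) {f : D.Bases} (hf : f ∈ D.classF r) (j : D.Pos)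
    (i : ℕ) (ω : Ω) : (D.V f i ω j - D.V D.eigenBases i ω j) ^ 2 ≤
      8 * r * (‖D.X i ω‖ ^ 2 * ‖D.Y i ω‖ ^ 2) := by
  obtain ⟨s, hs, h1, h2⟩ := exists_sign_norm_sub_le hr hf j
  have hV : D.V f i ω j = ⟪D.X i ω, s • f.1 j.1⟫ * ⟪D.Y i ω, s • f.2 j.2⟫ := by
    rw [V, inner_smul_right, inner_smul_right]
    linear_combination (-(⟪D.X i ω, f.1 j.1⟫ * ⟪D.Y i ω, f.2 j.2⟫ : ℝ)) * hs
  have hn : ‖s • f.2 j.2‖ = 1 := by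
    have hs1 : |s| = 1 := by
      rw [← Real.sqrt_sq_eq_abs, sq, hs, Real.sqrt_one]
    rw [norm_smul, hf.2.1.1 j.2, Real.norm_eq_abs, hs1, one_mul]
  have h := sq_inner_mul_inner_sub_le (D.X i ω) (D.Y i ω) h1 h2 hn (D.norm_eigenBases_fst j.1)
  rw [hV, V]
  linarith

/-- The sample variances for a pair in the class are controlled by those for the eigenelements. -/
theorem sigmaHat_le_eigenBases {n : ℕ} (hn : 1 ≤ n) {r : ℝ} (hr : r < 1) {f : D.Bases}
    (hf : f ∈ D.classF r) (ω : Ω) (j : D.Pos) :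
    D.sigmaHat n f ω j j ≤ 2 * D.sigmaHat n D.eigenBases ω j j +
      16 * r * ((n : ℝ)⁻¹ * ∑ i ∈ Finset.range n, ‖D.X i ω‖ ^ 2 * ‖D.Y i ω‖ ^ 2) := by
  have h1 := sampleVariance_le hn (fun i => D.V f i ω j) (D.Vbar n D.eigenBases ω j)
  simp only [sigmaHat, Matrix.of_apply, ← sq]
  refine h1.trans ?_
  calc _ ≤ (n : ℝ)⁻¹ * ∑ i ∈ Finset.range n,
        (2 * (D.V D.eigenBases i ω j - D.Vbar n D.eigenBases ω j) ^ 2 +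
          16 * r * (‖D.X i ω‖ ^ 2 * ‖D.Y i ω‖ ^ 2)) := by
        gcongr with i _
        have h2 := sq_V_sub_le hr hf j i ω
        have h3 := add_sq_le (a := D.V D.eigenBases i ω j - D.Vbar n D.eigenBases ω j)
          (b := D.V f i ω j - D.V D.eigenBases i ω j)
        rw [show D.V D.eigenBases i ω j - D.Vbar n D.eigenBases ω j +
          (D.V f i ω j - D.V D.eigenBases i ω j) = D.V f i ω j - D.Vbar n D.eigenBases ω j by ring]
          at h3
        linarith
    _ = _ := by
        rw [Finset.sum_add_distrib, ← Finset.mul_sum, ← Finset.mul_sum]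
        ring

end ClassF

section Sampling

variable {𝒳 𝒴 Ω : Type*} [NormedAddCommGroup 𝒳] [InnerProductSpace ℝ 𝒳] [CompleteSpace 𝒳]
  [SecondCountableTopology 𝒳] [MeasurableSpace 𝒳] [BorelSpace 𝒳]
  [NormedAddCommGroup 𝒴] [InnerProductSpace ℝ 𝒴] [CompleteSpace 𝒴]
  [SecondCountableTopology 𝒴] [MeasurableSpace 𝒴] [BorelSpace 𝒴]
  [MeasurableSpace Ω] {P : Measure Ω} [IsProbabilityMeasure P] {D : Model 𝒳 𝒴 Ω}

namespace IsFLM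

theorem iIndepFun_comp (hD : D.IsFLM P) {h : 𝒳 × 𝒴 → ℝ} (hh : Measurable h) :
    iIndepFun (fun i ω => h (D.X i ω, D.Y i ω)) P :=
  hD.indep.comp (fun _ => h) (fun _ => hh)

theorem identDistrib_comp (hD : D.IsFLM P) {h : 𝒳 × 𝒴 → ℝ} (hh : Measurable h) (i : ℕ) :
    IdentDistrib (fun ω => h (D.X i ω, D.Y i ω)) (fun ω => h (D.X 0 ω, D.Y 0 ω)) P P :=
  (hD.ident i).comp hh

theorem measurable_prod_score (u : 𝒳) (v : 𝒴) :
    Measurable fun x : 𝒳 × 𝒴 => (⟪x.1, u⟫ * ⟪x.2, v⟫ : ℝ) :=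
  (measurable_fst.inner measurable_const).mul (measurable_snd.inner measurable_const)

/-- The error does not contribute to the means. -/
theorem integral_score_eq (hD : D.IsFLM P) (u : 𝒳) (v : 𝒴) :
    ∫ ω, D.score u v 0 ω ∂P = ⟪D.β (covOp (D.X 0) P u), v⟫ := by
  have hm0 : Measurable fun x : 𝒳 => ⟪x, u⟫ := (continuous_id.inner continuous_const).measurable
  have hm2 : Measurable fun z : 𝒴 => ⟪z, v⟫ := (continuous_id.inner continuous_const).measurable
  have h1 : ∀ ω, D.score u v 0 ω = ⟪D.X 0 ω, u⟫ * ⟪D.X 0 ω, D.β.adjoint v⟫ +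
      ⟪D.X 0 ω, u⟫ * ⟪D.Z 0 ω, v⟫ := fun ω => by
    rw [score, inner_Y, ContinuousLinearMap.adjoint_inner_right]; ring
  have h2 := hD.integral_mul_of_indep hm0 hm2
  rw [hD.integral_inner_Z, mul_zero] at h2
  simp_rw [h1]
  rw [integral_add (integrable_inner_mul_inner hD.memLp_X hD.memLp_X _ _)
    (integrable_inner_mul_inner hD.memLp_X hD.moment_Z _ _), h2, add_zero,
    ← covOp_inner hD.memLp_X, ContinuousLinearMap.adjoint_inner_right]

theorem sd_sq (D : Model 𝒳 𝒴 Ω) (P : Measure Ω) (f : D.Bases) (j : D.Pos) :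
    D.sd P f j ^ 2 = variance (D.score (f.1 j.1) (f.2 j.2) 0) P :=
  Real.sq_sqrt (variance_nonneg _ _)

theorem sd_eigenBases_sq_le (hD : D.IsFLM P) {K : ℝ} (hK : 0 < K) (hT : D.HasTail P K)
    (j : D.Pos) : D.sd P D.eigenBases j ^ 2 ≤
      64 * K ^ 4 * (D.lam (Idx.ofFin D.p₁_le j.1) * D.rho (Idx.ofFin D.p₂_le j.2)) := by
  rw [sd_sq, ← hD.secX_φ, ← hD.secY_ψ]
  exact (hD.variance_score_le _ _).trans (hD.integral_score_sq_le hK hT _ _)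

/-- The population variances for the eigenelements are controlled by those for a pair in the
class. -/
theorem sd_eigenBases_sq_le_sd_sq (hD : D.IsFLM P) {K : ℝ} (hK : 0 < K) (hT : D.HasTail P K)
    {CN : ℝ} (hN : MemLp (fun ω => ‖D.X 0 ω‖ ^ 2 * ‖D.Y 0 ω‖ ^ 2) 2 P)
    (hCN : ∫ ω, ‖D.X 0 ω‖ ^ 2 * ‖D.Y 0 ω‖ ^ 2 ∂P ≤ CN) {r : ℝ} (hr0 : 0 ≤ r) (hr : r < 1)
    {f : D.Bases} (hf : f ∈ D.classF r) (j : D.Pos) :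
    D.sd P D.eigenBases j ^ 2 ≤ 2 * D.sd P f j ^ 2 + 16 * r * CN := by
  rw [sd_sq, sd_sq]
  set A := D.score (D.eigenBases.1 j.1) (D.eigenBases.2 j.2) 0
  set B := D.score (f.1 j.1) (f.2 j.2) 0
  have hA : MemLp A 2 P := (hD.memLp_score hK hT _ _).mono_exponent (by norm_num)
  have hB : MemLp B 2 P := (hD.memLp_score hK hT _ _).mono_exponent (by norm_num)
  set c := ∫ ω, B ω ∂P with hc
  have h1 : variance A P ≤ ∫ ω, (A ω - c) ^ 2 ∂P := by
    rw [← variance_sub_const hA.1 c]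
    exact variance_le_expectation_sq (hA.sub (memLp_const c)).1
  have h2 : variance B P = ∫ ω, (B ω - c) ^ 2 ∂P := variance_eq_integral hB.1.aemeasurable
  have iB : Integrable (fun ω => 2 * (B ω - c) ^ 2) P :=
    (hB.sub (memLp_const c)).integrable_sq.const_mul 2
  have iN : Integrable (fun ω => 16 * r * (‖D.X 0 ω‖ ^ 2 * ‖D.Y 0 ω‖ ^ 2)) P :=
    (hN.integrable (by norm_num)).const_mul _
  have h3 : ∫ ω, (A ω - c) ^ 2 ∂P ≤
      ∫ ω, (2 * (B ω - c) ^ 2 + 16 * r * (‖D.X 0 ω‖ ^ 2 * ‖D.Y 0 ω‖ ^ 2)) ∂P := by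
    refine integral_mono (hA.sub (memLp_const c)).integrable_sq (iB.add iN) fun ω => ?_
    have h4 : (B ω - A ω) ^ 2 ≤ _ := sq_V_sub_le hr hf j 0 ω
    have h5 := add_sq_le (a := B ω - c) (b := A ω - B ω)
    rw [show B ω - c + (A ω - B ω) = A ω - c by ring] at h5
    have h6 : (A ω - B ω) ^ 2 = (B ω - A ω) ^ 2 := by ring
    simp only
    linarith
  rw [integral_add iB iN, integral_const_mul, integral_const_mul, ← h2] at h3
  have : 16 * r * ∫ ω, ‖D.X 0 ω‖ ^ 2 * ‖D.Y 0 ω‖ ^ 2 ∂P ≤ 16 * r * CN := by gcongr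
  linarith

/-- The event on which the average of `‖X_i‖² ‖Y_i‖²` is large. -/
theorem measure_norm_mean_le (hD : D.IsFLM P) {CN : ℝ}
    (hN : MemLp (fun ω => ‖D.X 0 ω‖ ^ 2 * ‖D.Y 0 ω‖ ^ 2) 2 P)
    (hCN : ∫ ω, ‖D.X 0 ω‖ ^ 2 * ‖D.Y 0 ω‖ ^ 2 ∂P ≤ CN)
    (hCN2 : ∫ ω, (‖D.X 0 ω‖ ^ 2 * ‖D.Y 0 ω‖ ^ 2) ^ 2 ∂P ≤ CN ^ 2) {n : ℕ} (hn : 1 ≤ n) :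
    P {ω | CN + 1 < (n : ℝ)⁻¹ * ∑ i ∈ Finset.range n, ‖D.X i ω‖ ^ 2 * ‖D.Y i ω‖ ^ 2} ≤
      ENNReal.ofReal (CN ^ 2 * (n : ℝ)⁻¹) := by
  have hh : Measurable fun x : 𝒳 × 𝒴 => ‖x.1‖ ^ 2 * ‖x.2‖ ^ 2 :=
    (measurable_fst.norm.pow_const 2).mul (measurable_snd.norm.pow_const 2)
  have h := measure_lt_sampleMean_sub_le (U := fun i ω => ‖D.X i ω‖ ^ 2 * ‖D.Y i ω‖ ^ 2) hN
    (hD.iIndepFun_comp hh) (hD.identDistrib_comp hh) hn one_pos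
  refine (measure_mono fun ω hω => ?_).trans (h.trans (ENNReal.ofReal_le_ofReal ?_))
  · have hω' : CN + 1 < (n : ℝ)⁻¹ * ∑ i ∈ Finset.range n, ‖D.X i ω‖ ^ 2 * ‖D.Y i ω‖ ^ 2 := hω
    have : (1 : ℝ) < (n : ℝ)⁻¹ * ∑ i ∈ Finset.range n, ‖D.X i ω‖ ^ 2 * ‖D.Y i ω‖ ^ 2 -
      ∫ ω, ‖D.X 0 ω‖ ^ 2 * ‖D.Y 0 ω‖ ^ 2 ∂P := by linarith
    exact this.trans_le (le_abs_self _)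
  · rw [one_pow, div_one]
    gcongr

theorem integral_centered_pow_four_le (hD : D.IsFLM P) {K : ℝ} (hK : 0 < K) (hT : D.HasTail P K)
    (u : 𝒳) (v : 𝒴) :
    MemLp (fun ω => (D.score u v 0 ω - ∫ ω, D.score u v 0 ω ∂P) ^ 2) 2 P ∧
      ∫ ω, ((D.score u v 0 ω - ∫ ω, D.score u v 0 ω ∂P) ^ 2) ^ 2 ∂P ≤
        16 * (128 * K ^ 6 * (D.secX P u * D.secY P v)) ^ 2 := by
  set A := D.score u v 0
  set c := ∫ ω, A ω ∂P with hc
  have hA : MemLp A 4 P := hD.memLp_score hK hT u v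
  have hA2 : MemLp A 2 P := hA.mono_exponent (by norm_num)
  have hAsq := memLp_two_sq_of_memLp_four hA
  have hL : MemLp (fun ω => (A ω - c) ^ 2) 2 P :=
    memLp_two_sq_of_memLp_four (hA.sub (memLp_const c))
  refine ⟨hL, ?_⟩
  have hc4 : c ^ 4 ≤ ∫ ω, A ω ^ 4 ∂P := by
    have h1 := sq_integral_mul_le hA2 (memLp_const (1 : ℝ))
    have h2 := sq_integral_mul_le hAsq (memLp_const (1 : ℝ))
    simp only [mul_one, one_pow, integral_const, probReal_univ, smul_eq_mul, ← pow_mul] at h1 h2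
    calc c ^ 4 = (c ^ 2) ^ 2 := by ring
      _ ≤ (∫ ω, A ω ^ 2 ∂P) ^ 2 := by gcongr
      _ ≤ _ := h2
  have i4 : Integrable (fun ω => A ω ^ 4) P := by
    simpa [(by decide : Even 4).pow_abs] using hA.integrable_norm_pow (by norm_num : 4 ≠ 0)
  have i5 : Integrable (fun ω => 8 * A ω ^ 4) P := i4.const_mul 8
  have h3 : ∫ ω, ((A ω - c) ^ 2) ^ 2 ∂P ≤ ∫ ω, (8 * A ω ^ 4 + 8 * c ^ 4) ∂P := by
    refine integral_mono hL.integrable_sq (i5.add (integrable_const _)) fun ω => ?_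
    have h6 : (A ω - c) ^ 2 ≤ 2 * (A ω ^ 2 + c ^ 2) := by nlinarith [sq_nonneg (A ω + c)]
    have h7 : ((A ω - c) ^ 2) ^ 2 ≤ (2 * (A ω ^ 2 + c ^ 2)) ^ 2 := by gcongr
    simp only
    nlinarith [sq_nonneg (A ω ^ 2 - c ^ 2)]
  rw [integral_add i5 (integrable_const _), integral_const_mul, integral_const, probReal_univ,
    one_smul] at h3
  have h4 := hD.integral_score_pow_four_le hK hT u v
  linarith

theorem sum_lam_le {LX : ℝ} (hLX : 0 ≤ LX)
    (hX : ∑' j, ENNReal.ofReal (D.lam j) ≤ ENNReal.ofReal LX) (hD : D.IsFLM P) :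
    ∑ k, D.lam (Idx.ofFin D.p₁_le k) ≤ LX := by
  have hinj : Function.Injective (Idx.ofFin D.p₁_le) := fun a b hab =>
    Fin.ext (congrArg Subtype.val hab)
  have h1 := (ENNReal.sum_le_tsum (f := fun j => ENNReal.ofReal (D.lam j))
    (Finset.univ.map ⟨_, hinj⟩)).trans hX
  rw [Finset.sum_map] at h1
  simp only [Function.Embedding.coeFn_mk] at h1
  rw [← ENNReal.ofReal_sum_of_nonneg fun i _ => (hD.lam_pos _).le] at h1
  exact (ENNReal.ofReal_le_ofReal_iff hLX).1 h1

theorem sum_rho_le {LY : ℝ} (hLY : 0 ≤ LY)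
    (hY : ∑' j, ENNReal.ofReal (D.rho j) ≤ ENNReal.ofReal LY) (hD : D.IsFLM P) :
    ∑ k, D.rho (Idx.ofFin D.p₂_le k) ≤ LY := by
  have hinj : Function.Injective (Idx.ofFin D.p₂_le) := fun a b hab =>
    Fin.ext (congrArg Subtype.val hab)
  have h1 := (ENNReal.sum_le_tsum (f := fun j => ENNReal.ofReal (D.rho j))
    (Finset.univ.map ⟨_, hinj⟩)).trans hY
  rw [Finset.sum_map] at h1
  simp only [Function.Embedding.coeFn_mk] at h1
  rw [← ENNReal.ofReal_sum_of_nonneg fun i _ => (hD.rho_pos _).le] at h1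
  exact (ENNReal.ofReal_le_ofReal_iff hLY).1 h1

/-- All sample variances for the eigenelements are close to, or smaller than, their population
counterparts; no logarithmic factor is lost since the fourth moments are summable. -/
theorem measure_exists_sigmaHat_gt_le (hD : D.IsFLM P) {K : ℝ} (hK : 0 < K) (hT : D.HasTail P K)
    {LX LY : ℝ} (hLX : 0 ≤ LX) (hLY : 0 ≤ LY)
    (hX : ∑' j, ENNReal.ofReal (D.lam j) ≤ ENNReal.ofReal LX)
    (hY : ∑' j, ENNReal.ofReal (D.rho j) ≤ ENNReal.ofReal LY) {n : ℕ} (hn : 1 ≤ n)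
    {ε : ℝ} (hε : 0 < ε) :
    P {ω | ∃ j, D.sd P D.eigenBases j ^ 2 + ε < D.sigmaHat n D.eigenBases ω j j} ≤
      ENNReal.ofReal (16 * (128 * K ^ 6 * (LX * LY)) ^ 2 / ε ^ 2 * (n : ℝ)⁻¹) := by
  have hset : {ω | ∃ j, D.sd P D.eigenBases j ^ 2 + ε < D.sigmaHat n D.eigenBases ω j j} =
      ⋃ j, {ω | D.sd P D.eigenBases j ^ 2 + ε < D.sigmaHat n D.eigenBases ω j j} := by ext; simp
  rw [hset]
  set q : D.Pos → ℝ := fun j => D.lam (Idx.ofFin D.p₁_le j.1) * D.rho (Idx.ofFin D.p₂_le j.2)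
    with hq
  have hq0 : ∀ j, 0 ≤ q j := fun j => (mul_pos (hD.lam_pos _) (hD.rho_pos _)).le
  have hj : ∀ j, P {ω | D.sd P D.eigenBases j ^ 2 + ε < D.sigmaHat n D.eigenBases ω j j} ≤
      ENNReal.ofReal (16 * (128 * K ^ 6 * q j) ^ 2 / ε ^ 2 * (n : ℝ)⁻¹) := fun j => by
    set u := D.eigenBases.1 j.1 with hu
    set v := D.eigenBases.2 j.2 with hv
    set c := ∫ ω, D.score u v 0 ω ∂P with hc
    have hh : Measurable fun x : 𝒳 × 𝒴 => (⟪x.1, u⟫ * ⟪x.2, v⟫ - c) ^ 2 :=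
      ((measurable_prod_score u v).sub_const c).pow_const 2
    obtain ⟨hL, h4⟩ := hD.integral_centered_pow_four_le hK hT u v
    have h := measure_lt_sampleMean_sub_le (U := fun i ω => (D.score u v i ω - c) ^ 2) hL
      (hD.iIndepFun_comp hh) (hD.identDistrib_comp hh) hn hε
    refine (measure_mono fun ω hω => ?_).trans (h.trans (ENNReal.ofReal_le_ofReal ?_))
    · have hω' : D.sd P D.eigenBases j ^ 2 + ε < D.sigmaHat n D.eigenBases ω j j := hω
      have h1 := sampleVariance_le hn (fun i => D.V D.eigenBases i ω j) c
      have h2 : D.sigmaHat n D.eigenBases ω j j ≤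
          (n : ℝ)⁻¹ * ∑ i ∈ Finset.range n, (D.score u v i ω - c) ^ 2 := by
        refine le_trans (le_of_eq ?_) h1
        simp only [sigmaHat, Matrix.of_apply, ← sq, Vbar]
      have h3 : D.sd P D.eigenBases j ^ 2 = ∫ ω, (D.score u v 0 ω - c) ^ 2 ∂P := by
        rw [sd_sq]
        exact variance_eq_integral (hD.measurable_score _ _ _).aemeasurable
      have h5 : ε < (n : ℝ)⁻¹ * ∑ i ∈ Finset.range n, (D.score u v i ω - c) ^ 2 -
        ∫ ω, (D.score u v 0 ω - c) ^ 2 ∂P := by linarith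
      exact h5.trans_le (le_abs_self _)
    · gcongr
      refine h4.trans (le_of_eq ?_)
      rw [hu, hv, hq]
      simp only [eigenBases]
      rw [hD.secX_φ, hD.secY_ψ]
  refine (measure_iUnion_fintype_le _ _).trans ((Finset.sum_le_sum fun j _ => hj j).trans ?_)
  rw [← ENNReal.ofReal_sum_of_nonneg fun j _ => by positivity]
  refine ENNReal.ofReal_le_ofReal ?_
  have h1 : ∑ j, q j ≤ LX * LY := by
    rw [hq, Fintype.sum_prod_type]
    simp only
    rw [← Fintype.sum_mul_sum]
    exact mul_le_mul (sum_lam_le hLX hX hD) (sum_rho_le hLY hY hD)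
      (Finset.sum_nonneg fun _ _ => (hD.rho_pos _).le) hLX
  have h2 : ∑ j, q j ^ 2 ≤ (LX * LY) ^ 2 :=
    (Finset.sum_sq_le_sq_sum_of_nonneg fun j _ => hq0 j).trans
      (by have := Finset.sum_nonneg fun j (_ : j ∈ Finset.univ) => hq0 j; gcongr)
  calc _ = 16 * (128 * K ^ 6) ^ 2 / ε ^ 2 * (n : ℝ)⁻¹ * ∑ j, q j ^ 2 := by
        rw [Finset.mul_sum]
        exact Finset.sum_congr rfl fun j _ => by ring
    _ ≤ 16 * (128 * K ^ 6) ^ 2 / ε ^ 2 * (n : ℝ)⁻¹ * (LX * LY) ^ 2 := by gcongr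
    _ = _ := by ring

/-- The sample means of the products of scores are close to their expectations, uniformly over
all unit vectors: the error is a bilinear form with Hilbert--Schmidt norm of order `n ^ (-1/2)`. -/
theorem measure_exists_mean_score_gt_le (hD : D.IsFLM P) {K : ℝ} (hK : 0 < K) (hT : D.HasTail P K)
    {CN : ℝ} (hN : MemLp (fun ω => ‖D.X 0 ω‖ ^ 2 * ‖D.Y 0 ω‖ ^ 2) 2 P)
    (hCN : ∫ ω, ‖D.X 0 ω‖ ^ 2 * ‖D.Y 0 ω‖ ^ 2 ∂P ≤ CN) {n : ℕ} (hn : 1 ≤ n)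
    {ε : ℝ} (hε : 0 < ε) :
    P {ω | ∃ u v, ‖u‖ = 1 ∧ ‖v‖ = 1 ∧ ε <
      |(n : ℝ)⁻¹ * ∑ i ∈ Finset.range n, D.score u v i ω - ∫ ω, D.score u v 0 ω ∂P|} ≤
      ENNReal.ofReal (CN / ε ^ 2 * (n : ℝ)⁻¹) := by
  set T : Ω → 𝒳 →L[ℝ] 𝒴 := fun ω => (n : ℝ)⁻¹ • ∑ i ∈ Finset.range n,
    InnerProductSpace.rankOne ℝ (D.Y i ω) (D.X i ω) - D.β.comp (covOp (D.X 0) P) with hTdef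
  have hTin : ∀ ω u v, ⟪T ω u, v⟫ = (n : ℝ)⁻¹ * ∑ i ∈ Finset.range n, D.score u v i ω -
      ∫ ω, D.score u v 0 ω ∂P := fun ω u v => by
    rw [hD.integral_score_eq]
    simp only [hTdef, sub_apply, smul_apply,
      sum_apply, InnerProductSpace.rankOne_apply, inner_sub_left,
      inner_smul_left, sum_inner, ContinuousLinearMap.comp_apply, conj_trivial, score]
  set Q : Ω → ℝ≥0∞ := fun ω => ∑' l, ∑' k, ENNReal.ofReal (⟪T ω (D.φ k), D.ψ l⟫ ^ 2) with hQ
  have hmeas : ∀ k l, Measurable fun ω => ENNReal.ofReal (⟪T ω (D.φ k), D.ψ l⟫ ^ 2) := fun k l => by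
    simp_rw [hTin]
    have : ∀ i, Measurable (D.score (D.φ k) (D.ψ l) i) := fun i => hD.measurable_score _ _ i
    fun_prop
  have hQm : Measurable Q := Measurable.tsum fun l => Measurable.tsum fun k => hmeas k l
  have hQE : ∫⁻ ω, Q ω ∂P ≤ ENNReal.ofReal (CN * (n : ℝ)⁻¹) := by
    have h1 : ∀ k l, ∫⁻ ω, ENNReal.ofReal (⟪T ω (D.φ k), D.ψ l⟫ ^ 2) ∂P ≤
        (∫⁻ ω, ENNReal.ofReal (D.score (D.φ k) (D.ψ l) 0 ω ^ 2) ∂P) *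
          ENNReal.ofReal ((n : ℝ)⁻¹) := fun k l => by
      have hL : MemLp (D.score (D.φ k) (D.ψ l) 0) 2 P :=
        (hD.memLp_score hK hT _ _).mono_exponent (by norm_num)
      have h := lintegral_sampleMean_sub_sq_le hL
        (hD.iIndepFun_comp (measurable_prod_score (D.φ k) (D.ψ l)))
        (hD.identDistrib_comp (measurable_prod_score (D.φ k) (D.ψ l))) hn
      simp_rw [hTin]
      refine h.trans (le_of_eq ?_)
      rw [← ofReal_integral_eq_lintegral_ofReal hL.integrable_sq
        (ae_of_all _ fun ω => sq_nonneg _), ← ENNReal.ofReal_mul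
        (integral_nonneg fun _ => sq_nonneg _), div_eq_mul_inv]
    have h2 : ∀ ω, ∑' l, ∑' k, ENNReal.ofReal (D.score (D.φ k) (D.ψ l) 0 ω ^ 2) =
        ENNReal.ofReal (‖D.X 0 ω‖ ^ 2 * ‖D.Y 0 ω‖ ^ 2) := fun ω => by
      rw [ENNReal.ofReal_mul (by positivity), ← tsum_ofReal_inner_sq D.φ,
        ← tsum_ofReal_inner_sq D.ψ, ← ENNReal.tsum_mul_left]
      refine tsum_congr fun l => ?_
      rw [← ENNReal.tsum_mul_right]
      refine tsum_congr fun k => ?_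
      rw [← ENNReal.ofReal_mul (by positivity), score, mul_pow]
    have hm2 : ∀ k l, Measurable fun ω => ENNReal.ofReal (D.score (D.φ k) (D.ψ l) 0 ω ^ 2) :=
      fun k l => ((hD.measurable_score _ _ 0).pow_const 2).ennreal_ofReal
    calc ∫⁻ ω, Q ω ∂P = ∑' l, ∑' k, ∫⁻ ω, ENNReal.ofReal (⟪T ω (D.φ k), D.ψ l⟫ ^ 2) ∂P := by
          rw [lintegral_tsum fun l => (Measurable.tsum fun k => hmeas k l).aemeasurable]
          exact tsum_congr fun l => lintegral_tsum fun k => (hmeas k l).aemeasurable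
      _ ≤ ∑' l, ∑' k, (∫⁻ ω, ENNReal.ofReal (D.score (D.φ k) (D.ψ l) 0 ω ^ 2) ∂P) *
          ENNReal.ofReal ((n : ℝ)⁻¹) :=
          ENNReal.tsum_le_tsum fun l => ENNReal.tsum_le_tsum fun k => h1 k l
      _ = (∫⁻ ω, ENNReal.ofReal (‖D.X 0 ω‖ ^ 2 * ‖D.Y 0 ω‖ ^ 2) ∂P) *
          ENNReal.ofReal ((n : ℝ)⁻¹) := by
          simp_rw [ENNReal.tsum_mul_right, ← h2]
          rw [lintegral_tsum fun l => (Measurable.tsum fun k => hm2 k l).aemeasurable]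
          congr 1
          exact tsum_congr fun l => (lintegral_tsum fun k => (hm2 k l).aemeasurable).symm
      _ ≤ ENNReal.ofReal (CN * (n : ℝ)⁻¹) := by
          rw [← ofReal_integral_eq_lintegral_ofReal (hN.integrable (by norm_num))
            (ae_of_all _ fun ω => by positivity), ← ENNReal.ofReal_mul
            (integral_nonneg fun _ => by positivity)]
          refine ENNReal.ofReal_le_ofReal ?_
          gcongr
  have hε2 : ENNReal.ofReal (ε ^ 2) ≠ 0 := by simpa using hε.ne'
  calc _ ≤ P {ω | ENNReal.ofReal (ε ^ 2) ≤ Q ω} := by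
        refine measure_mono fun ω hω => ?_
        obtain ⟨u, v, hu, hv, h⟩ := hω
        have h1 := ofReal_inner_apply_sq_le D.φ D.ψ (T ω) u v
        rw [hu, hv, one_pow, one_mul, ENNReal.ofReal_one, one_mul, hTin] at h1
        refine le_trans (ENNReal.ofReal_le_ofReal ?_) h1
        rw [← sq_abs (_ - _)]
        exact pow_le_pow_left₀ hε.le h.le 2
    _ ≤ ENNReal.ofReal (CN * (n : ℝ)⁻¹) / ENNReal.ofReal (ε ^ 2) := by
        rw [ENNReal.le_div_iff_mul_le (Or.inl hε2) (Or.inl ENNReal.ofReal_ne_top), mul_comm]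
        exact (mul_meas_ge_le_lintegral₀ hQm.aemeasurable _).trans hQE
    _ = _ := by
        rw [← ENNReal.ofReal_div_of_pos (by positivity)]
        congr 1
        ring

end IsFLM
end Sampling
end Model
end FLMTest

/-! ### Means of the coordinates, and the largest variance -/

namespace FLMTest

section Residual

variable {E ι κ : Type*} [NormedAddCommGroup E] [InnerProductSpace ℝ E] [Fintype κ]

/-- The residual of the projection of `u` onto the span of the basis elements `e (g k)`. -/
noncomputable def basisResidual (e : HilbertBasis ι ℝ E) (g : κ → ι) (u : E) : E :=
  u - ∑ k, (⟪e (g k), u⟫ : ℝ) • e (g k)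

theorem inner_basisResidual (e : HilbertBasis ι ℝ E) {g : κ → ι} (hg : g.Injective) (u : E)
    (k : κ) : ⟪basisResidual e g u, e (g k)⟫ = (0 : ℝ) := by
  have h := (e.orthonormal.comp g hg).inner_left_fintype (fun k => (⟪e (g k), u⟫ : ℝ)) k
  simp only [Function.comp_apply, conj_trivial] at h
  rw [basisResidual, inner_sub_left, h, real_inner_comm, sub_self]

theorem norm_basisResidual_sq_le (e : HilbertBasis ι ℝ E) {g : κ → ι} (hg : g.Injective) (u : E)
    (k : κ) : ‖basisResidual e g u‖ ^ 2 ≤ ‖u‖ ^ 2 - ⟪e (g k), u⟫ ^ 2 := by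
  have h1 : ⟪basisResidual e g u, basisResidual e g u⟫ = ⟪basisResidual e g u, u⟫ := by
    conv_lhs => rw [show basisResidual e g u = u - ∑ k, (⟪e (g k), u⟫ : ℝ) • e (g k) from rfl]
    rw [inner_sub_right]
    rw [show u - ∑ k, (⟪e (g k), u⟫ : ℝ) • e (g k) = basisResidual e g u from rfl]
    simp only [inner_sum, inner_smul_right, inner_basisResidual e hg, mul_zero,
      Finset.sum_const_zero, sub_zero]
  have h2 : ⟪basisResidual e g u, u⟫ = ‖u‖ ^ 2 - ∑ k, (⟪e (g k), u⟫ : ℝ) ^ 2 := by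
    rw [basisResidual, inner_sub_left, sum_inner, real_inner_self_eq_norm_sq]
    simp only [inner_smul_left, conj_trivial, sq]
  rw [← real_inner_self_eq_norm_sq, h1, h2]
  have := Finset.single_le_sum (f := fun k => (⟪e (g k), u⟫ : ℝ) ^ 2)
    (fun _ _ => sq_nonneg _) (Finset.mem_univ k)
  linarith

/-- A quadratic form with eigenvalues `l` is at most `ε ‖q‖²` if `q` has no component in the
directions with eigenvalues above `ε`. -/
theorem hasSum_le_mul_norm_sq (e : HilbertBasis ι ℝ E) {l : ι → ℝ} {q : E} {S ε : ℝ}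
    (hS : HasSum (fun j => l j * ⟪q, e j⟫ ^ 2) S)
    (h : ∀ j, l j ≤ ε ∨ (⟪q, e j⟫ : ℝ) = 0) : S ≤ ε * ‖q‖ ^ 2 := by
  have h1 := (e.hasSum_inner_mul_inner q q).mul_left ε
  rw [real_inner_self_eq_norm_sq] at h1
  refine hasSum_le (fun j => ?_) hS h1
  rw [real_inner_comm q (e j), ← sq]
  rcases h j with h2 | h2
  · gcongr
  · rw [h2]; simp

end Residual

namespace Model

variable {𝒳 𝒴 Ω : Type*} [NormedAddCommGroup 𝒳] [InnerProductSpace ℝ 𝒳] [CompleteSpace 𝒳]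
  [SecondCountableTopology 𝒳] [MeasurableSpace 𝒳] [BorelSpace 𝒳]
  [NormedAddCommGroup 𝒴] [InnerProductSpace ℝ 𝒴] [CompleteSpace 𝒴]
  [SecondCountableTopology 𝒴] [MeasurableSpace 𝒴] [BorelSpace 𝒴]
  [MeasurableSpace Ω] {P : Measure Ω} [IsProbabilityMeasure P] {D : Model 𝒳 𝒴 Ω}

/-- The expectation `E ⟪X, u⟫ ⟪Y, v⟫`, the cross-covariance form. -/
noncomputable def crossCov (D : Model 𝒳 𝒴 Ω) (P : Measure Ω) (u : 𝒳) (v : 𝒴) : ℝ :=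
  ∫ ω, D.score u v 0 ω ∂P

/-- The expectation `λ_{j₁} b_{j₁j₂}` of the `j`-th coordinate of `V_1`. -/
noncomputable def μ (D : Model 𝒳 𝒴 Ω) (j : D.Pos) : ℝ :=
  D.lam (Idx.ofFin D.p₁_le j.1) * D.b (Idx.ofFin D.p₁_le j.1) (Idx.ofFin D.p₂_le j.2)

namespace IsFLM

theorem crossCov_eq (hD : D.IsFLM P) (u : 𝒳) (v : 𝒴) :
    D.crossCov P u v = ⟪D.β (covOp (D.X 0) P u), v⟫ := hD.integral_score_eq u v

theorem crossCov_φ_ψ (hD : D.IsFLM P) (i : Idx D.dX) (j : Idx D.dY) :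
    D.crossCov P (D.φ i) (D.ψ j) = D.lam i * D.b i j := by
  rw [hD.crossCov_eq, hD.eigen_X, map_smul, inner_smul_left, b]
  simp

theorem crossCov_sq_le (hD : D.IsFLM P) (u : 𝒳) (v : 𝒴) :
    D.crossCov P u v ^ 2 ≤ D.secX P u * D.secY P v :=
  sq_integral_mul_le (hD.memLp_X.inner_const u) (hD.memLp_Y.inner_const v)

theorem abs_crossCov_le (hD : D.IsFLM P) (u : 𝒳) (v : 𝒴) {A B : ℝ} (hA : D.secX P u ≤ A)
    (hB : D.secY P v ≤ B) : |D.crossCov P u v| ≤ √(A * B) := by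
  refine Real.abs_le_sqrt ((hD.crossCov_sq_le u v).trans ?_)
  exact mul_le_mul hA hB (D.secY_nonneg P v) ((D.secX_nonneg P u).trans hA)

theorem abs_μ_le (hD : D.IsFLM P) (j : D.Pos) : |D.μ j| ≤
    √(D.lam (Idx.ofFin D.p₁_le j.1) * D.rho (Idx.ofFin D.p₂_le j.2)) := by
  rw [μ, ← hD.crossCov_φ_ψ]
  exact hD.abs_crossCov_le _ _ (hD.secX_φ _).le (hD.secY_ψ _).le

/-- The mean of a coordinate of `V_1(φ̃, ψ̃)` for a pair in the class. The error has a part from the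
entries of `W - I`, and parts from the components of `φ̃` and `ψ̃` outside the span of the leading
eigenelements; `εX` and `εY` bound the eigenvalues that belong to the latter. -/
theorem abs_μ_sub_le_abs_crossCov (hD : D.IsFLM P) {r : ℝ} (hr0 : 0 ≤ r) (hr : r < 1)
    {f : D.Bases} (hf : f ∈ D.classF r) (j : D.Pos) {εX εY LX LY : ℝ} (hεX0 : 0 ≤ εX)
    (hεY0 : 0 ≤ εY) (hεX : ∀ i : Idx D.dX, D.p₁ ≤ (i : ℕ) → D.lam i ≤ εX)
    (hεY : ∀ i : Idx D.dY, D.p₂ ≤ (i : ℕ) → D.rho i ≤ εY)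
    (hLX : ∀ i, D.lam i ≤ LX) (hLY : ∀ i, D.rho i ≤ LY) :
    |D.μ j| - r * ∑ k, |D.μ k| - (2 * √(εX * (2 * r) * LY) + √(LX * (εY * (2 * r)))) ≤
      |D.crossCov P (f.1 j.1) (f.2 j.2)| := by
  obtain ⟨s, hs, hs1, hs2⟩ := exists_sign_norm_sub_le hr hf j
  obtain ⟨h1, h2, h3⟩ := hf
  set u := f.1 j.1 with hu
  set v := f.2 j.2 with hv
  have hu1 : ‖u‖ = 1 := h1.1 _
  have hv1 : ‖v‖ = 1 := h2.1 _
  have hgX : Function.Injective (Idx.ofFin D.p₁_le) := fun a b hab =>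
    Fin.ext (congrArg Subtype.val hab)
  have hgY : Function.Injective (Idx.ofFin D.p₂_le) := fun a b hab =>
    Fin.ext (congrArg Subtype.val hab)
  set qu := basisResidual D.φ (Idx.ofFin D.p₁_le) u with hqu
  set qv := basisResidual D.ψ (Idx.ofFin D.p₂_le) v with hqv
  have sgn : ∀ {x : ℝ}, 2 - 2 * (s * x) ≤ 2 * r → 1 - x ^ 2 ≤ 2 * r := fun {x} hx => by
    have h4 : 1 - r ≤ s * x := by linarith
    have h5 : (1 - r) ^ 2 ≤ (s * x) ^ 2 := pow_le_pow_left₀ (by linarith) h4 2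
    have h6 : (s * x) ^ 2 = x ^ 2 := by rw [mul_pow, sq s, hs, one_mul]
    nlinarith
  have hs' : s ^ 2 = 1 := by rw [sq, hs]
  have hnu : ‖qu‖ ^ 2 ≤ 2 * r := by
    refine (norm_basisResidual_sq_le D.φ hgX u j.1).trans ?_
    rw [hu1, one_pow]
    refine sgn ?_
    rw [norm_sub_sq_real, norm_smul, hu1, D.norm_eigenBases_fst, inner_smul_left,
      real_inner_comm, mul_pow, Real.norm_eq_abs, sq_abs, hs'] at hs1
    simp only [conj_trivial, eigenBases] at hs1
    linarith
  have hnv : ‖qv‖ ^ 2 ≤ 2 * r := by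
    refine (norm_basisResidual_sq_le D.ψ hgY v j.2).trans ?_
    rw [hv1, one_pow]
    refine sgn ?_
    rw [norm_sub_sq_real, norm_smul, hv1, D.norm_eigenBases_snd, inner_smul_left,
      real_inner_comm, mul_pow, Real.norm_eq_abs, sq_abs, hs'] at hs2
    simp only [conj_trivial, eigenBases] at hs2
    linarith
  have hnv1 : ‖qv‖ ^ 2 ≤ 1 := by
    refine (norm_basisResidual_sq_le D.ψ hgY v j.2).trans ?_
    rw [hv1]
    nlinarith [sq_nonneg (⟪D.ψ (Idx.ofFin D.p₂_le j.2), v⟫ : ℝ)]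
  have hLX0 : 0 ≤ LX := (hD.lam_pos (Idx.ofFin D.p₁_le j.1)).le.trans (hLX _)
  have hLY0 : 0 ≤ LY := (hD.rho_pos (Idx.ofFin D.p₂_le j.2)).le.trans (hLY _)
  have sX : D.secX P qu ≤ εX * (2 * r) := by
    refine (hasSum_le_mul_norm_sq D.φ (hD.hasSum_secX qu) (ε := εX) fun i => ?_).trans
      (by gcongr)
    rcases lt_or_ge (i : ℕ) D.p₁ with h | h
    · exact Or.inr (inner_basisResidual D.φ hgX u ⟨i, h⟩)
    · exact Or.inl (hεX i h)
  have sY : D.secY P qv ≤ εY * (2 * r) := by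
    refine (hasSum_le_mul_norm_sq D.ψ (hD.hasSum_secY qv) (ε := εY) fun i => ?_).trans
      (by gcongr)
    rcases lt_or_ge (i : ℕ) D.p₂ with h | h
    · exact Or.inr (inner_basisResidual D.ψ hgY v ⟨i, h⟩)
    · exact Or.inl (hεY i h)
  have sX1 : D.secX P u ≤ LX := by
    refine (hasSum_le_mul_norm_sq D.φ (hD.hasSum_secX u) (ε := LX)
      fun i => Or.inl (hLX i)).trans (by rw [hu1]; simp)
  have sY1 : D.secY P v ≤ LY := by
    refine (hasSum_le_mul_norm_sq D.ψ (hD.hasSum_secY v) (ε := LY)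
      fun i => Or.inl (hLY i)).trans (by rw [hv1]; simp)
  have sYq : D.secY P qv ≤ LY := by
    refine (hasSum_le_mul_norm_sq D.ψ (hD.hasSum_secY qv) (ε := LY)
      fun i => Or.inl (hLY i)).trans (mul_le_of_le_one_right hLY0 hnv1)
  have b1 := hD.abs_crossCov_le qu v sX sY1
  have b2 := hD.abs_crossCov_le u qv sX1 sY
  have b3 := hD.abs_crossCov_le qu qv sX sYq
  have hPP : D.crossCov P (u - qu) (v - qv) = ∑ k, D.W f k j * D.μ k := by
    have e1 : u - qu = ∑ k, (⟪D.eigenBases.1 k, u⟫ : ℝ) • D.eigenBases.1 k := sub_sub_cancel _ _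
    have e2 : v - qv = ∑ k, (⟪D.eigenBases.2 k, v⟫ : ℝ) • D.eigenBases.2 k := sub_sub_cancel _ _
    rw [hD.crossCov_eq, e1, e2]
    simp only [map_sum, map_smul, sum_inner, inner_sum, inner_smul_left, inner_smul_right,
      conj_trivial]
    refine Eq.trans ?_ (Fintype.sum_prod_type (fun k : D.Pos => D.W f k j * D.μ k)).symm
    simp only [Finset.mul_sum]
    rw [Finset.sum_comm]
    refine Finset.sum_congr rfl fun k _ => Finset.sum_congr rfl fun l _ => ?_
    have e3 : ⟪D.β (covOp (D.X 0) P (D.eigenBases.1 k)), D.eigenBases.2 l⟫ = D.μ (k, l) := by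
      rw [← hD.crossCov_eq]
      exact hD.crossCov_φ_ψ _ _
    have e4 : D.W f (k, l) j = ⟪D.eigenBases.1 k, u⟫ * ⟪D.eigenBases.2 l, v⟫ := rfl
    rw [e3, e4]
    ring
  have hdec : D.crossCov P u v = D.crossCov P (u - qu) (v - qv) + D.crossCov P qu v +
      D.crossCov P u qv - D.crossCov P qu qv := by
    simp only [hD.crossCov_eq, map_sub, inner_sub_left, inner_sub_right]
    ring
  have hW : ∑ k, D.W f k j * D.μ k = D.μ j + ∑ k, (D.W f - 1) k j * D.μ k := by
    simp only [Matrix.sub_apply, sub_mul, Finset.sum_sub_distrib, Matrix.one_apply, ite_mul,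
      one_mul, zero_mul, Finset.sum_ite_eq', Finset.mem_univ, if_true]
    ring
  have hWr : |∑ k, (D.W f - 1) k j * D.μ k| ≤ r * ∑ k, |D.μ k| := by
    refine (Finset.abs_sum_le_sum_abs _ _).trans ?_
    rw [Finset.mul_sum]
    refine Finset.sum_le_sum fun k _ => ?_
    rw [abs_mul]
    gcongr
    exact h3 k j
  have hfin : D.μ j = D.crossCov P u v - ∑ k, (D.W f - 1) k j * D.μ k - D.crossCov P qu v -
      D.crossCov P u qv + D.crossCov P qu qv := by
    rw [hdec, hPP, hW]; ring
  have htri : |D.μ j| ≤ |D.crossCov P u v| + |∑ k, (D.W f - 1) k j * D.μ k| +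
      |D.crossCov P qu v| + |D.crossCov P u qv| + |D.crossCov P qu qv| := by
    rw [hfin]
    refine (abs_add_le _ _).trans ?_
    gcongr
    refine (abs_sub _ _).trans ?_
    gcongr
    refine (abs_sub _ _).trans ?_
    gcongr
    exact abs_sub _ _
  linarith

/-- A lower bound for the largest variance of the coordinates of `V_1`. Either the error has a
substantial share in `⟪Y, ψ_1⟫`, or the slope operator correlates `⟪Y, ψ_1⟫` with one of the leading
scores of `X`. The function `h` bounds `λ_k b_{k1}²` beyond the first `N` indices. -/
theorem exists_le_sd_sq (hD : D.IsFLM P) {K : ℝ} (hK : 0 < K) (hT : D.HasTail P K) {N : ℕ}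
    (hN : N ≤ D.p₁ ∨ (D.p₁ : ℕ∞) = D.dX) (hN0 : 0 < N) {l ρ Cb : ℝ} (hl : 0 < l) (hρ : 0 < ρ)
    (hlam : ∀ i : Idx D.dX, (i : ℕ) < N → l ≤ D.lam i)
    (hrho : ρ ≤ D.rho (Idx.ofFin D.p₂_le ⟨0, D.p₂_pos⟩))
    (hb : ∀ i, D.b i (Idx.ofFin D.p₂_le ⟨0, D.p₂_pos⟩) ^ 2 ≤
      Cb * D.rho (Idx.ofFin D.p₂_le ⟨0, D.p₂_pos⟩)) {h : ℕ → ℝ} (h0 : ∀ k, 0 ≤ h k)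
    (hh : ∀ i : Idx D.dX, N ≤ (i : ℕ) → D.lam i * Cb ≤ h i)
    (hsum : Summable h) (htail : ∑' k, h (k + N) ≤ 1 / 4) :
    ∃ j : D.Pos, l * ρ / (8 * N * K ^ 2) ≤ D.sd P D.eigenBases j ^ 2 := by
  set y := Idx.ofFin D.p₂_le ⟨0, D.p₂_pos⟩ with hy
  have hN1 : (1 : ℝ) ≤ N := by exact_mod_cast hN0
  have hvar : ∀ (j : D.Pos) (s : ℝ), s ≤ ∫ ω, D.score (D.eigenBases.1 j.1)
      (D.eigenBases.2 j.2) 0 ω ^ 2 ∂P → s / (2 * K ^ 2) ≤ D.sd P D.eigenBases j ^ 2 := by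
    intro j s hs
    rw [sd_sq, div_le_iff₀ (by positivity)]
    have := hD.integral_score_sq_le_variance hK hT (D.eigenBases.1 j.1) (D.eigenBases.2 j.2)
    linarith
  have hdX0 : ((0 : ℕ) : ℕ∞) < D.dX :=
    lt_of_lt_of_le (by exact_mod_cast D.p₁_pos) D.p₁_le
  by_cases hZ : D.rho y / 2 ≤ ∫ ω, ⟪D.Z 0 ω, D.ψ y⟫ ^ 2 ∂P
  · refine ⟨(⟨0, D.p₁_pos⟩, ⟨0, D.p₂_pos⟩), ?_⟩
    have h1 := hD.mul_integral_Z_le_integral_score_sq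
      (D.φ (Idx.ofFin D.p₁_le ⟨0, D.p₁_pos⟩)) (D.ψ y)
    rw [hD.secX_φ] at h1
    have h2 : l ≤ D.lam (Idx.ofFin D.p₁_le ⟨0, D.p₁_pos⟩) := hlam _ hN0
    refine le_trans ?_ (hvar _ (l * (ρ / 2)) (le_trans ?_ h1))
    · rw [div_le_div_iff₀ (by positivity) (by positivity)]
      have : 0 < l * ρ * K ^ 2 := by positivity
      nlinarith
    · have : 0 ≤ D.rho y / 2 := by linarith
      exact mul_le_mul h2 (le_trans (by linarith) hZ) (by positivity) (hl.le.trans h2)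
  · by_contra! hcon
    have hβ : ∀ ω x, ⟪D.X 0 ω, D.β.adjoint x⟫ = ⟪D.β (D.X 0 ω), x⟫ := fun ω x =>
      ContinuousLinearMap.adjoint_inner_right _ _ _
    have hG : D.rho y / 2 < D.secX P (D.β.adjoint (D.ψ y)) := by
      have h1 := hD.secY_eq (D.ψ y)
      rw [hD.secY_ψ] at h1
      simp_rw [secX, hβ]
      linarith
    have hs := hD.hasSum_secX (D.β.adjoint (D.ψ y))
    have hb' : ∀ i, (⟪D.β.adjoint (D.ψ y), D.φ i⟫ : ℝ) = D.b i y := fun i => by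
      rw [ContinuousLinearMap.adjoint_inner_left, real_inner_comm, b]
    simp_rw [hb'] at hs
    have hρy : 0 < D.rho y := hD.rho_pos y
    set g : ℕ → ℝ := fun k => if k < N then D.rho y / (4 * N) else D.rho y * h k with hgdef
    have hg0 : ∀ k, 0 ≤ g k := fun k => by
      simp only [hgdef]
      split_ifs
      · positivity
      · exact mul_nonneg hρy.le (h0 k)
    have hle : ∀ i : Idx D.dX, D.lam i * D.b i y ^ 2 ≤ g i := fun i => by
      simp only [hgdef]
      split_ifs with hi
      · have hip : (i : ℕ) < D.p₁ := by
          rcases hN with h1 | h1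
          · exact hi.trans_le h1
          · exact_mod_cast lt_of_lt_of_eq i.2 h1.symm
        have h2 := hcon (⟨i, hip⟩, ⟨0, D.p₂_pos⟩)
        by_contra! h3
        have h4 : (D.lam i * D.b i y) ^ 2 ≤ ∫ ω, D.score (D.φ i) (D.ψ y) 0 ω ^ 2 ∂P := by
          rw [← hD.crossCov_φ_ψ]
          have := sq_integral_mul_le ((hD.memLp_score hK hT (D.φ i) (D.ψ y)).mono_exponent
            (by norm_num : (2 : ℝ≥0∞) ≤ 4)) (memLp_const (1 : ℝ))
          simpa [crossCov] using this
        have h5 : l * ρ / (4 * N) ≤ (D.lam i * D.b i y) ^ 2 := by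
          calc l * ρ / (4 * N) = l * (ρ / (4 * N)) := by ring
            _ ≤ D.lam i * (D.lam i * D.b i y ^ 2) := by
              refine mul_le_mul (hlam i hi) (le_trans ?_ h3.le) (by positivity) (hD.lam_pos i).le
              gcongr
            _ = _ := by ring
        have h6 := hvar (⟨i, hip⟩, ⟨0, D.p₂_pos⟩) _ (h5.trans h4)
        have h7 : l * ρ / (4 * N) / (2 * K ^ 2) = l * ρ / (8 * N * K ^ 2) := by
          field_simp
          norm_num
        linarith
      · calc D.lam i * D.b i y ^ 2 ≤ D.lam i * (Cb * D.rho y) := by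
              have := (hD.lam_pos i).le
              gcongr
              exact hb i
          _ = D.rho y * (D.lam i * Cb) := by ring
          _ ≤ _ := by
              gcongr
              exact hh i (not_lt.1 hi)
    have hgsum : Summable g := by
      refine (summable_nat_add_iff N).1 ?_
      refine ((summable_nat_add_iff N).2 (hsum.mul_left (D.rho y))).congr fun k => ?_
      simp [hgdef]
    have hgt : ∑' k, g k ≤ D.rho y / 2 := by
      rw [← hgsum.sum_add_tsum_nat_add N]
      have h1 : ∑ k ∈ Finset.range N, g k = D.rho y / 4 := by
        rw [Finset.sum_congr rfl fun k hk => show g k = D.rho y / (4 * N) by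
          simp [hgdef, Finset.mem_range.1 hk]]
        rw [Finset.sum_const, Finset.card_range, nsmul_eq_mul]
        field_simp
      have h2 : ∑' k, g (k + N) = D.rho y * ∑' k, h (k + N) := by
        rw [← tsum_mul_left]
        exact tsum_congr fun k => by simp [hgdef]
      rw [h1, h2]
      nlinarith
    have hgi : Summable fun i : Idx D.dX => g i := hgsum.comp_injective Subtype.val_injective
    have h8 : D.secX P (D.β.adjoint (D.ψ y)) ≤ ∑' i : Idx D.dX, g i := hasSum_le hle hs hgi.hasSum
    have h9 : ∑' i : Idx D.dX, g i ≤ ∑' k, g k :=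
      hgi.tsum_le_tsum_of_inj _ Subtype.val_injective (fun k _ => hg0 k) (fun _ => le_rfl) hgsum
    linarith

end IsFLM
end Model
end FLMTest

/-! ### Bounds that depend on the constants of the assumptions only -/

namespace FLMTest

theorem summable_succ_rpow {α : ℝ} (hα : 1 < α) : Summable fun k : ℕ => ((k : ℝ) + 1) ^ (-α) := by
  have h := (summable_nat_add_iff 1).2 (Real.summable_nat_rpow.2 (show -α < -1 by linarith))
  simpa using h

namespace Model

variable {𝒳 𝒴 Ω : Type*} [NormedAddCommGroup 𝒳] [InnerProductSpace ℝ 𝒳] [CompleteSpace 𝒳]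
  [SecondCountableTopology 𝒳] [MeasurableSpace 𝒳] [BorelSpace 𝒳]
  [NormedAddCommGroup 𝒴] [InnerProductSpace ℝ 𝒴] [CompleteSpace 𝒴]
  [SecondCountableTopology 𝒴] [MeasurableSpace 𝒴] [BorelSpace 𝒴]
  [MeasurableSpace Ω] {P : Measure Ω} [IsProbabilityMeasure P] {D : Model 𝒳 𝒴 Ω}

/-- The assumptions on a single model, with explicit constants: the tail constant `K`, and lower and
upper constants `c`, `C` for the eigenvalues and for the alignment of the slope operator. -/
structure Regular [MeasurableSpace Ω] [MeasurableSpace 𝒳] [MeasurableSpace 𝒴]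
    (D : Model 𝒳 𝒴 Ω) (P : Measure Ω) (α₁ α₂ K c C : ℝ) : Prop where
  flm : D.IsFLM P
  tail : D.HasTail P K
  le_lam : ∀ j : Idx D.dX, c * ((j : ℕ) + 1 : ℝ) ^ (-α₁) ≤ D.lam j
  lam_le : ∀ j : Idx D.dX, D.lam j ≤ C * ((j : ℕ) + 1 : ℝ) ^ (-α₁)
  le_rho : ∀ j : Idx D.dY, c * ((j : ℕ) + 1 : ℝ) ^ (-α₂) ≤ D.rho j
  rho_le : ∀ j : Idx D.dY, D.rho j ≤ C * ((j : ℕ) + 1 : ℝ) ^ (-α₂)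
  b_sq_le : ∀ i j, D.b i j ^ 2 ≤ C * D.rho j

theorem succ_rpow_le_one {α : ℝ} (hα : 0 ≤ α) (k : ℕ) : ((k : ℝ) + 1) ^ (-α) ≤ 1 :=
  Real.rpow_le_one_of_one_le_of_nonpos (by linarith [k.cast_nonneg (α := ℝ)]) (by linarith)

theorem signal_nonneg (D : Model 𝒳 𝒴 Ω) : 0 ≤ D.signal := Real.iSup_nonneg fun _ => abs_nonneg _

theorem abs_μ_le_signal (D : Model 𝒳 𝒴 Ω) (j : D.Pos) : |D.μ j| ≤ D.signal :=
  le_ciSup (f := fun j => |D.μ j|) (Set.finite_range _).bddAbove j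

theorem sd_le_sdMax (D : Model 𝒳 𝒴 Ω) (P : Measure Ω) (f : D.Bases) (j : D.Pos) :
    D.sd P f j ≤ D.sdMax P f :=
  le_ciSup (f := fun j => D.sd P f j) (Set.finite_range _).bddAbove j

theorem tsum_ofReal_idx_le {d : ℕ∞} {l : Idx d → ℝ} {C α : ℝ} (hC : 0 ≤ C) (hα : 1 < α)
    (h : ∀ j, l j ≤ C * ((j : ℕ) + 1 : ℝ) ^ (-α)) :
    ∑' j, ENNReal.ofReal (l j) ≤ ENNReal.ofReal (C * ∑' k : ℕ, ((k : ℝ) + 1) ^ (-α)) := by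
  rw [← tsum_mul_left, ENNReal.ofReal_tsum_of_nonneg (fun k => by positivity)
    ((summable_succ_rpow hα).mul_left C)]
  refine (ENNReal.tsum_le_tsum fun j => ENNReal.ofReal_le_ofReal (h j)).trans ?_
  exact ENNReal.tsum_comp_le_tsum_of_injective Subtype.val_injective
    (fun k : ℕ => ENNReal.ofReal (C * ((k : ℝ) + 1) ^ (-α)))

namespace Regular

variable {α₁ α₂ K c C : ℝ}

theorem tsum_lam_le (h : D.Regular P α₁ α₂ K c C) (hC : 0 ≤ C) (hα : 1 < α₁) :
    ∑' j, ENNReal.ofReal (D.lam j) ≤ ENNReal.ofReal (C * ∑' k : ℕ, ((k : ℝ) + 1) ^ (-α₁)) :=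
  tsum_ofReal_idx_le hC hα h.lam_le

theorem tsum_rho_le (h : D.Regular P α₁ α₂ K c C) (hC : 0 ≤ C) (hα : 1 < α₂) :
    ∑' j, ENNReal.ofReal (D.rho j) ≤ ENNReal.ofReal (C * ∑' k : ℕ, ((k : ℝ) + 1) ^ (-α₂)) :=
  tsum_ofReal_idx_le hC hα h.rho_le

theorem lam_le_const (h : D.Regular P α₁ α₂ K c C) (hC : 0 ≤ C) (hα : 0 ≤ α₁) (j : Idx D.dX) :
    D.lam j ≤ C :=
  (h.lam_le j).trans (mul_le_of_le_one_right hC (succ_rpow_le_one hα j))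

theorem rho_le_const (h : D.Regular P α₁ α₂ K c C) (hC : 0 ≤ C) (hα : 0 ≤ α₂) (j : Idx D.dY) :
    D.rho j ≤ C :=
  (h.rho_le j).trans (mul_le_of_le_one_right hC (succ_rpow_le_one hα j))

theorem summable_weight (C : ℝ) (hα₁ : 2 < α₁) (hα₂ : 2 < α₂) : Summable fun k : ℕ × ℕ =>
    C * (((k.1 : ℝ) + 1) ^ (-(α₁ / 2)) * ((k.2 : ℝ) + 1) ^ (-(α₂ / 2))) :=
  (Summable.mul_of_nonneg (f := fun k : ℕ => ((k : ℝ) + 1) ^ (-(α₁ / 2)))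
    (g := fun k : ℕ => ((k : ℝ) + 1) ^ (-(α₂ / 2))) (summable_succ_rpow (by linarith))
    (summable_succ_rpow (by linarith)) (fun _ => by positivity)
    (fun _ => by positivity)).mul_left C

theorem abs_μ_le (h : D.Regular P α₁ α₂ K c C) (hC : 0 ≤ C) (j : D.Pos) : |D.μ j| ≤
    C * ((((j.1 : ℕ) : ℝ) + 1) ^ (-(α₁ / 2)) * (((j.2 : ℕ) : ℝ) + 1) ^ (-(α₂ / 2))) := by
  refine (h.flm.abs_μ_le j).trans (Real.sqrt_le_iff.2 ⟨by positivity, ?_⟩)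
  have e : ∀ (x : ℝ) (α : ℝ), 0 ≤ x → (x ^ (-(α / 2))) ^ 2 = x ^ (-α) := fun x α hx => by
    rw [← Real.rpow_natCast, ← Real.rpow_mul hx]
    congr 1
    push_cast
    ring
  rw [mul_pow, mul_pow, e _ _ (by positivity), e _ _ (by positivity)]
  have h1 : D.lam (Idx.ofFin D.p₁_le j.1) ≤ C * (((j.1 : ℕ) : ℝ) + 1) ^ (-α₁) := h.lam_le _
  have h2 : D.rho (Idx.ofFin D.p₂_le j.2) ≤ C * (((j.2 : ℕ) : ℝ) + 1) ^ (-α₂) := h.rho_le _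
  calc _ ≤ (C * (((j.1 : ℕ) : ℝ) + 1) ^ (-α₁)) * (C * (((j.2 : ℕ) : ℝ) + 1) ^ (-α₂)) :=
        mul_le_mul h1 h2 (h.flm.rho_pos _).le (by positivity)
    _ = _ := by ring

/-- All but a fixed number of the means `λ_{j₁} b_{j₁j₂}` have a small sum. -/
theorem sum_abs_μ_le (h : D.Regular P α₁ α₂ K c C) (hC : 0 ≤ C) {η : ℝ} {F : Finset (ℕ × ℕ)}
    (hF : ∀ t : Finset (ℕ × ℕ), Disjoint t F → ‖∑ k ∈ t,
      C * (((k.1 : ℝ) + 1) ^ (-(α₁ / 2)) * ((k.2 : ℝ) + 1) ^ (-(α₂ / 2)))‖ < η) :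
    ∑ k, |D.μ k| ≤ F.card * D.signal + η := by
  have hν : 0 ≤ D.signal := signal_nonneg D
  have hinj : Function.Injective fun j : D.Pos => ((j.1 : ℕ), (j.2 : ℕ)) := fun a b hab => by
    simp only [Prod.mk.injEq] at hab
    exact Prod.ext (Fin.ext hab.1) (Fin.ext hab.2)
  classical
  rw [← Finset.sum_filter_add_sum_filter_not Finset.univ
    (fun j : D.Pos => ((j.1 : ℕ), (j.2 : ℕ)) ∈ F)]
  gcongr
  · refine (Finset.sum_le_card_nsmul _ _ D.signal fun j _ => abs_μ_le_signal D j).trans ?_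
    rw [nsmul_eq_mul]
    gcongr
    exact Finset.card_le_card_of_injOn (fun j => ((j.1 : ℕ), (j.2 : ℕ)))
      (fun j hj => (Finset.mem_filter.1 hj).2) hinj.injOn
  · refine (Finset.sum_le_sum fun j _ => h.abs_μ_le hC j).trans ?_
    have h1 := hF ((Finset.univ.filter
      fun j : D.Pos => ¬ ((j.1 : ℕ), (j.2 : ℕ)) ∈ F).map ⟨_, hinj⟩) (by
        rw [Finset.disjoint_left]
        intro a ha
        obtain ⟨j, hj, rfl⟩ := Finset.mem_map.1 ha
        exact (Finset.mem_filter.1 hj).2)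
    rw [Finset.sum_map] at h1
    exact (le_abs_self _).trans h1.le

/-- Once enough eigenelements are used, the largest variance is bounded away from zero by a constant
that depends only on the constants of the model. -/
theorem exists_le_sd_sq (hR : D.Regular P α₁ α₂ K c C) (hK : 0 < K) (hc : 0 < c) (hC : 0 < C)
    (hα₁ : 1 < α₁) {N : ℕ} (hN0 : 0 < N)
    (hN1 : ∑' k : ℕ, C * (((k + N : ℕ) : ℝ) + 1) ^ (-α₁) * C < 1 / 4)
    (hp : N ≤ D.p₁ ∨ (D.p₁ : ℕ∞) = D.dX) :
    ∃ j : D.Pos, c * (N : ℝ) ^ (-α₁) * c / (8 * N * K ^ 2) ≤ D.sd P D.eigenBases j ^ 2 := by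
  set h : ℕ → ℝ := fun k => C * ((k : ℝ) + 1) ^ (-α₁) * C with hh
  have hs : Summable h := ((summable_succ_rpow hα₁).mul_left C).mul_right C
  have hl : 0 < c * (N : ℝ) ^ (-α₁) :=
    mul_pos hc (Real.rpow_pos_of_pos (by exact_mod_cast hN0) _)
  refine hR.flm.exists_le_sd_sq hK hR.tail hp hN0 hl hc (fun i hi => ?_) ?_ (Cb := C)
    (fun i => hR.b_sq_le i _) (h := h) (fun k => by positivity) (fun i _ => ?_) hs hN1.le
  · refine le_trans ?_ (hR.le_lam i)
    gcongr ?_ * ?_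
    refine Real.rpow_le_rpow_of_nonpos (by positivity) ?_ (by linarith)
    exact_mod_cast hi
  · refine le_trans ?_ (hR.le_rho _)
    simp [Idx.ofFin]
  · simp only [hh]
    gcongr
    exact hR.lam_le i

end Regular
end Model
end FLMTest

/-! ### Rates -/

namespace FLMTest

namespace Consts

variable {e : Consts} {p : ℕ → ℕ}

theorem tendsto_k (hδ : 0 < e.δ) (hp : Tendsto p atTop atTop) :
    Tendsto (fun n => (e.k n (p n) : ℝ)) atTop atTop := by
  have ha : 0 < e.a := lt_of_lt_of_le (by norm_num) (le_max_left _ _)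
  have h1 : Tendsto (fun n : ℕ => (n : ℝ) ^ (e.δ / e.a)) atTop atTop :=
    (tendsto_rpow_atTop (div_pos hδ ha)).comp tendsto_natCast_atTop_atTop
  have h2 : Tendsto (fun n => (p n : ℝ)) atTop atTop := tendsto_natCast_atTop_atTop.comp hp
  refine tendsto_atTop_mono (fun n => Nat.le_ceil _) ?_
  rw [tendsto_atTop]
  intro b
  filter_upwards [h1.eventually_ge_atTop b, h2.eventually_ge_atTop b] with n h3 h4
  exact le_min h3 h4

theorem rate_nonneg (n p : ℕ) : 0 ≤ e.rate n p := by
  unfold rate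
  positivity

theorem tendsto_rate (hδ : 0 < e.δ) (hα : 0 ≤ e.αhi) (hα₀ : 0 < e.α₀)
    (hp : Tendsto p atTop atTop) : Tendsto (fun n => e.rate n (p n)) atTop (𝓝 0) := by
  have h2 : Tendsto (fun n => (p n : ℝ) ^ e.α₀) atTop atTop :=
    (tendsto_rpow_atTop hα₀).comp (tendsto_natCast_atTop_atTop.comp hp)
  refine tendsto_inv_atTop_zero.comp (tendsto_atTop_mono' atTop ?_ h2)
  filter_upwards [(tendsto_k hδ hp).eventually_ge_atTop 1] with n hn
  exact le_mul_of_one_le_left (by positivity) (Real.one_le_rpow hn hα)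

/-- Eigenvalues beyond the truncation level `q` are negligible compared with `a_n`, when the other
truncation level is bounded. -/
theorem eventually_rpow_le_rate (hδ : 0 < e.δ) (hp : Tendsto p atTop atTop) {α c C M : ℝ}
    (hlo : 1 < e.αlo) (hα : e.αlo ≤ α) (hhi : 0 < e.αhi) (hα₀ : e.α₀ ∈ Set.Ioo (0 : ℝ) 1)
    (hc : 0 < c) (hC : 0 < C) (hM : 0 < M) {q q' : ℕ → ℕ} {T : ℕ → Prop}
    (hpq : ∀ n, p n = q n * q' n) (hmin : ∀ n, (min (q n) (q' n) : ℝ) ≤ M)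
    (hT : ∀ᶠ n in atTop, T n → c * (e.k n (p n) : ℝ) ^ (e.αhi / (e.αlo - 1)) ≤ q n)
    {ε : ℝ} (hε : 0 < ε) :
    ∀ᶠ n in atTop, T n → C * ((q n : ℝ) + 1) ^ (-α) ≤ ε * e.rate n (p n) := by
  have hs : 0 < e.αlo - 1 := by linarith
  have hkt := tendsto_k hδ hp
  have hlow : Tendsto (fun n => c * (e.k n (p n) : ℝ) ^ (e.αhi / (e.αlo - 1))) atTop atTop :=
    ((tendsto_rpow_atTop (div_pos hhi hs)).comp hkt).const_mul_atTop hc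
  have hexp : Tendsto (fun x : ℝ => C * (c⁻¹ ^ (e.αlo - 1) * M ^ e.α₀ * x ^ (-(1 - e.α₀))))
      atTop (𝓝 (C * (c⁻¹ ^ (e.αlo - 1) * M ^ e.α₀ * 0))) :=
    ((tendsto_rpow_neg_atTop (by linarith [hα₀.2])).const_mul _).const_mul _
  simp only [mul_zero] at hexp
  obtain ⟨x₀, hx₀⟩ := eventually_atTop.1 (hexp.eventually_lt_const hε)
  filter_upwards [hT, hlow.eventually_ge_atTop x₀, hlow.eventually_gt_atTop M,
    hlow.eventually_ge_atTop 1, hkt.eventually_ge_atTop 1, hp.eventually_gt_atTop 0]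
    with n h1 h2 h3 h4 h5 h6 hn
  have hq := h1 hn
  have hq1 : (1 : ℝ) ≤ q n := h4.trans hq
  have hq0 : (0 : ℝ) < q n := by linarith
  have hq' : (q' n : ℝ) ≤ M := by
    rcases min_le_iff.1 (hmin n) with h | h
    · linarith
    · exact h
  set k : ℝ := (e.k n (p n) : ℝ) with hk
  have hk0 : 0 < k := by linarith
  have hkb : k ^ e.αhi ≤ c⁻¹ ^ (e.αlo - 1) * (q n : ℝ) ^ (e.αlo - 1) := by
    rw [← Real.mul_rpow (by positivity) hq0.le]
    calc k ^ e.αhi = (k ^ (e.αhi / (e.αlo - 1))) ^ (e.αlo - 1) := by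
          rw [← Real.rpow_mul hk0.le, div_mul_cancel₀ _ hs.ne']
      _ ≤ _ := by
          refine Real.rpow_le_rpow (by positivity) ?_ hs.le
          rw [inv_mul_eq_div, le_div_iff₀ hc, mul_comm]
          exact hq
  have hpb : (p n : ℝ) ^ e.α₀ ≤ M ^ e.α₀ * (q n : ℝ) ^ e.α₀ := by
    rw [← Real.mul_rpow hM.le hq0.le]
    refine Real.rpow_le_rpow (by positivity) ?_ hα₀.1.le
    rw [hpq n]
    push_cast
    rw [mul_comm]
    gcongr
  have hp0 : (0 : ℝ) < p n := by exact_mod_cast h6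
  have hx := hx₀ (q n) (h2.trans hq)
  rw [rate, ← div_eq_mul_inv, le_div_iff₀ (by positivity)]
  have hqa : ((q n : ℝ) + 1) ^ (-α) ≤ (q n : ℝ) ^ (-e.αlo) :=
    (Real.rpow_le_rpow_of_nonpos hq0 (by linarith) (by linarith)).trans
      (Real.rpow_le_rpow_of_exponent_le hq1 (by linarith))
  calc _ ≤ C * (q n : ℝ) ^ (-e.αlo) * ((c⁻¹ ^ (e.αlo - 1) * (q n : ℝ) ^ (e.αlo - 1)) *
        (M ^ e.α₀ * (q n : ℝ) ^ e.α₀)) := by gcongr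
    _ = C * (c⁻¹ ^ (e.αlo - 1) * M ^ e.α₀ * ((q n : ℝ) ^ (-e.αlo) *
        (q n : ℝ) ^ (e.αlo - 1) * (q n : ℝ) ^ e.α₀)) := by ring
    _ = C * (c⁻¹ ^ (e.αlo - 1) * M ^ e.α₀ * (q n : ℝ) ^ (-(1 - e.α₀))) := by
        rw [← Real.rpow_add hq0, ← Real.rpow_add hq0]
        congr 3
        ring
    _ ≤ ε := hx.le

end Consts

section

variable {𝒳 𝒴 Ω : ℕ → Type*} [∀ n, NormedAddCommGroup (𝒳 n)] [∀ n, InnerProductSpace ℝ (𝒳 n)]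
  [∀ n, NormedAddCommGroup (𝒴 n)] [∀ n, InnerProductSpace ℝ (𝒴 n)]

/-- The growth assumption forces the dimension `p` to be at most the sample size. -/
theorem GrowthAssumption.eventually_p_le {D : ∀ n, Model (𝒳 n) (𝒴 n) (Ω n)} {e : Consts}
    (h : GrowthAssumption D e) (hδ : 0 < e.δ) (hα : 0 ≤ e.αhi) (hα₀ : 0 ≤ e.α₀)
    (hp : Tendsto (fun n => (D n).p) atTop atTop) : ∀ᶠ n in atTop, (D n).p ≤ n := by
  obtain ⟨C, hC, hb⟩ := h.p_bound
  have hl : Tendsto (fun n => Real.log (D n).p) atTop atTop :=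
    Real.tendsto_log_atTop.comp (tendsto_natCast_atTop_atTop.comp hp)
  filter_upwards [hb, hl.eventually_ge_atTop C, (Consts.tendsto_k hδ hp).eventually_ge_atTop 1]
    with n h1 h2 h3
  have hp1 : (1 : ℝ) ≤ (D n).p := by exact_mod_cast Nat.mul_pos (D n).p₁_pos (D n).p₂_pos
  set m : ℝ := max ((D n).p₁ : ℝ) ((D n).p₂ : ℝ) with hm
  have hm1 : (1 : ℝ) ≤ m := le_max_of_le_left (by exact_mod_cast (D n).p₁_pos)
  have hpm : ((D n).p : ℝ) ≤ m ^ (2 * (e.αhi + 1)) := by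
    calc ((D n).p : ℝ) = (D n).p₁ * (D n).p₂ := by simp [Model.p]
      _ ≤ m * m := by gcongr <;> simp [hm]
      _ = m ^ (2 : ℝ) := by norm_cast; ring
      _ ≤ _ := Real.rpow_le_rpow_of_exponent_le hm1 (by linarith)
  have h4 : (1 : ℝ) ≤ ((D n).p : ℝ) ^ (2 * e.α₀) := Real.one_le_rpow hp1 (by linarith)
  have h5 : (n : ℝ) / (e.k n (D n).p : ℝ) ^ (2 * e.αhi) ≤ n :=
    div_le_self (by positivity) (Real.one_le_rpow h3 (by linarith))
  have h6 : ((D n).p : ℝ) * C ≤ n * C := by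
    calc ((D n).p : ℝ) * C = 1 * (D n).p * C := by ring
      _ ≤ ((D n).p : ℝ) ^ (2 * e.α₀) * m ^ (2 * (e.αhi + 1)) * Real.log (D n).p := by gcongr
      _ ≤ C * ((n : ℝ) / (e.k n (D n).p : ℝ) ^ (2 * e.αhi)) := h1
      _ ≤ C * n := by gcongr
      _ = n * C := mul_comm _ _
  exact_mod_cast le_of_mul_le_mul_right h6 hC

end

end FLMTest

/-! ### Events of high probability and the rejection rule -/

namespace FLMTest

section

variable {Ω : Type*} [MeasurableSpace Ω] {P : Measure Ω}

theorem innerProb_mono {A B : Set Ω} (h : A ⊆ B) : innerProb P A ≤ innerProb P B :=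
  tsub_le_tsub_left (measure_mono (Set.compl_subset_compl.2 h)) 1

theorem ofReal_one_sub_le_innerProb {G A : Set Ω} (hGA : G ⊆ A) {a : ℝ} (ha : 0 ≤ a)
    (hG : P Gᶜ ≤ ENNReal.ofReal a) : ENNReal.ofReal (1 - a) ≤ innerProb P A := by
  rw [ENNReal.ofReal_sub _ ha, ENNReal.ofReal_one]
  exact tsub_le_tsub_left ((measure_mono (Set.compl_subset_compl.2 hGA)).trans hG) 1

theorem innerProb_le_one (A : Set Ω) : innerProb P A ≤ 1 := tsub_le_self

/-- The convention for division by zero only helps: a denominator in `[0, B]` that vanishes gives an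
infinite ratio of the same sign as the numerator. -/
theorem le_exDiv {x s m B : ℝ} (hm : 0 < m) (hx : m ≤ x) (hs : 0 ≤ s) (hsB : s ≤ B) :
    ((m / B : ℝ) : EReal) ≤ exDiv x s := by
  unfold exDiv
  split_ifs with h1 h2 h3
  · exact le_top
  · linarith
  · linarith
  · have hs' : 0 < s := lt_of_le_of_ne hs (Ne.symm h1)
    exact EReal.coe_le_coe_iff.2 (div_le_div₀ (hm.le.trans hx) hx hs' hsB)

theorem exDiv_le {x s m B : ℝ} (hm : 0 < m) (hx : x ≤ -m) (hs : 0 ≤ s) (hsB : s ≤ B) :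
    exDiv x s ≤ ((-(m / B) : ℝ) : EReal) := by
  unfold exDiv
  split_ifs with h1 h2 h3
  · linarith
  · exact bot_le
  · linarith
  · have hs' : 0 < s := lt_of_le_of_ne hs (Ne.symm h1)
    refine EReal.coe_le_coe_iff.2 ?_
    have : m / B ≤ -x / s := div_le_div₀ (by linarith) (by linarith) hs' hsB
    rw [neg_div] at this
    linarith

end

/-- Events that hold eventually on sets with probability `1 - O(1/n)` have probability
`1 - O(1/n)` for all sample sizes, because the bound is trivial for small `n`. -/
theorem exists_forall_ofReal_le_innerProb {Ω : ℕ → Type*} [∀ n, MeasurableSpace (Ω n)]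
    {P : ∀ n, Measure (Ω n)} {G A : ∀ n, Set (Ω n)} {a : ℝ}
    (hG : ∀ n : ℕ, 1 ≤ n → P n (G n)ᶜ ≤ ENNReal.ofReal (a * (n : ℝ)⁻¹))
    (hGA : ∀ᶠ n in atTop, G n ⊆ A n) :
    ∃ c₀ : ℝ, 0 < c₀ ∧ ∀ c, c₀ ≤ c → ∀ n : ℕ, 1 ≤ n →
      ENNReal.ofReal (1 - c * (n : ℝ)⁻¹) ≤ innerProb (P n) (A n) := by
  obtain ⟨N, hN⟩ := eventually_atTop.1 hGA
  refine ⟨max (N + 1) a, lt_max_of_lt_left (by positivity), fun c hc n hn => ?_⟩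
  have hn0 : (0 : ℝ) < n := by exact_mod_cast hn
  have hcN : (N : ℝ) + 1 ≤ c := (le_max_left _ _).trans hc
  have hc0 : 0 ≤ c := le_trans (by positivity) hcN
  rcases le_or_gt N n with h | h
  · refine ofReal_one_sub_le_innerProb (hN n h) (by positivity) ((hG n hn).trans ?_)
    exact ENNReal.ofReal_le_ofReal
      (mul_le_mul_of_nonneg_right ((le_max_right _ _).trans hc) (by positivity))
  · rw [ENNReal.ofReal_eq_zero.2]
    · exact zero_le
    · rw [sub_nonpos, ← div_eq_mul_inv, le_div_iff₀ hn0]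
      have : (n : ℝ) ≤ N := by exact_mod_cast h.le
      linarith

namespace Model

variable {𝒳 𝒴 Ω : Type*} [NormedAddCommGroup 𝒳] [InnerProductSpace ℝ 𝒳] [CompleteSpace 𝒳]
  [SecondCountableTopology 𝒳] [MeasurableSpace 𝒳] [BorelSpace 𝒳]
  [NormedAddCommGroup 𝒴] [InnerProductSpace ℝ 𝒴] [CompleteSpace 𝒴]
  [SecondCountableTopology 𝒴] [MeasurableSpace 𝒴] [BorelSpace 𝒴]
  [MeasurableSpace Ω] {P : Measure Ω} [IsProbabilityMeasure P] {D : Model 𝒳 𝒴 Ω}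

theorem card_pos_eq_p (D : Model 𝒳 𝒴 Ω) : Fintype.card D.Pos = D.p := by
  simp [p]

/-- Quantile bounds when the sample standard deviations are moderate on a small set `J` of
positions, and small on all other positions. -/
theorem abs_quantile_le_of_sdHat_le_on (D : Model 𝒳 𝒴 Ω) {n : ℕ} {f : D.Bases} {ω : Ω}
    {τ t r v₁ v₂ : ℝ} (ht : 0 ≤ t) (hv₁ : 0 < v₁) (hv₂ : 0 < v₂) (J : Finset D.Pos)
    (h₁ : ∀ j ∈ J, D.sdHat n f ω j ^ (1 - τ) ≤ v₁) (h₂ : ∀ j ∉ J, D.sdHat n f ω j ^ (1 - τ) ≤ v₂)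
    (hsum : J.card * (2 * Real.exp (-t ^ 2 / (2 * v₁ ^ 2))) +
      D.p * (2 * Real.exp (-t ^ 2 / (2 * v₂ ^ 2))) < min r (1 - r)) :
    |D.qM τ n f ω r| ≤ t ∧ |D.qL τ n f ω r| ≤ t := by
  classical
  set v : D.Pos → ℝ := fun j => if j ∈ J then v₁ else v₂ with hv
  have hle : ∑ j, 2 * Real.exp (-t ^ 2 / (2 * v j ^ 2)) ≤
      J.card * (2 * Real.exp (-t ^ 2 / (2 * v₁ ^ 2))) +
      D.p * (2 * Real.exp (-t ^ 2 / (2 * v₂ ^ 2))) := by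
    rw [← Finset.sum_filter_add_sum_filter_not Finset.univ (fun j => j ∈ J)]
    gcongr
    · rw [Finset.sum_congr rfl fun j hj => show 2 * Real.exp (-t ^ 2 / (2 * v j ^ 2)) =
        2 * Real.exp (-t ^ 2 / (2 * v₁ ^ 2)) by simp [hv, (Finset.mem_filter.1 hj).2],
        Finset.sum_const, nsmul_eq_mul, Finset.filter_univ_mem]
    · rw [Finset.sum_congr rfl fun j hj => show 2 * Real.exp (-t ^ 2 / (2 * v j ^ 2)) =
        2 * Real.exp (-t ^ 2 / (2 * v₂ ^ 2)) by simp [hv, (Finset.mem_filter.1 hj).2],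
        Finset.sum_const, nsmul_eq_mul]
      gcongr
      rw [← D.card_pos_eq_p]
      exact Finset.card_le_univ _
  refine D.abs_quantile_le_of_sdHat_le ht (v := v) (fun j => ?_) (fun j => ?_)
    (hle.trans_lt (hsum.trans_le (min_le_left _ _)))
    (hle.trans (hsum.le.trans (min_le_right _ _)))
  · simp only [hv]; split_ifs <;> assumption
  · simp only [hv]
    split_ifs with h
    · exact h₁ j h
    · exact h₂ j h

/-- A coordinate with a large sample mean leads to rejection, through the upper or the lower
statistic depending on the sign. -/
theorem rejects_of_abs_Vbar (D : Model 𝒳 𝒴 Ω) {n : ℕ} {f : D.Bases} {ω : Ω} {τ ϱ m B t : ℝ}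
    (j : D.Pos) (hm : 0 < m) (hV : m ≤ √n * |D.Vbar n f ω j|) (hB : D.sdHat n f ω j ^ τ ≤ B)
    (ht : t < m / B) (hM : |D.qM τ n f ω (1 - ϱ / 2)| ≤ t) (hL : |D.qL τ n f ω (ϱ / 2)| ≤ t) :
    D.Rejects τ n f ϱ ω := by
  have hs : 0 ≤ D.sdHat n f ω j ^ τ := Real.rpow_nonneg (Real.sqrt_nonneg _) _
  rcases le_total 0 (D.Vbar n f ω j) with h | h
  · left
    rw [abs_of_nonneg h] at hV
    refine lt_of_lt_of_le ?_ (le_iSup (fun j => exDiv (√n * D.Vbar n f ω j)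
      (D.sdHat n f ω j ^ τ)) j)
    refine lt_of_lt_of_le ?_ (le_exDiv hm hV hs hB)
    exact EReal.coe_lt_coe_iff.2 (((le_abs_self _).trans hM).trans_lt ht)
  · right
    rw [abs_of_nonpos h, mul_neg] at hV
    refine lt_of_le_of_lt (iInf_le (fun j => exDiv (√n * D.Vbar n f ω j)
      (D.sdHat n f ω j ^ τ)) j) ?_
    refine lt_of_le_of_lt (exDiv_le hm (by linarith) hs hB) ?_
    exact EReal.coe_lt_coe_iff.2 (by linarith [neg_abs_le (D.qL τ n f ω (ϱ / 2))])

/-- The event on which the sample second moment of `‖X‖ ‖Y‖` is bounded and no sample variance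
exceeds its population counterpart by more than `ε`, for the eigenelements. -/
def varianceEvent (D : Model 𝒳 𝒴 Ω) (P : Measure Ω) (n : ℕ) (M ε : ℝ) : Set Ω :=
  {ω | (n : ℝ)⁻¹ * ∑ i ∈ Finset.range n, ‖D.X i ω‖ ^ 2 * ‖D.Y i ω‖ ^ 2 ≤ M ∧
    ∀ j, D.sigmaHat n D.eigenBases ω j j ≤ D.sd P D.eigenBases j ^ 2 + ε}

/-- The event on which all sample means `⟪X, u⟫ ⟪Y, v⟫` over unit vectors are within `ε` of their
expectations. -/
def meanEvent (D : Model 𝒳 𝒴 Ω) (P : Measure Ω) (n : ℕ) (ε : ℝ) : Set Ω :=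
  {ω | ∀ u v, ‖u‖ = 1 → ‖v‖ = 1 →
    |(n : ℝ)⁻¹ * ∑ i ∈ Finset.range n, D.score u v i ω - D.crossCov P u v| ≤ ε}

/-- On the variance event, the sample variances for any pair in the class. -/
theorem sigmaHat_le_of_mem_varianceEvent {n : ℕ} (hn : 1 ≤ n) {M ε r : ℝ} (hr0 : 0 ≤ r)
    (hr : r < 1) {f : D.Bases} (hf : f ∈ D.classF r) {ω : Ω} (hω : ω ∈ D.varianceEvent P n M ε)
    (j : D.Pos) : D.sigmaHat n f ω j j ≤ 2 * D.sd P D.eigenBases j ^ 2 + 2 * ε + 16 * r * M := by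
  refine (D.sigmaHat_le_eigenBases hn hr hf ω j).trans ?_
  have h1 := hω.2 j
  have h2 : 16 * r * ((n : ℝ)⁻¹ * ∑ i ∈ Finset.range n, ‖D.X i ω‖ ^ 2 * ‖D.Y i ω‖ ^ 2) ≤
      16 * r * M := mul_le_mul_of_nonneg_left hω.1 (by positivity)
  linarith

theorem sdHat_sq {n : ℕ} (f : D.Bases) (ω : Ω) (j : D.Pos) :
    D.sdHat n f ω j ^ 2 = D.sigmaHat n f ω j j :=
  Real.sq_sqrt ((D.posSemidef_sigmaHat n f ω).diag_nonneg)

theorem sdHat_nonneg {n : ℕ} (f : D.Bases) (ω : Ω) (j : D.Pos) : 0 ≤ D.sdHat n f ω j :=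
  Real.sqrt_nonneg _

namespace Regular

variable {α₁ α₂ K c C : ℝ}

/-- The constant that bounds the moments of `‖X‖² ‖Y‖²`. -/
noncomputable def momentConst (α₁ α₂ K C : ℝ) : ℝ :=
  128 * K ^ 6 * ((C * ∑' k : ℕ, ((k : ℝ) + 1) ^ (-α₁)) * (C * ∑' k : ℕ, ((k : ℝ) + 1) ^ (-α₂)))

theorem momentConst_nonneg (α₁ α₂ K : ℝ) (hC : 0 ≤ C) : 0 ≤ momentConst α₁ α₂ K C := by
  unfold momentConst
  have h : ∀ α : ℝ, 0 ≤ ∑' k : ℕ, ((k : ℝ) + 1) ^ (-α) := fun α =>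
    tsum_nonneg fun k => by positivity
  have := h α₁
  have := h α₂
  positivity

theorem moments (h : D.Regular P α₁ α₂ K c C) (hK : 0 < K) (hC : 0 ≤ C) (hα₁ : 1 < α₁)
    (hα₂ : 1 < α₂) : MemLp (fun ω => ‖D.X 0 ω‖ ^ 2 * ‖D.Y 0 ω‖ ^ 2) 2 P ∧
      ∫ ω, (‖D.X 0 ω‖ ^ 2 * ‖D.Y 0 ω‖ ^ 2) ^ 2 ∂P ≤ momentConst α₁ α₂ K C ^ 2 ∧
      ∫ ω, ‖D.X 0 ω‖ ^ 2 * ‖D.Y 0 ω‖ ^ 2 ∂P ≤ momentConst α₁ α₂ K C := by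
  have hL : ∀ α : ℝ, 0 ≤ C * ∑' k : ℕ, ((k : ℝ) + 1) ^ (-α) := fun α =>
    mul_nonneg hC (tsum_nonneg fun k => by positivity)
  obtain ⟨h1, h2⟩ := h.flm.integral_norm_sq_mul_norm_sq_sq_le hK h.tail (hL α₁) (hL α₂)
    (h.tsum_lam_le hC hα₁) (h.tsum_rho_le hC hα₂)
  refine ⟨h1, h2, ?_⟩
  have h3 := sq_integral_mul_le h1 (memLp_const (1 : ℝ))
  simp only [mul_one, one_pow, integral_const, probReal_univ, smul_eq_mul] at h3
  exact abs_le_of_sq_le_sq' (h3.trans h2) (momentConst_nonneg α₁ α₂ K hC) |>.2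

theorem measure_compl_varianceEvent_le (h : D.Regular P α₁ α₂ K c C) (hK : 0 < K) (hC : 0 ≤ C)
    (hα₁ : 1 < α₁) (hα₂ : 1 < α₂) {n : ℕ} (hn : 1 ≤ n) {ε : ℝ} (hε : 0 < ε) :
    P (D.varianceEvent P n (momentConst α₁ α₂ K C + 1) ε)ᶜ ≤ ENNReal.ofReal
      ((momentConst α₁ α₂ K C ^ 2 + 16 * momentConst α₁ α₂ K C ^ 2 / ε ^ 2) * (n : ℝ)⁻¹) := by
  have hL : ∀ α : ℝ, 0 ≤ C * ∑' k : ℕ, ((k : ℝ) + 1) ^ (-α) := fun α =>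
    mul_nonneg hC (tsum_nonneg fun k => by positivity)
  obtain ⟨h1, h2, h3⟩ := h.moments hK hC hα₁ hα₂
  have h4 := h.flm.measure_norm_mean_le h1 h3 h2 hn
  have h5 := h.flm.measure_exists_sigmaHat_gt_le hK h.tail (hL α₁) (hL α₂)
    (h.tsum_lam_le hC hα₁) (h.tsum_rho_le hC hα₂) hn hε
  rw [add_mul, ENNReal.ofReal_add (by positivity) (by positivity)]
  refine le_trans (measure_mono fun ω hω => ?_) ((measure_union_le _ _).trans (add_le_add h4 h5))
  simp only [varianceEvent, Set.mem_compl_iff, Set.mem_ofPred_eq, not_and_or, not_le,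
    not_forall] at hω
  exact hω

theorem measure_compl_meanEvent_le (h : D.Regular P α₁ α₂ K c C) (hK : 0 < K) (hC : 0 ≤ C)
    (hα₁ : 1 < α₁) (hα₂ : 1 < α₂) {n : ℕ} (hn : 1 ≤ n) {ε : ℝ} (hε : 0 < ε) :
    P (D.meanEvent P n ε)ᶜ ≤
      ENNReal.ofReal (momentConst α₁ α₂ K C / ε ^ 2 * (n : ℝ)⁻¹) := by
  obtain ⟨h1, h2, h3⟩ := h.moments hK hC hα₁ hα₂
  refine le_trans (measure_mono fun ω hω => ?_)
    (h.flm.measure_exists_mean_score_gt_le hK h.tail h1 h3 hn hε)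
  simp only [meanEvent, Set.mem_compl_iff, Set.mem_ofPred_eq, not_le, not_forall] at hω
  obtain ⟨u, v, hu, hv, h⟩ := hω
  exact ⟨u, v, hu, hv, h⟩

theorem sd_eigenBases_sq_le (h : D.Regular P α₁ α₂ K c C) (hK : 0 < K) (hC : 0 ≤ C) (j : D.Pos) :
    D.sd P D.eigenBases j ^ 2 ≤ 64 * K ^ 4 * C ^ 2 *
      ((((j.1 : ℕ) : ℝ) + 1) ^ (-α₁) * (((j.2 : ℕ) : ℝ) + 1) ^ (-α₂)) := by
  have h1 : D.lam (Idx.ofFin D.p₁_le j.1) ≤ C * (((j.1 : ℕ) : ℝ) + 1) ^ (-α₁) := h.lam_le _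
  have h2 : D.rho (Idx.ofFin D.p₂_le j.2) ≤ C * (((j.2 : ℕ) : ℝ) + 1) ^ (-α₂) := h.rho_le _
  calc _ ≤ _ := h.flm.sd_eigenBases_sq_le hK h.tail j
    _ ≤ 64 * K ^ 4 * ((C * (((j.1 : ℕ) : ℝ) + 1) ^ (-α₁)) *
        (C * (((j.2 : ℕ) : ℝ) + 1) ^ (-α₂))) := by
      refine mul_le_mul_of_nonneg_left ?_ (by positivity)
      exact mul_le_mul h1 h2 (h.flm.rho_pos _).le (by positivity)
    _ = _ := by ring

theorem sd_eigenBases_sq_le_const (h : D.Regular P α₁ α₂ K c C) (hK : 0 < K) (hC : 0 ≤ C)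
    (hα₁ : 0 ≤ α₁) (hα₂ : 0 ≤ α₂) (j : D.Pos) :
    D.sd P D.eigenBases j ^ 2 ≤ 64 * K ^ 4 * C ^ 2 := by
  refine (h.sd_eigenBases_sq_le hK hC j).trans (mul_le_of_le_one_right (by positivity) ?_)
  exact mul_le_one₀ (succ_rpow_le_one hα₁ _) (by positivity) (succ_rpow_le_one hα₂ _)

end Regular
end Model
end FLMTest

/-! ### Eigenvalue tails, largest variance and signal along the sequence of models -/

namespace FLMTest

variable {𝒳 𝒴 Ω : ℕ → Type*}
  [∀ n, NormedAddCommGroup (𝒳 n)] [∀ n, InnerProductSpace ℝ (𝒳 n)] [∀ n, CompleteSpace (𝒳 n)]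
  [∀ n, SecondCountableTopology (𝒳 n)] [∀ n, MeasurableSpace (𝒳 n)] [∀ n, BorelSpace (𝒳 n)]
  [∀ n, NormedAddCommGroup (𝒴 n)] [∀ n, InnerProductSpace ℝ (𝒴 n)] [∀ n, CompleteSpace (𝒴 n)]
  [∀ n, SecondCountableTopology (𝒴 n)] [∀ n, MeasurableSpace (𝒴 n)] [∀ n, BorelSpace (𝒴 n)]
  [∀ n, MeasurableSpace (Ω n)] {P : ∀ n, Measure (Ω n)} [∀ n, IsProbabilityMeasure (P n)]
  {D : ∀ n, Model (𝒳 n) (𝒴 n) (Ω n)} {e : Consts} {α₁ α₂ K c C : ℝ}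

theorem exists_regular (hD : ∀ n, (D n).IsFLM (P n)) (htail : TailAssumption P D)
    (hstruct : StructuralAssumption P D e) : ∃ K c C : ℝ, 0 < K ∧ 0 < c ∧ 0 < C ∧
      ∀ n, (D n).Regular (P n) e.α₁ e.α₂ K c C := by
  obtain ⟨K, hK, hT⟩ := htail
  obtain ⟨c₁, C₁, hc₁, hC₁, h₁⟩ := hstruct.lam_decay
  obtain ⟨c₂, C₂, hc₂, hC₂, h₂⟩ := hstruct.rho_decay
  obtain ⟨C₃, hC₃, h₃⟩ := hstruct.alignment
  refine ⟨K, min c₁ c₂, max (max C₁ C₂) C₃, hK, lt_min hc₁ hc₂, lt_max_of_lt_right hC₃,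
    fun n => ⟨hD n, hT n, fun j => ?_, fun j => ?_, fun j => ?_, fun j => ?_, fun i j => ?_⟩⟩
  · refine le_trans ?_ (h₁ n j).1
    gcongr
    exact min_le_left _ _
  · refine (h₁ n j).2.trans ?_
    gcongr
    exact (le_max_left _ _).trans (le_max_left _ _)
  · refine le_trans ?_ (h₂ n j).1
    gcongr
    exact min_le_right _ _
  · refine (h₂ n j).2.trans ?_
    gcongr
    exact (le_max_right _ _).trans (le_max_left _ _)
  · have hbdd : BddAbove (Set.range fun i => (D n).b i j ^ 2) := by
      refine ⟨‖(D n).β‖ ^ 2, ?_⟩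
      rintro _ ⟨i, rfl⟩
      simp only [Model.b]
      rw [← sq_abs]
      gcongr
      refine (abs_real_inner_le_norm _ _).trans ?_
      rw [(D n).ψ.orthonormal.1, mul_one]
      refine ((D n).β.le_opNorm _).trans ?_
      rw [(D n).φ.orthonormal.1, mul_one]
    refine (le_ciSup hbdd i).trans ((h₃ n j).trans ?_)
    have := (hD n).rho_pos j
    gcongr
    exact le_max_right _ _

/-- The omitted eigenvalues of the covariance operator of `X` are `o(a_n)`. If nothing is omitted,
the claim is empty. -/
theorem eventually_lam_le_rate (hR : ∀ n, (D n).Regular (P n) e.α₁ e.α₂ K c C) (hK : 0 < K)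
    (hC : 0 < C) (hα₁ : 2 < e.α₁) (hα₂ : 2 < e.α₂) (hδ : 0 < e.δ)
    (hα₀ : e.α₀ ∈ Set.Ioo (0 : ℝ) 1) (hg : GrowthAssumption D e)
    (hp : Tendsto (fun n => (D n).p) atTop atTop) {ε : ℝ} (hε : 0 < ε) :
    ∀ᶠ n in atTop, ∀ i : Idx (D n).dX, (D n).p₁ ≤ (i : ℕ) →
      (D n).lam i ≤ ε * e.rate n (D n).p := by
  obtain ⟨c', hc', hlow⟩ := hg.p₁_lower
  filter_upwards [Consts.eventually_rpow_le_rate (e := e) (p := fun n => (D n).p) hδ hp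
    (α := e.α₁) (C := C) (M := 192 * K ^ 2 * (8 * K ^ 2) ^ 6) (lt_min (by linarith) (by linarith))
    (min_le_left _ _) (lt_max_of_lt_left (by linarith)) hα₀ hc' hC (by positivity)
    (q := fun n => (D n).p₁) (q' := fun n => (D n).p₂) (fun n => rfl)
    (fun n => (hR n).flm.min_p_le hK (hR n).tail) hlow hε] with n h i hi
  have hlt : ((D n).p₁ : ℕ∞) < (D n).dX := lt_of_le_of_lt (by exact_mod_cast hi) i.2
  refine ((hR n).lam_le i).trans (le_trans ?_ (h hlt))
  refine mul_le_mul_of_nonneg_left ?_ hC.le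
  refine Real.rpow_le_rpow_of_nonpos (by positivity) ?_ (by linarith)
  have : ((D n).p₁ : ℝ) ≤ (i : ℕ) := by exact_mod_cast hi
  linarith

/-- The omitted eigenvalues of the covariance operator of `Y` are `o(a_n)`. -/
theorem eventually_rho_le_rate (hR : ∀ n, (D n).Regular (P n) e.α₁ e.α₂ K c C) (hK : 0 < K)
    (hC : 0 < C) (hα₁ : 2 < e.α₁) (hα₂ : 2 < e.α₂) (hδ : 0 < e.δ)
    (hα₀ : e.α₀ ∈ Set.Ioo (0 : ℝ) 1) (hg : GrowthAssumption D e)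
    (hp : Tendsto (fun n => (D n).p) atTop atTop) {ε : ℝ} (hε : 0 < ε) :
    ∀ᶠ n in atTop, ∀ i : Idx (D n).dY, (D n).p₂ ≤ (i : ℕ) →
      (D n).rho i ≤ ε * e.rate n (D n).p := by
  obtain ⟨c', hc', hlow⟩ := hg.p₂_lower
  filter_upwards [Consts.eventually_rpow_le_rate (e := e) (p := fun n => (D n).p) hδ hp
    (α := e.α₂) (C := C) (M := 192 * K ^ 2 * (8 * K ^ 2) ^ 6) (lt_min (by linarith) (by linarith))
    (min_le_right _ _) (lt_max_of_lt_left (by linarith)) hα₀ hc' hC (by positivity)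
    (q := fun n => (D n).p₂) (q' := fun n => (D n).p₁) (fun n => mul_comm _ _)
    (fun n => by rw [min_comm]; exact (hR n).flm.min_p_le hK (hR n).tail) hlow hε] with n h i hi
  have hlt : ((D n).p₂ : ℕ∞) < (D n).dY := lt_of_le_of_lt (by exact_mod_cast hi) i.2
  refine ((hR n).rho_le i).trans (le_trans ?_ (h hlt))
  refine mul_le_mul_of_nonneg_left ?_ hC.le
  refine Real.rpow_le_rpow_of_nonpos (by positivity) ?_ (by linarith)
  have : ((D n).p₂ : ℝ) ≤ (i : ℕ) := by exact_mod_cast hi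
  linarith

/-- The largest variance stays away from zero. -/
theorem exists_eventually_le_sd_sq (hR : ∀ n, (D n).Regular (P n) e.α₁ e.α₂ K c C) (hK : 0 < K)
    (hc : 0 < c) (hC : 0 < C) (hα₁ : 2 < e.α₁) (hα₂ : 2 < e.α₂) (hδ : 0 < e.δ)
    (hg : GrowthAssumption D e) (hp : Tendsto (fun n => (D n).p) atTop atTop) :
    ∃ v : ℝ, 0 < v ∧ ∀ᶠ n in atTop, ∃ j, v ≤ (D n).sd (P n) (D n).eigenBases j ^ 2 := by
  have hN : ∀ᶠ N in atTop, ∑' k : ℕ, C * (((k + N : ℕ) : ℝ) + 1) ^ (-e.α₁) * C < 1 / 4 :=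
    (tendsto_sum_nat_add fun k : ℕ => C * ((k : ℝ) + 1) ^ (-e.α₁) * C).eventually_lt_const
      (by norm_num)
  obtain ⟨N, hN1, hN0⟩ := (hN.and (eventually_gt_atTop 0)).exists
  have hN0' : (0 : ℝ) < N := by exact_mod_cast hN0
  refine ⟨c * (N : ℝ) ^ (-e.α₁) * c / (8 * N * K ^ 2), by positivity, ?_⟩
  obtain ⟨c', hc', hlow⟩ := hg.p₁_lower
  have hlo : 0 < e.αlo - 1 := by
    have : 2 < e.αlo := lt_min hα₁ hα₂
    linarith
  have hhi : 0 < e.αhi := lt_max_of_lt_left (by linarith)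
  have hinf : Tendsto (fun n => c' * (e.k n (D n).p : ℝ) ^ (e.αhi / (e.αlo - 1))) atTop atTop :=
    ((tendsto_rpow_atTop (div_pos hhi hlo)).comp (Consts.tendsto_k hδ hp)).const_mul_atTop hc'
  filter_upwards [hlow, hinf.eventually_ge_atTop (N : ℝ)] with n h1 h2
  refine (hR n).exists_le_sd_sq hK hc hC (by linarith) hN0 hN1 ?_
  rcases (D n).p₁_le.lt_or_eq with h | h
  · exact Or.inl (by exact_mod_cast h2.trans (h1 h))
  · exact Or.inr h

/-- For a pair in the class, some coordinate has a mean of at least half the signal strength. -/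
theorem eventually_signal_le (hR : ∀ n, (D n).Regular (P n) e.α₁ e.α₂ K c C) (hK : 0 < K)
    (hC : 0 < C) (hα₁ : 2 < e.α₁) (hα₂ : 2 < e.α₂) (hδ : 0 < e.δ)
    (hα₀ : e.α₀ ∈ Set.Ioo (0 : ℝ) 1) (hg : GrowthAssumption D e)
    (hp : Tendsto (fun n => (D n).p) atTop atTop) {CF : ℝ} (hCF : 0 < CF) {s : ℝ} (hs : 0 < s)
    (hsig : ∀ᶠ n in atTop, s * e.rate n (D n).p ≤ (D n).signal) :
    ∀ᶠ n in atTop, ∀ f ∈ (D n).classF (CF * e.rate n (D n).p),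
      ∃ j : (D n).Pos, (D n).signal / 2 ≤ |(D n).crossCov (P n) (f.1 j.1) (f.2 j.2)| := by
  obtain ⟨F, hF⟩ := summable_iff_vanishing_norm.1
    (Model.Regular.summable_weight C hα₁ hα₂) (s / (8 * CF)) (by positivity)
  set ε : ℝ := (s / 24) ^ 2 / (2 * CF * C) with hε
  have hε0 : 0 < ε := by positivity
  have hrate := Consts.tendsto_rate hδ (le_max_of_le_left (by linarith)) hα₀.1 hp
  have hr : Tendsto (fun n => CF * e.rate n (D n).p) atTop (𝓝 0) := by
    simpa using hrate.const_mul CF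
  have hrN : Tendsto (fun n => CF * e.rate n (D n).p * F.card) atTop (𝓝 0) := by
    simpa using hr.mul_const (F.card : ℝ)
  filter_upwards [hsig, hr.eventually_lt_const one_pos,
    hrN.eventually_lt_const (show (0 : ℝ) < 1 / 4 by norm_num),
    eventually_lam_le_rate hR hK hC hα₁ hα₂ hδ hα₀ hg hp hε0,
    eventually_rho_le_rate hR hK hC hα₁ hα₂ hδ hα₀ hg hp hε0] with n h1 h2 h3 h4 h5 f hf
  have ha := Consts.rate_nonneg (e := e) n (D n).p
  set a := e.rate n (D n).p
  obtain ⟨j, hj⟩ := exists_eq_ciSup_of_finite (f := fun j => |(D n).μ j|)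
  refine ⟨j, ?_⟩
  have hj' : |(D n).μ j| = (D n).signal := hj
  have key := (hR n).flm.abs_μ_sub_le_abs_crossCov (by positivity) h2 hf j
    (εX := ε * a) (εY := ε * a) (LX := C) (LY := C) (by positivity) (by positivity) h4 h5
    ((hR n).lam_le_const hC.le (by linarith)) ((hR n).rho_le_const hC.le (by linarith))
  have e1 : ε * a * (2 * (CF * a)) * C = (s / 24 * a) ^ 2 := by
    rw [hε]; field_simp
  have e2 : C * (ε * a * (2 * (CF * a))) = (s / 24 * a) ^ 2 := by rw [← e1]; ring
  rw [e1, e2, Real.sqrt_sq (by positivity), hj'] at key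
  have h6 := (hR n).sum_abs_μ_le hC.le hF
  have h7 : CF * a * ∑ k, |(D n).μ k| ≤ 1 / 4 * (D n).signal + s / 8 * a := by
    calc _ ≤ CF * a * (F.card * (D n).signal + s / (8 * CF)) := by gcongr
      _ = CF * a * F.card * (D n).signal + s / 8 * a := by field_simp
      _ ≤ _ := by
        have := Model.signal_nonneg (D n)
        gcongr
  have h8 : 0 ≤ s * a := by positivity
  linarith

end FLMTest

/-! ### Bootstrap quantiles and the variance ratio -/

namespace FLMTest

open Model.Regular (momentConst momentConst_nonneg)

variable {𝒳 𝒴 Ω : ℕ → Type*}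
  [∀ n, NormedAddCommGroup (𝒳 n)] [∀ n, InnerProductSpace ℝ (𝒳 n)] [∀ n, CompleteSpace (𝒳 n)]
  [∀ n, SecondCountableTopology (𝒳 n)] [∀ n, MeasurableSpace (𝒳 n)] [∀ n, BorelSpace (𝒳 n)]
  [∀ n, NormedAddCommGroup (𝒴 n)] [∀ n, InnerProductSpace ℝ (𝒴 n)] [∀ n, CompleteSpace (𝒴 n)]
  [∀ n, SecondCountableTopology (𝒴 n)] [∀ n, MeasurableSpace (𝒴 n)] [∀ n, BorelSpace (𝒴 n)]
  [∀ n, MeasurableSpace (Ω n)] {P : ∀ n, Measure (Ω n)} [∀ n, IsProbabilityMeasure (P n)]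
  {D : ∀ n, Model (𝒳 n) (𝒴 n) (Ω n)} {α₁ α₂ K c C τ : ℝ} {r : ℕ → ℝ}

theorem tendsto_sqrt_log : Tendsto (fun n : ℕ => √(Real.log n)) atTop atTop :=
  Real.tendsto_sqrt_atTop.comp (Real.tendsto_log_atTop.comp tendsto_natCast_atTop_atTop)

theorem exp_neg_two_mul_log {n : ℕ} (hn : 1 ≤ n) :
    Real.exp (-(2 * Real.log n)) = ((n : ℝ) ^ 2)⁻¹ := by
  have hn0 : (0 : ℝ) < n := by exact_mod_cast hn
  rw [Real.exp_neg, mul_comm, Real.exp_mul, Real.exp_log hn0]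
  norm_num

/-- A common bound for the sample variances. -/
theorem eventually_sdHat_sq_le (hR : ∀ n, (D n).Regular (P n) α₁ α₂ K c C) (hK : 0 < K)
    (hC : 0 < C) (hα₁ : 2 < α₁) (hα₂ : 2 < α₂) (hr0 : ∀ n, 0 ≤ r n) (hr : Tendsto r atTop (𝓝 0))
    {ε : ℝ} (hε : ε ≤ 1) :
    ∃ S : ℝ, 0 < S ∧ ∀ᶠ n in atTop, ∀ ω ∈ (D n).varianceEvent (P n) n (momentConst α₁ α₂ K C + 1) ε,
      ∀ f ∈ (D n).classF (r n), ∀ j, (D n).sdHat n f ω j ≤ S := by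
  have hM := momentConst_nonneg α₁ α₂ K hC.le
  set T : ℝ := 2 * (64 * K ^ 4 * C ^ 2) + 2 + 16 * (momentConst α₁ α₂ K C + 1) with hT
  have hT0 : 0 < T := by positivity
  refine ⟨√T, Real.sqrt_pos.2 hT0, ?_⟩
  filter_upwards [hr.eventually_lt_const one_pos, eventually_ge_atTop 1] with n h1 hn ω hω f hf j
  refine Real.sqrt_le_sqrt ?_
  refine (Model.sigmaHat_le_of_mem_varianceEvent hn (hr0 n) h1 hf hω j).trans ?_
  have h2 := (hR n).sd_eigenBases_sq_le_const hK hC.le (by linarith) (by linarith) j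
  have h3 : r n * (momentConst α₁ α₂ K C + 1) ≤ 1 * (momentConst α₁ α₂ K C + 1) := by
    gcongr
  rw [hT]
  linarith

/-- The bootstrap quantiles are `O(√(log n))`: at this level each of the `p ≤ n` coordinates
contributes at most `2 / n²` to the union bound. -/
theorem eventually_abs_qM_le (hR : ∀ n, (D n).Regular (P n) α₁ α₂ K c C) (hK : 0 < K)
    (hC : 0 < C) (hα₁ : 2 < α₁) (hα₂ : 2 < α₂) (hr0 : ∀ n, 0 ≤ r n) (hr : Tendsto r atTop (𝓝 0))
    (hτ : τ < 1) (hpn : ∀ᶠ n in atTop, (D n).p ≤ n) {ϱ : ℝ} (hϱ : ϱ ∈ Set.Ioo (0 : ℝ) 1) :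
    ∃ t : ℝ, 0 < t ∧ ∀ᶠ n in atTop,
      ∀ ω ∈ (D n).varianceEvent (P n) n (momentConst α₁ α₂ K C + 1) 1,
      ∀ f ∈ (D n).classF (r n), |(D n).qM τ n f ω ϱ| ≤ t * √(Real.log n) := by
  obtain ⟨S, hS, hev⟩ := eventually_sdHat_sq_le hR hK hC hα₁ hα₂ hr0 hr le_rfl
  set v := S ^ (1 - τ) with hv
  have hv0 : 0 < v := Real.rpow_pos_of_pos hS _
  have hlim : Tendsto (fun n : ℕ => 2 * (n : ℝ)⁻¹) atTop (𝓝 (2 * 0)) :=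
    tendsto_inv_atTop_nhds_zero_nat.const_mul 2
  rw [mul_zero] at hlim
  refine ⟨2 * v, by positivity, ?_⟩
  filter_upwards [hev, hpn, eventually_ge_atTop 1,
    hlim.eventually_lt_const (lt_min hϱ.1 (sub_pos.2 hϱ.2))] with n h1 h2 hn h3 ω hω f hf
  have hn0 : (0 : ℝ) < n := by exact_mod_cast hn
  have hl : 0 ≤ Real.log n := Real.log_nonneg (by exact_mod_cast hn)
  have hsd : ∀ j, (D n).sdHat n f ω j ^ (1 - τ) ≤ v := fun j =>
    Real.rpow_le_rpow (Model.sdHat_nonneg f ω j) (h1 ω hω f hf j) (by linarith)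
  refine ((D n).abs_quantile_le_of_sdHat_le_on (by positivity) hv0 hv0 ∅ (by simp)
    (fun j _ => hsd j) (lt_of_le_of_lt ?_ h3)).1
  have e1 : -(2 * v * √(Real.log n)) ^ 2 / (2 * v ^ 2) = -(2 * Real.log n) := by
    rw [mul_pow, Real.sq_sqrt hl]
    field_simp
  rw [e1, exp_neg_two_mul_log hn]
  have h4 : ((D n).p : ℝ) ≤ n := by exact_mod_cast h2
  calc _ = ((D n).p : ℝ) * (2 * ((n : ℝ) ^ 2)⁻¹) := by simp
    _ ≤ n * (2 * ((n : ℝ) ^ 2)⁻¹) := by gcongr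
    _ = 2 * (n : ℝ)⁻¹ := by field_simp

/-- The bootstrap quantiles are `o(√(log n))`, since only a bounded number of the sample standard
deviations is not small. -/
theorem eventually_abs_quantile_le (hR : ∀ n, (D n).Regular (P n) α₁ α₂ K c C) (hK : 0 < K)
    (hC : 0 < C) (hα₁ : 2 < α₁) (hα₂ : 2 < α₂) (hr0 : ∀ n, 0 ≤ r n) (hr : Tendsto r atTop (𝓝 0))
    (hτ : τ < 1) (hpn : ∀ᶠ n in atTop, (D n).p ≤ n) {t : ℝ} (ht : 0 < t) :
    ∃ ε : ℝ, 0 < ε ∧ ε ≤ 1 ∧ ∀ ϱ ∈ Set.Ioo (0 : ℝ) 1, ∀ᶠ n in atTop,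
      ∀ ω ∈ (D n).varianceEvent (P n) n (momentConst α₁ α₂ K C + 1) ε,
      ∀ f ∈ (D n).classF (r n), |(D n).qM τ n f ω ϱ| ≤ t * √(Real.log n) ∧
        |(D n).qL τ n f ω ϱ| ≤ t * √(Real.log n) := by
  have hτ' : 0 < 1 - τ := by linarith
  have hM := momentConst_nonneg α₁ α₂ K hC.le
  -- A standard deviation of at most `s` has a power of at most `t / 2`.
  set s : ℝ := (t / 2) ^ (1 - τ)⁻¹ with hs
  have hs0 : 0 < s := Real.rpow_pos_of_pos (by positivity) _
  have hst : s ^ (1 - τ) = t / 2 := by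
    rw [hs, ← Real.rpow_mul (by positivity), inv_mul_cancel₀ hτ'.ne', Real.rpow_one]
  set ε : ℝ := min (s ^ 2 / 8) 1 with hε
  have hε0 : 0 < ε := lt_min (by positivity) one_pos
  refine ⟨ε, hε0, min_le_right _ _, fun ϱ hϱ => ?_⟩
  obtain ⟨S, hS, hev⟩ := eventually_sdHat_sq_le hR hK hC hα₁ hα₂ hr0 hr
    (show ε ≤ 1 from min_le_right _ _)
  set g : ℕ × ℕ → ℝ := fun k =>
    64 * K ^ 4 * C ^ 2 * (((k.1 : ℝ) + 1) ^ (-α₁) * ((k.2 : ℝ) + 1) ^ (-α₂)) with hg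
  have hgs : Summable g := (Summable.mul_of_nonneg (f := fun k : ℕ => ((k : ℝ) + 1) ^ (-α₁))
    (g := fun k : ℕ => ((k : ℝ) + 1) ^ (-α₂)) (summable_succ_rpow (by linarith))
    (summable_succ_rpow (by linarith)) (fun _ => by positivity)
    (fun _ => by positivity)).mul_left _
  have hfin : {k | ¬ g k < s ^ 2 / 8}.Finite :=
    hgs.tendsto_cofinite_zero.eventually_lt_const (show (0 : ℝ) < s ^ 2 / 8 by positivity)
  set F := hfin.toFinset with hF
  set v := S ^ (1 - τ) with hv
  have hv0 : 0 < v := Real.rpow_pos_of_pos hS _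
  have hlim2 : Tendsto (fun n : ℕ => 2 * (n : ℝ)⁻¹) atTop (𝓝 (2 * 0)) :=
    tendsto_inv_atTop_nhds_zero_nat.const_mul 2
  have hlim1 : Tendsto (fun n : ℕ => (F.card : ℝ) * (2 * Real.exp (-(t * √(Real.log n)) ^ 2 /
      (2 * v ^ 2)))) atTop (𝓝 (F.card * (2 * 0))) := by
    refine ((Real.tendsto_exp_atBot.comp ?_).const_mul 2).const_mul _
    have h1 : Tendsto (fun n : ℕ => (t * √(Real.log n)) ^ 2 / (2 * v ^ 2)) atTop atTop :=
      ((tendsto_pow_atTop two_ne_zero).comp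
        (tendsto_sqrt_log.const_mul_atTop ht)).atTop_div_const (by positivity)
    refine (tendsto_neg_atTop_atBot.comp h1).congr fun n => ?_
    simp only [Function.comp_apply, neg_div]
  have hlim := hlim1.add hlim2
  simp only [mul_zero, add_zero] at hlim
  have hrM : Tendsto (fun n => 16 * r n * (momentConst α₁ α₂ K C + 1)) atTop (𝓝 0) := by
    simpa using (hr.const_mul 16).mul_const (momentConst α₁ α₂ K C + 1)
  filter_upwards [hev, hpn, eventually_ge_atTop 1, hr.eventually_lt_const one_pos,
    hrM.eventually_lt_const (show (0 : ℝ) < s ^ 2 / 2 by positivity),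
    hlim.eventually_lt_const (lt_min hϱ.1 (sub_pos.2 hϱ.2))] with n h1 h2 hn h3 h4 h5 ω hω f hf
  have hn0 : (0 : ℝ) < n := by exact_mod_cast hn
  have hl : 0 ≤ Real.log n := Real.log_nonneg (by exact_mod_cast hn)
  classical
  set J : Finset (D n).Pos := Finset.univ.filter fun j => ((j.1 : ℕ), (j.2 : ℕ)) ∈ F with hJ
  have hJc : J.card ≤ F.card := by
    refine Finset.card_le_card_of_injOn (fun j => ((j.1 : ℕ), (j.2 : ℕ)))
      (fun j hj => (Finset.mem_filter.1 hj).2) fun a _ b _ hab => ?_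
    simp only [Prod.mk.injEq] at hab
    exact Prod.ext (Fin.ext hab.1) (Fin.ext hab.2)
  refine (D n).abs_quantile_le_of_sdHat_le_on (by positivity) hv0
    (show 0 < t / 2 by positivity) J (fun j _ => ?_) (fun j hj => ?_) (lt_of_le_of_lt ?_ h5)
  · exact Real.rpow_le_rpow (Model.sdHat_nonneg f ω j) (h1 ω hω f hf j) hτ'.le
  · rw [← hst]
    refine Real.rpow_le_rpow (Model.sdHat_nonneg f ω j) ?_ hτ'.le
    refine abs_le_of_sq_le_sq' ?_ hs0.le |>.2
    rw [Model.sdHat_sq]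
    refine (Model.sigmaHat_le_of_mem_varianceEvent hn (hr0 n) h3 hf hω j).trans ?_
    have h6 : g ((j.1 : ℕ), (j.2 : ℕ)) < s ^ 2 / 8 := by
      by_contra hcon
      exact hj (Finset.mem_filter.2 ⟨Finset.mem_univ _, hfin.mem_toFinset.2 hcon⟩)
    have h7 : (D n).sd (P n) (D n).eigenBases j ^ 2 ≤ g ((j.1 : ℕ), (j.2 : ℕ)) :=
      (hR n).sd_eigenBases_sq_le hK hC.le j
    have h8 : ε ≤ s ^ 2 / 8 := min_le_left _ _
    linarith
  · have e1 : -(t * √(Real.log n)) ^ 2 / (2 * (t / 2) ^ 2) = -(2 * Real.log n) := by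
      rw [mul_pow, Real.sq_sqrt hl]
      field_simp
    have h6 : ((D n).p : ℝ) ≤ n := by exact_mod_cast h2
    rw [e1, exp_neg_two_mul_log hn]
    gcongr ?_ + ?_
    · gcongr
    · calc ((D n).p : ℝ) * (2 * ((n : ℝ) ^ 2)⁻¹) ≤ n * (2 * ((n : ℝ) ^ 2)⁻¹) := by gcongr
        _ = 2 * (n : ℝ)⁻¹ := by field_simp

/-- On the variance event, the sample variances are at most `4.5` times the largest population
variance. -/
theorem eventually_ratio_lt (hR : ∀ n, (D n).Regular (P n) α₁ α₂ K c C) (hK : 0 < K)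
    (hC : 0 < C) (hα₁ : 2 < α₁) (hα₂ : 2 < α₂) (hr0 : ∀ n, 0 ≤ r n) (hr : Tendsto r atTop (𝓝 0))
    {v : ℝ} (hv : 0 < v)
    (hsd : ∀ᶠ n in atTop, ∃ j, v ≤ (D n).sd (P n) (D n).eigenBases j ^ 2) :
    ∀ᶠ n in atTop, ∀ ω ∈ (D n).varianceEvent (P n) n (momentConst α₁ α₂ K C + 1) (v / 32),
      (⨆ f ∈ (D n).classF (r n), ENNReal.ofReal (⨆ j, (D n).sdHat n f ω j ^ 2) /
        ENNReal.ofReal ((D n).sdMax (P n) f ^ 2)) < 5 := by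
  set M := momentConst α₁ α₂ K C with hM
  have hM0 : 0 ≤ M := momentConst_nonneg α₁ α₂ K hC.le
  have hrM : Tendsto (fun n => r n * (48 * M + 16)) atTop (𝓝 0) := by
    simpa using hr.mul_const (48 * M + 16)
  filter_upwards [hsd, eventually_ge_atTop 1, hr.eventually_lt_const one_pos,
    hrM.eventually_lt_const (show (0 : ℝ) < v / 16 by positivity)] with n h1 hn h2 h3 ω hω
  have h45 : ENNReal.ofReal (9 / 2) < 5 := by
    rw [show (5 : ℝ≥0∞) = ENNReal.ofReal 5 by norm_num]
    exact (ENNReal.ofReal_lt_ofReal_iff (by norm_num)).2 (by norm_num)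
  refine lt_of_le_of_lt (iSup₂_le fun f hf => ?_) h45
  refine ENNReal.div_le_of_le_mul ?_
  rw [← ENNReal.ofReal_mul (by norm_num)]
  refine ENNReal.ofReal_le_ofReal (ciSup_le fun j => ?_)
  have hmom := (hR n).moments hK hC.le (by linarith) (by linarith)
  have hcmp : ∀ j, (D n).sd (P n) (D n).eigenBases j ^ 2 ≤
      2 * (D n).sdMax (P n) f ^ 2 + 16 * r n * M := fun j => by
    have h4 := (hR n).flm.sd_eigenBases_sq_le_sd_sq hK (hR n).tail hmom.1 hmom.2.2 (hr0 n) h2 hf j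
    have h5 : (D n).sd (P n) f j ^ 2 ≤ (D n).sdMax (P n) f ^ 2 :=
      pow_le_pow_left₀ (Real.sqrt_nonneg _) (Model.sd_le_sdMax _ _ _ _) 2
    linarith
  obtain ⟨j₀, hj₀⟩ := h1
  have h6 := hcmp j₀
  have h7 := hcmp j
  have h8 := Model.sigmaHat_le_of_mem_varianceEvent hn (hr0 n) h2 hf hω j
  have h9 : 0 ≤ r n * M := mul_nonneg (hr0 n) hM0
  have h10 := hr0 n
  rw [Model.sdHat_sq]
  nlinarith

end FLMTest

/-! ### Consistency of the test -/

namespace FLMTest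

open Model.Regular (momentConst momentConst_nonneg)

variable {𝒳 𝒴 Ω : ℕ → Type*}
  [∀ n, NormedAddCommGroup (𝒳 n)] [∀ n, InnerProductSpace ℝ (𝒳 n)] [∀ n, CompleteSpace (𝒳 n)]
  [∀ n, SecondCountableTopology (𝒳 n)] [∀ n, MeasurableSpace (𝒳 n)] [∀ n, BorelSpace (𝒳 n)]
  [∀ n, NormedAddCommGroup (𝒴 n)] [∀ n, InnerProductSpace ℝ (𝒴 n)] [∀ n, CompleteSpace (𝒴 n)]
  [∀ n, SecondCountableTopology (𝒴 n)] [∀ n, MeasurableSpace (𝒴 n)] [∀ n, BorelSpace (𝒴 n)]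
  [∀ n, MeasurableSpace (Ω n)] {P : ∀ n, Measure (Ω n)} [∀ n, IsProbabilityMeasure (P n)]
  {D : ∀ n, Model (𝒳 n) (𝒴 n) (Ω n)} {α₁ α₂ K c C τ : ℝ} {r : ℕ → ℝ}

/-- Consistency of the test, from a lower bound of the order `√(log n / n)` for the largest mean of
the coordinates. -/
theorem tendsto_innerProb_rejects (hR : ∀ n, (D n).Regular (P n) α₁ α₂ K c C) (hK : 0 < K)
    (hC : 0 < C) (hα₁ : 2 < α₁) (hα₂ : 2 < α₂) (hr0 : ∀ n, 0 ≤ r n) (hr : Tendsto r atTop (𝓝 0))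
    (hτ : τ ∈ Set.Ico (0 : ℝ) 1) (hpn : ∀ᶠ n in atTop, (D n).p ≤ n) {ϱ : ℝ}
    (hϱ : ϱ ∈ Set.Ioo (0 : ℝ) 1) {s : ℝ} (hs : 0 < s)
    (hmean : ∀ᶠ n : ℕ in atTop, ∀ f ∈ (D n).classF (r n), ∃ j : (D n).Pos,
      s * √(Real.log n) ≤ √n * |(D n).crossCov (P n) (f.1 j.1) (f.2 j.2)|) :
    Tendsto (fun n : ℕ => innerProb (P n)
      {ω | ∀ f ∈ (D n).classF (r n), (D n).Rejects τ n f ϱ ω}) atTop (𝓝 1) := by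
  set M := momentConst α₁ α₂ K C with hM
  have hM0 : 0 ≤ M := momentConst_nonneg α₁ α₂ K hC.le
  obtain ⟨S, hS, hev⟩ := eventually_sdHat_sq_le hR hK hC hα₁ hα₂ hr0 hr le_rfl
  set B := S ^ τ with hB
  have hB0 : 0 < B := Real.rpow_pos_of_pos hS _
  obtain ⟨ε, hε, hε1, hq⟩ := eventually_abs_quantile_le hR hK hC hα₁ hα₂ hr0 hr hτ.2 hpn
    (show 0 < s / (4 * B) by positivity)
  set d : ℕ → ℝ := fun n => √(√(Real.log n)) / √n with hd
  set a : ℕ → ℝ := fun n => (M ^ 2 + 16 * M ^ 2 / ε ^ 2) * (n : ℝ)⁻¹ + M / d n ^ 2 * (n : ℝ)⁻¹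
    with hadef
  have ha0 : ∀ n, 0 ≤ a n := fun n => by positivity
  have ha : Tendsto a atTop (𝓝 0) := by
    have h1 : Tendsto (fun n : ℕ => (M ^ 2 + 16 * M ^ 2 / ε ^ 2) * (n : ℝ)⁻¹) atTop (𝓝 0) := by
      have h := (tendsto_inv_atTop_nhds_zero_nat (𝕜 := ℝ)).const_mul
        (M ^ 2 + 16 * M ^ 2 / ε ^ 2)
      rwa [mul_zero] at h
    have h2 : Tendsto (fun n : ℕ => M * (√(Real.log n))⁻¹) atTop (𝓝 0) := by
      simpa using (tendsto_inv_atTop_zero.comp tendsto_sqrt_log).const_mul M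
    have h3 : Tendsto (fun n : ℕ => M / d n ^ 2 * (n : ℝ)⁻¹) atTop (𝓝 0) := by
      refine h2.congr' ?_
      filter_upwards [eventually_ge_atTop 1, tendsto_sqrt_log.eventually_gt_atTop 0] with n hn hl
      have hn0 : (0 : ℝ) < n := by exact_mod_cast hn
      simp only [hd]
      rw [div_pow, Real.sq_sqrt hl.le, Real.sq_sqrt hn0.le]
      field_simp
    simpa using h1.add h3
  have hlow : Tendsto (fun n => ENNReal.ofReal (1 - a n)) atTop (𝓝 1) := by
    have h := ENNReal.tendsto_ofReal (ha.const_sub 1)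
    simpa using h
  refine tendsto_of_tendsto_of_tendsto_of_le_of_le' hlow tendsto_const_nhds ?_
    (Eventually.of_forall fun n => innerProb_le_one _)
  have hsq : Tendsto (fun n : ℕ => √(√(Real.log n))) atTop atTop :=
    Real.tendsto_sqrt_atTop.comp tendsto_sqrt_log
  filter_upwards [hev, hq (1 - ϱ / 2) ⟨by linarith [hϱ.2], by linarith [hϱ.1]⟩,
    hq (ϱ / 2) ⟨by linarith [hϱ.1], by linarith [hϱ.2]⟩, hmean, eventually_ge_atTop 1,
    hsq.eventually_ge_atTop (2 / s), tendsto_sqrt_log.eventually_gt_atTop 0,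
    hsq.eventually_gt_atTop 0] with n h1 h2 h3 h4 hn h5 hl hl'
  have hn0 : (0 : ℝ) < n := by exact_mod_cast hn
  have hd0 : 0 < d n := by simp only [hd]; positivity
  refine ofReal_one_sub_le_innerProb (G := (D n).varianceEvent (P n) n (M + 1) ε ∩
    (D n).meanEvent (P n) n (d n)) ?_ (ha0 n) ?_
  · rintro ω ⟨hω, hω'⟩ f hf
    obtain ⟨j, hj⟩ := h4 f hf
    have hω1 : ω ∈ (D n).varianceEvent (P n) n (M + 1) 1 :=
      ⟨hω.1, fun j => (hω.2 j).trans (by gcongr)⟩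
    have h6 : |(D n).Vbar n f ω j - (D n).crossCov (P n) (f.1 j.1) (f.2 j.2)| ≤ d n :=
      hω' _ _ (hf.1.1 _) (hf.2.1.1 _)
    have h7 : √n * d n = √(√(Real.log n)) := by
      simp only [hd]
      field_simp
    -- The fluctuation `(log n)^{1/4}` is at most half of the mean, of the order `(log n)^{1/2}`.
    have h8 : √(√(Real.log n)) ≤ s / 2 * √(Real.log n) := by
      nth_rewrite 2 [← Real.mul_self_sqrt hl.le]
      rw [div_le_iff₀ hs] at h5
      nlinarith
    have h9 : |(D n).crossCov (P n) (f.1 j.1) (f.2 j.2)| - d n ≤ |(D n).Vbar n f ω j| := by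
      have := abs_sub_abs_le_abs_sub ((D n).crossCov (P n) (f.1 j.1) (f.2 j.2))
        ((D n).Vbar n f ω j)
      rw [abs_sub_comm] at this
      linarith
    have h10 := mul_le_mul_of_nonneg_left h9 (Real.sqrt_nonneg (n : ℝ))
    rw [mul_sub, h7] at h10
    refine (D n).rejects_of_abs_Vbar j (m := s / 2 * √(Real.log n)) (B := B)
      (t := s / (4 * B) * √(Real.log n)) (by positivity) (by linarith)
      (Real.rpow_le_rpow (Model.sdHat_nonneg f ω j) (h1 ω hω1 f hf j) hτ.1) ?_
      (h2 ω hω f hf).1 (h3 ω hω f hf).2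
    have e1 : s / 2 * √(Real.log n) / B = 2 * (s / (4 * B) * √(Real.log n)) := by
      field_simp
      norm_num
    have : 0 < s / (4 * B) * √(Real.log n) := by positivity
    linarith
  · rw [Set.compl_inter, hadef]
    refine (measure_union_le _ _).trans ?_
    rw [ENNReal.ofReal_add (by positivity) (by positivity)]
    exact add_le_add
      ((hR n).measure_compl_varianceEvent_le hK hC.le (by linarith) (by linarith) hn hε)
      ((hR n).measure_compl_meanEvent_le hK hC.le (by linarith) (by linarith) hn hd0)

end FLMTest

theorem theorem5 {𝒳 𝒴 Ω : ℕ → Type*}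
    [∀ n, NormedAddCommGroup (𝒳 n)] [∀ n, InnerProductSpace ℝ (𝒳 n)] [∀ n, CompleteSpace (𝒳 n)]
    [∀ n, SecondCountableTopology (𝒳 n)] [∀ n, MeasurableSpace (𝒳 n)] [∀ n, BorelSpace (𝒳 n)]
    [∀ n, NormedAddCommGroup (𝒴 n)] [∀ n, InnerProductSpace ℝ (𝒴 n)] [∀ n, CompleteSpace (𝒴 n)]
    [∀ n, SecondCountableTopology (𝒴 n)] [∀ n, MeasurableSpace (𝒴 n)] [∀ n, BorelSpace (𝒴 n)]
    [∀ n, MeasurableSpace (Ω n)] (P : ∀ n, Measure (Ω n)) [∀ n, IsProbabilityMeasure (P n)]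
    (D : ∀ n, FLMTest.Model (𝒳 n) (𝒴 n) (Ω n)) (hD : ∀ n, (D n).IsFLM (P n))
    (e : FLMTest.Consts) (hα₁ : 2 < e.α₁) (hα₂ : 2 < e.α₂) (hτ : e.τ ∈ Set.Ico (0 : ℝ) 1)
    (hδ : e.δ ∈ Set.Ioo (0 : ℝ) (1 / 2)) (hα₀ : e.α₀ ∈ Set.Ioo (0 : ℝ) 1) (hδ₀ : 0 < e.δ₀)
    (htail : FLMTest.TailAssumption P D) (hstruct : FLMTest.StructuralAssumption P D e)
    (hgrowth : FLMTest.GrowthAssumption D e) (hp : Tendsto (fun n => (D n).p) atTop atTop)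
    (CF : ℝ) (hCF : 0 < CF) :
    (∀ ϱ ∈ Set.Ioo (0 : ℝ) 1, ∃ c : ℝ, 0 < c ∧ ∀ n : ℕ, 1 ≤ n →
      ENNReal.ofReal (1 - c * (n : ℝ)⁻¹) ≤ FLMTest.innerProb (P n)
        {ω | ∀ f ∈ (D n).classF (CF * e.rate n (D n).p),
          |(D n).qM e.τ n f ω ϱ| ≤ c * √(Real.log n)}) ∧
    (∃ c : ℝ, 0 < c ∧ ∀ n : ℕ, 1 ≤ n →
      ENNReal.ofReal (1 - c * (n : ℝ)⁻¹) ≤ FLMTest.innerProb (P n)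
        {ω | (⨆ f ∈ (D n).classF (CF * e.rate n (D n).p),
          ENNReal.ofReal (⨆ j, (D n).sdHat n f ω j ^ 2) /
            ENNReal.ofReal ((D n).sdMax (P n) f ^ 2)) < 5}) ∧
    (∀ ϱ ∈ Set.Ioo (0 : ℝ) 1,
      (∃ c : ℝ, 0 < c ∧ ∀ᶠ n : ℕ in atTop,
        c * max ((D n).sdMax (P n) (D n).eigenBases * (n : ℝ) ^ (-(1 / 2) : ℝ) *
          √(Real.log n)) (e.rate n (D n).p) ≤ (D n).signal) →
      Tendsto (fun n : ℕ => FLMTest.innerProb (P n)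
        {ω | ∀ f ∈ (D n).classF (CF * e.rate n (D n).p), (D n).Rejects e.τ n f ϱ ω})
        atTop (𝓝 1)) := by

  obtain ⟨K, c, C, hK, hc, hC, hR⟩ := FLMTest.exists_regular hD htail hstruct
  have hhi : 0 ≤ e.αhi := le_max_of_le_left (by linarith)
  have hr0 : ∀ n, 0 ≤ CF * e.rate n (D n).p := fun n =>
    mul_nonneg hCF.le (FLMTest.Consts.rate_nonneg _ _)
  have hr : Tendsto (fun n => CF * e.rate n (D n).p) atTop (𝓝 0) := by
    simpa using (FLMTest.Consts.tendsto_rate hδ.1 hhi hα₀.1 hp).const_mul CF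
  have hpn := hgrowth.eventually_p_le hδ.1 hhi hα₀.1.le hp
  obtain ⟨v, hv, hsd⟩ :=
    FLMTest.exists_eventually_le_sd_sq hR hK hc hC hα₁ hα₂ hδ.1 hgrowth hp
  refine ⟨fun ϱ hϱ => ?_, ?_, fun ϱ hϱ ⟨s, hs, hsig⟩ => ?_⟩
  · obtain ⟨t, ht, hev⟩ := FLMTest.eventually_abs_qM_le hR hK hC hα₁ hα₂ hr0 hr hτ.2 hpn hϱ
    obtain ⟨c₀, hc₀, h⟩ := FLMTest.exists_forall_ofReal_le_innerProb (fun n hn =>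
      (hR n).measure_compl_varianceEvent_le hK hC.le (by linarith) (by linarith) hn one_pos) hev
    refine ⟨max c₀ t, lt_max_of_lt_left hc₀, fun n hn => (h _ (le_max_left _ _) n hn).trans ?_⟩
    refine FLMTest.innerProb_mono fun ω hω f hf => (hω f hf).trans ?_
    gcongr
    exact le_max_right _ _
  · obtain ⟨c₀, hc₀, h⟩ := FLMTest.exists_forall_ofReal_le_innerProb (fun n hn =>
      (hR n).measure_compl_varianceEvent_le hK hC.le (by linarith) (by linarith) hn
        (show 0 < v / 32 by positivity))
      (FLMTest.eventually_ratio_lt hR hK hC hα₁ hα₂ hr0 hr hv hsd)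
    exact ⟨c₀, hc₀, h c₀ le_rfl⟩
  · refine FLMTest.tendsto_innerProb_rejects hR hK hC hα₁ hα₂ hr0 hr hτ hpn hϱ
      (s := s * √v / 2) (by positivity) ?_
    filter_upwards [FLMTest.eventually_signal_le hR hK hC hα₁ hα₂ hδ.1 hα₀ hgrowth hp hCF hs
      (hsig.mono fun n h => le_trans (by gcongr; exact le_max_right _ _) h), hsig, hsd,
      eventually_ge_atTop 1] with n h1 h2 h3 hn f hf
    obtain ⟨j, hj⟩ := h1 f hf
    obtain ⟨j₀, hj₀⟩ := h3
    refine ⟨j, ?_⟩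
    have hn0 : (0 : ℝ) < n := by exact_mod_cast hn
    have hmax : √v ≤ (D n).sdMax (P n) (D n).eigenBases :=
      (Real.sqrt_le_iff.2 ⟨Real.sqrt_nonneg _, hj₀⟩).trans
        (FLMTest.Model.sd_le_sdMax _ _ _ j₀)
    have hpow : √(n : ℝ) * (n : ℝ) ^ (-(1 / 2) : ℝ) = 1 := by
      rw [Real.sqrt_eq_rpow, ← Real.rpow_add hn0]
      norm_num
    have h4 : s * (√v * (n : ℝ) ^ (-(1 / 2) : ℝ) * √(Real.log n)) ≤ (D n).signal := by
      refine le_trans ?_ h2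
      gcongr
      refine le_trans ?_ (le_max_left _ _)
      gcongr
    calc s * √v / 2 * √(Real.log n)
        = √(n : ℝ) * (n : ℝ) ^ (-(1 / 2) : ℝ) * (s * √v / 2 * √(Real.log n)) := by
          rw [hpow, one_mul]
      _ = √(n : ℝ) * (s * (√v * (n : ℝ) ^ (-(1 / 2) : ℝ) * √(Real.log n)) / 2) := by ring
      _ ≤ √(n : ℝ) * ((D n).signal / 2) := by gcongr
      _ ≤ _ := by gcongr
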